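/- Let $\Sigma$ be a connected, second countable smooth Riemannian manifold of dimension $m$, complete and non-compact, and let $x\colon\Sigma\to\mathbb R^{m+1}$ be a smooth isometric immersion which is a self-shrinker, that is, $x^{\perp}=-\mathbf H$, where $(\cdot)^\perp$ is the projection onto the normal bundle, $\mathbf H=\operatorname{tr}_\Sigma\mathbf A$ is the (unnormalized) mean curvature vector, and $\mathbf A=Ddx$ is the vector-valued second fundamental form. Put $f=|x|^2/2$ and $d\mathrm{vol}_f=e^{-f}\,d\mathrm{vol}$, where $d\mathrm{vol}$ is the Riemannian volume of $\Sigma$. Let $B_R^\Sigma(o)$ denote the geodesic balls of $\Sigma$ and $\mathbb B_R$ the open Euclidean ball of radius $R$ about the origin. Assume that at least one of the following holds: (a) (extrinsic polynomial volume growth) there are $C\in\mathbb R$ and $n\in\mathbb N$ with $\mathrm{vol}\left(x^{-1}(\mathbb B_R)\right)\le C R^n$ for all sufficiently large $R$; (b) $\mathrm{vol}_f\left(B_R^\Sigma(o)\right)=O(R^2)$ as $R\to\infty$, for some $o\in\Sigma$; (c) there is a real number $p>1$ such that $|\mathbf A|^2\in L^p(d\mathrm{vol}_f)$ and $|\mathbf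 A|^2\le 1+\frac1p$ on $\Sigma$. Then, for every hyperplane $\Pi$ through the origin of $\mathbb R^{m+1}$: if $x(\Sigma)$ is contained in one of the two closed half-spaces determined by $\Pi$, then $\Sigma=\Pi$, i.e. $x$ is injective and $x(\Sigma)=\Pi$. -/

import Mathlib

open scoped Manifold ContDiff ENNReal Topology RealInnerProductSpace
open Filter MeasureTheory Bundle

noncomputable section

namespace SelfShrinker

section Volume

variable {m : ℕ} {M : Type*} [MetricSpace M]
  [ChartedSpace (EuclideanSpace ℝ (Fin m)) M]
  [RiemannianBundle (fun p : M => TangentSpace (𝓡 m) p)]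

/-- The matrix `g_ij = g(∂_i, ∂_j)` of the Riemannian metric of `M` in the coordinates given by
the preferred chart at `c`, at the coordinate point `u` of the target of that chart. (Here and below, `letI` only makes Lean
regard a vector space as a manifold through its identity chart.) -/
def metricMatrix (c : M) (u : EuclideanSpace ℝ (Fin m)) : Matrix (Fin m) (Fin m) ℝ :=
  letI := chartedSpaceSelf (EuclideanSpace ℝ (Fin m))
  Matrix.of fun i j =>
    inner ℝ
      (mfderiv (𝓡 m) (𝓡 m) (extChartAt (𝓡 m) c).symm u (EuclideanSpace.single i (1 : ℝ)))
      (mfderiv (𝓡 m) (𝓡 m) (extChartAt (𝓡 m) c).symm u (EuclideanSpace.single j (1 : ℝ)))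

variable [MeasurableSpace M]

/-- The Riemannian volume on the domain of the preferred chart at `c`, extended by zero to `M`:
the image under the inverse chart of the measure `√(det g_ij) du` on the target of the chart. -/
def chartVolume (c : M) : Measure M :=
  Measure.map (extChartAt (𝓡 m) c).symm
    ((volume.restrict (extChartAt (𝓡 m) c).target).withDensity
      fun u => ENNReal.ofReal (Real.sqrt (metricMatrix c u).det))

variable (m M) in
/-- The Riemannian volume measure of `M`. The measures `chartVolume c` agree on the overlaps of
the chart domains, and countably many chart domains cover `M`; so their supremum in the complete
lattice of measures is the measure which restricts to `√(det g_ij) du` on every chart domain. -/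
def riemannianVolume : Measure M := ⨆ c : M, chartVolume (m := m) c

/-- The weighted volume `dvol_f = e^{-f} dvol` of an immersion `x`, where `f = |x|² / 2`. -/
def weightedVolume (x : M → EuclideanSpace ℝ (Fin (m + 1))) : Measure M :=
  (riemannianVolume m M).withDensity fun p => ENNReal.ofReal (Real.exp (-(‖x p‖ ^ 2 / 2)))

end Volume

section Immersion

variable {m : ℕ} {M : Type*} [MetricSpace M]
  [ChartedSpace (EuclideanSpace ℝ (Fin m)) M]

/-- The differential of `x : M → ℝ^{m+1}` at `p`, with values in `ℝ^{m+1}`. -/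
def differential (x : M → EuclideanSpace ℝ (Fin (m + 1))) (p : M) :
    TangentSpace (𝓡 m) p →L[ℝ] EuclideanSpace ℝ (Fin (m + 1)) :=
  letI := chartedSpaceSelf (EuclideanSpace ℝ (Fin (m + 1)))
  mfderiv (𝓡 m) 𝓘(ℝ, EuclideanSpace ℝ (Fin (m + 1))) x p

/-- The orthogonal projection `y ↦ y^⊥` of `ℝ^{m+1}` onto the normal space of `x` at `p`, that is
onto the orthogonal complement of the image of the differential. -/
def normalPart (x : M → EuclideanSpace ℝ (Fin (m + 1))) (p : M)
    (y : EuclideanSpace ℝ (Fin (m + 1))) : EuclideanSpace ℝ (Fin (m + 1)) :=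
  ((differential x p).toLinearMap.range)ᗮ.starProjection y

/-- The second fundamental form `A = D dx` of `x` at `p`: the normal part of the second
derivative of `x` read in a chart at `p`. The chart is the one in which Mathlib writes the tangent
vectors at `p`. -/
def secondFundamentalForm (x : M → EuclideanSpace ℝ (Fin (m + 1))) (p : M)
    (v w : TangentSpace (𝓡 m) p) : EuclideanSpace ℝ (Fin (m + 1)) :=
  let X : EuclideanSpace ℝ (Fin m) → EuclideanSpace ℝ (Fin (m + 1)) :=
    x ∘ (extChartAt (𝓡 m) p).symm
  normalPart x p
    (fderiv ℝ (fderiv ℝ X) (extChartAt (𝓡 m) p p)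
      (v : EuclideanSpace ℝ (Fin m)) (w : EuclideanSpace ℝ (Fin m)))

instance (p : M) : FiniteDimensional ℝ (TangentSpace (𝓡 m) p) :=
  inferInstanceAs (FiniteDimensional ℝ (EuclideanSpace ℝ (Fin m)))

variable [RiemannianBundle (fun p : M => TangentSpace (𝓡 m) p)]

/-- The mean curvature vector `H = tr A`, the (unnormalized) trace being taken with respect to the
Riemannian metric. -/
def meanCurvatureVector (x : M → EuclideanSpace ℝ (Fin (m + 1))) (p : M) :
    EuclideanSpace ℝ (Fin (m + 1)) :=
  ∑ i, secondFundamentalForm x p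
    (stdOrthonormalBasis ℝ (TangentSpace (𝓡 m) p) i)
    (stdOrthonormalBasis ℝ (TangentSpace (𝓡 m) p) i)

/-- The squared norm `|A|²` of the second fundamental form, with respect to the Riemannian
metric. -/
def normSqA (x : M → EuclideanSpace ℝ (Fin (m + 1))) (p : M) : ℝ :=
  ∑ i, ∑ j, ‖secondFundamentalForm x p
    (stdOrthonormalBasis ℝ (TangentSpace (𝓡 m) p) i)
    (stdOrthonormalBasis ℝ (TangentSpace (𝓡 m) p) j)‖ ^ 2

/-- `x : M → ℝ^{m+1}` is a smooth isometric immersion: it is smooth and the Riemannian metric of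
`M` is the one induced by `x`. -/
structure IsIsometricImmersion (x : M → EuclideanSpace ℝ (Fin (m + 1))) : Prop where
  smooth : letI := chartedSpaceSelf (EuclideanSpace ℝ (Fin (m + 1)))
    ContMDiff (𝓡 m) 𝓘(ℝ, EuclideanSpace ℝ (Fin (m + 1))) ∞ x
  inner_eq : ∀ (p : M) (v w : TangentSpace (𝓡 m) p),
    inner ℝ (differential x p v) (differential x p w) = inner ℝ v w

/-- `x : M → ℝ^{m+1}` is a self-shrinker (based at the origin): an isometrically immersed
hypersurface with `x^⊥ = -H`. Connectedness is asked of `M` itself. -/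
structure IsSelfShrinker (x : M → EuclideanSpace ℝ (Fin (m + 1))) : Prop
    extends IsIsometricImmersion x where
  shrinker_eq : ∀ p : M, normalPart x p (x p) = -meanCurvatureVector x p

variable [MeasurableSpace M]

/-- Extrinsic polynomial volume growth: the part of the immersed hypersurface lying in the
Euclidean ball of radius `R` about the origin has volume at most `C R^n` for all large `R`. -/
def HasExtrinsicPolynomialVolumeGrowth (x : M → EuclideanSpace ℝ (Fin (m + 1))) : Prop :=
  ∃ (C : ℝ) (n : ℕ), ∀ᶠ R : ℝ in atTop,
    riemannianVolume m M (x ⁻¹' Metric.ball 0 R) ≤ ENNReal.ofReal (C * R ^ n)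

/-- `vol_f (B_R) = O(R²)` as `R → ∞`, for the geodesic balls about some point. -/
def HasQuadraticWeightedVolumeGrowth (x : M → EuclideanSpace ℝ (Fin (m + 1))) : Prop :=
  ∃ (o : M) (C : ℝ), ∀ᶠ R : ℝ in atTop,
    weightedVolume x (Metric.ball o R) ≤ ENNReal.ofReal (C * R ^ 2)

/-- For some real `p > 1`, `|A|² ∈ L^p(dvol_f)` and `|A|² ≤ 1 + 1/p`. -/
def HasCurvatureBound (x : M → EuclideanSpace ℝ (Fin (m + 1))) : Prop :=
  ∃ p : ℝ, 1 < p ∧ MemLp (normSqA x) (ENNReal.ofReal p) (weightedVolume x) ∧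
    ∀ q : M, normSqA x q ≤ 1 + 1 / p

end Immersion

end SelfShrinker

end

/-! Let L = Δ - ⟨x, ∇·⟩ be the drift Laplacian, which is symmetric for dvol_f. The shrinker equation
makes every coordinate of the position vector satisfy L u = -u (`Patch.driftLap_inner_Y`). A height
u = ⟨a, x⟩ ≥ 0 therefore has L u ≤ 0, and the strong maximum principle (`inner_eq_zero_or_pos`)
leaves two cases: u vanishes identically, or u is positive everywhere.

If u = 0, then x is locally an isometry into the hyperplane. Completeness (through Hopf-Rinow) makes
it preserve all distances and cover the hyperplane (`eq_hyperplane_of_inner_eq_zero`).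

The case u > 0 is impossible. Testing L u = -u against φ²/u gives the stability inequality ∫ φ² ≤ ∫
|∇φ|² for dvol_f (`integral_sq_le_integral_gradInner`). With distance cutoffs it becomes vol_f(B_R)
≤ R⁻² vol_f(B_{2R}). Under quadratic growth one application bounds the volumes and a second one
forces them to be zero (`not_hasQuadraticWeightedVolumeGrowth`). Extrinsic polynomial growth makes
the total weighted volume finite because of the Gaussian factor, so it reduces to quadratic growth.

Under the curvature bound, Simons' inequality L|A|² ≥ 2|A|²(1 - |A|²) + |∇|A|²|² / (2|A|²), valid
where A ≠ 0 (`simons`, `exists_hasDriftLap_normSqA`), is combined with stability into a Caccioppoli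
inequality (`integral_caccioppoli`). Letting the cutoff radius tend to infinity shows that |A|² is
constant. If the constant is nonzero, integrability gives finite weighted volume, already excluded.
If it is zero, the image is a hyperplane through the origin, so x takes the value 0, where u cannot
be positive.

Local computations take place in graph patches over tangent hyperplanes (`Patch`), where the height
h of the graph and its differential vanish at the centre. L is an explicit operator there and is
shown not to depend on the patch. Cutoffs built from the distance are only Lipschitz, so integration
by parts is proved for Lipschitz test functions by way of Rademacher's theorem. -/

noncomputable section

namespace SelfShrinker
-- Isometric immersions read in charts, and lengths of paths.
section Charts
variable {m : ℕ} {M : Type*} [MetricSpace M] [ChartedSpace (EuclideanSpace ℝ (Fin m)) M]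
  [RiemannianBundle (fun p : M => TangentSpace (𝓡 m) p)]
  {x : M → EuclideanSpace ℝ (Fin (m + 1))}
theorem IsIsometricImmersion.contMDiff (hx : IsIsometricImmersion x) :
    ContMDiff (𝓡 m) 𝓘(ℝ, EuclideanSpace ℝ (Fin (m + 1))) ∞ x := hx.smooth
theorem IsIsometricImmersion.mdifferentiableAt (hx : IsIsometricImmersion x) (p : M) :
    MDifferentiableAt (𝓡 m) 𝓘(ℝ, EuclideanSpace ℝ (Fin (m + 1))) x p :=
  (hx.contMDiff p).mdifferentiableAt (by simp)
-- Tangent vectors at `p` are written in the preferred chart at `p`, so no coordinate change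
-- intervenes.
theorem differential_eq_fderiv (hx : IsIsometricImmersion x) (p : M)
    (v : TangentSpace (𝓡 m) p) : differential x p v =
      fderiv ℝ (x ∘ (extChartAt (𝓡 m) p).symm) (extChartAt (𝓡 m) p p) v := by
  have := (hx.mdifferentiableAt p).mfderiv
  rw [differential, this]
  simp only [writtenInExtChartAt, fderivWithin_univ, ModelWithCorners.range_eq_univ]
  rfl
variable [IsManifold (𝓡 m) ∞ M]
theorem IsIsometricImmersion.contDiffOn (hx : IsIsometricImmersion x) (c : M) :
    ContDiffOn ℝ ∞ (x ∘ (extChartAt (𝓡 m) c).symm) (extChartAt (𝓡 m) c).target := by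
  rw [← contMDiffOn_iff_contDiffOn]
  exact hx.contMDiff.comp_contMDiffOn (contMDiffOn_extChartAt_symm c)
-- The chain rule moves the Riemannian inner product into the ambient space. From here on the metric
-- is handled only as a Gram matrix of derivatives of `x`.
theorem metricMatrix_apply (hx : IsIsometricImmersion x) (c : M) {u : EuclideanSpace ℝ (Fin m)}
    (hu : u ∈ (extChartAt (𝓡 m) c).target) (i j : Fin m) :
    metricMatrix c u i j =
      inner ℝ (fderiv ℝ (x ∘ (extChartAt (𝓡 m) c).symm) u (EuclideanSpace.single i (1 : ℝ)))
       (fderiv ℝ (x ∘ (extChartAt (𝓡 m) c).symm) u (EuclideanSpace.single j (1 : ℝ))) := by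
  have hs : MDifferentiableAt (𝓡 m) (𝓡 m) (extChartAt (𝓡 m) c).symm u := by
    have := (contMDiffOn_extChartAt_symm (I := 𝓡 m) (n := ∞) c).contMDiffAt
      ((isOpen_extChartAt_target c).mem_nhds hu)
    exact this.mdifferentiableAt (by simp)
  have h1 : ∀ v : EuclideanSpace ℝ (Fin m),
      fderiv ℝ (x ∘ (extChartAt (𝓡 m) c).symm) u v =
        differential x ((extChartAt (𝓡 m) c).symm u)
          (mfderiv (𝓡 m) (𝓡 m) (extChartAt (𝓡 m) c).symm u v) := by
    intro v
    rw [← mfderiv_eq_fderiv, mfderiv_comp u (hx.mdifferentiableAt _) hs]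
    rfl
  rw [h1, h1, hx.inner_eq]
  rfl
omit [IsManifold (𝓡 m) ∞ M] in
theorem enorm_differential (hx : IsIsometricImmersion x) (p : M) (v : TangentSpace (𝓡 m) p) :
    ‖differential x p v‖ₑ = ‖v‖ₑ := by
  have h := hx.inner_eq p v v
  rw [real_inner_self_eq_norm_sq, real_inner_self_eq_norm_sq] at h
  have h' : ‖differential x p v‖ = ‖v‖ :=
    (pow_left_inj₀ (norm_nonneg _) (norm_nonneg _) two_ne_zero).1 h
  rw [← ofReal_norm, ← ofReal_norm, h']
omit [IsManifold (𝓡 m) ∞ M] in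
theorem enorm_mfderiv_path (hx : IsIsometricImmersion x) {γ : ℝ → M} {t : ℝ}
    (hγ : MDifferentiableAt 𝓘(ℝ, ℝ) (𝓡 m) γ t) :
    ‖mfderiv 𝓘(ℝ, ℝ) (𝓡 m) γ t (1 : ℝ)‖ₑ = ‖deriv (x ∘ γ) t‖ₑ := by
  rw [← enorm_differential hx, ← fderiv_apply_one_eq_deriv, ← mfderiv_eq_fderiv,
    mfderiv_comp t (hx.mdifferentiableAt _) hγ]
  rfl
omit [IsManifold (𝓡 m) ∞ M] in
theorem pathELength_eq_lintegral_deriv (hx : IsIsometricImmersion x) {γ : ℝ → M} {a b : ℝ}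
    (hγ : ContMDiffOn 𝓘(ℝ, ℝ) (𝓡 m) 1 γ (Set.Icc a b)) :
    Manifold.pathELength (𝓡 m) γ a b = ∫⁻ t in Set.Icc a b, ‖deriv (x ∘ γ) t‖ₑ := by
  rw [Manifold.pathELength_eq_lintegral_mfderiv_Ioo, ← restrict_Ioo_eq_restrict_Icc]
  refine setLIntegral_congr_fun measurableSet_Ioo fun t ht => ?_
  exact enorm_mfderiv_path hx
    ((hγ.contMDiffAt (Icc_mem_nhds ht.1 ht.2)).mdifferentiableAt one_ne_zero)
omit [IsManifold (𝓡 m) ∞ M] in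
-- A path and its image under `x` have the same length, and a chord is never longer than a curve
-- with the same ends.
theorem lipschitzWith_immersion [IsRiemannianManifold (𝓡 m) M] (hx : IsIsometricImmersion x) :
    LipschitzWith 1 x := by
  intro p q
  rw [ENNReal.coe_one, one_mul, IsRiemannianManifold.out (I := 𝓡 m) p q]
  refine le_of_forall_gt fun r hr => ?_
  obtain ⟨γ, h0, h1, hγ, hlen⟩ := Manifold.exists_lt_of_riemannianEDist_lt hr
  refine lt_of_le_of_lt ?_ hlen
  rw [pathELength_eq_lintegral_deriv hx hγ]
  have D : ContDiffOn ℝ 1 (x ∘ γ) (Set.Icc 0 1) := by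
    rw [← contMDiffOn_iff_contDiffOn]
    exact (hx.contMDiff.of_le (by simp)).comp_contMDiffOn hγ
  have := enorm_sub_le_lintegral_derivWithin_Icc_of_contDiffOn_Icc D zero_le_one
  rw [edist_comm, edist_eq_enorm_sub, ← h0, ← h1]
  refine this.trans_eq ?_
  rw [← restrict_Ioo_eq_restrict_Icc]
  refine setLIntegral_congr_fun measurableSet_Ioo fun t ht => ?_
  simp only [derivWithin_of_mem_nhds (Icc_mem_nhds ht.1 ht.2)]
end Charts

/-! ### Orthogonal splitting of the ambient space into a hyperplane and its normal. -/

section LinearAlgebra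

variable {m : ℕ}

/-- The range of an injective `D` has dimension m, so it is a copy of the model space and its
orthogonal complement is a line. -/
theorem exists_isometry_normal
    (D : EuclideanSpace ℝ (Fin m) →L[ℝ] EuclideanSpace ℝ (Fin (m + 1)))
    (hD : Function.Injective D) :
    ∃ (E : EuclideanSpace ℝ (Fin m) →ₗᵢ[ℝ] EuclideanSpace ℝ (Fin (m + 1)))
      (ν : EuclideanSpace ℝ (Fin (m + 1))), ‖ν‖ = 1 ∧ (∀ v, inner ℝ ν (E v) = 0) ∧
      (∀ v, ∃ w, D v = E w) := by
  set K := D.toLinearMap.range with hK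
  have hrank : Module.finrank ℝ K = m := by
    rw [hK, LinearMap.finrank_range_of_inj hD]; simp
  let e : K ≃ₗᵢ[ℝ] EuclideanSpace ℝ (Fin m) :=
    ((stdOrthonormalBasis ℝ K).reindex (finCongr hrank)).repr
  have hperp : Module.finrank ℝ Kᗮ = 1 := by
    have := K.finrank_add_finrank_orthogonal
    simp only [finrank_euclideanSpace, Fintype.card_fin] at this
    omega
  obtain ⟨n, hn⟩ := (Module.finrank_pos_iff_exists_ne_zero (R := ℝ) (M := Kᗮ)).1 (by omega)
  have hn' : (n : EuclideanSpace ℝ (Fin (m + 1))) ≠ 0 := by simpa using hn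
  refine ⟨K.subtypeₗᵢ.comp e.symm.toLinearIsometry, ‖(n : EuclideanSpace ℝ (Fin (m + 1)))‖⁻¹ • n,
    ?_, ?_, ?_⟩
  · rw [norm_smul, norm_inv, norm_norm, inv_mul_cancel₀ (norm_ne_zero_iff.2 hn')]
  · intro v
    have := (Submodule.mem_orthogonal' K _).1 n.2 _ (e.symm v).2
    simp [inner_smul_left, this]
  · intro v
    refine ⟨e ⟨D v, ⟨v, rfl⟩⟩, ?_⟩
    simp

/-- A dimension count shows that `E` and `ν` together span. The two components are then read off by
the adjoint of `E` and by pairing with `ν`. -/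
theorem decompose_normal (E : EuclideanSpace ℝ (Fin m) →ₗᵢ[ℝ] EuclideanSpace ℝ (Fin (m + 1)))
    {ν : EuclideanSpace ℝ (Fin (m + 1))} (hν : ‖ν‖ = 1) (horth : ∀ v, inner ℝ ν (E v) = 0)
    (z : EuclideanSpace ℝ (Fin (m + 1))) :
    z = E (E.toContinuousLinearMap.adjoint z) + (inner ℝ ν z : ℝ) • ν := by
  have hAE : ∀ v, E.toContinuousLinearMap.adjoint (E v) = v := by
    intro v
    refine ext_inner_right ℝ fun w => ?_
    rw [ContinuousLinearMap.adjoint_inner_left]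
    exact E.inner_map_map v w
  have hAν : E.toContinuousLinearMap.adjoint ν = 0 := by
    refine ext_inner_right ℝ fun w => ?_
    rw [ContinuousLinearMap.adjoint_inner_left, inner_zero_left]
    exact horth w
  have hν0 : ν ≠ 0 := fun h0 => by simp [h0] at hν
  have hνν : (inner ℝ ν ν : ℝ) = 1 := by rw [real_inner_self_eq_norm_sq, hν]; norm_num
  -- the linear map `(v, t) ↦ E v + t ν` is injective, hence surjective
  let T : (EuclideanSpace ℝ (Fin m) × ℝ) →ₗ[ℝ] EuclideanSpace ℝ (Fin (m + 1)) :=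
    E.toLinearMap.coprod (LinearMap.toSpanSingleton ℝ _ ν)
  have hT : ∀ w, T w = E w.1 + w.2 • ν := fun w => by simp [T]
  have hinj : Function.Injective T := by
    rw [← LinearMap.ker_eq_bot, LinearMap.ker_eq_bot']
    intro w hw
    rw [hT] at hw
    have h2 : w.2 = 0 := by
      have := congrArg (inner ℝ ν) hw
      simpa [inner_add_right, inner_smul_right, horth, hνν, hν0] using this
    have h1 : w.1 = 0 := by
      have := congrArg E.toContinuousLinearMap.adjoint hw
      simpa [hAE, h2] using this
    exact Prod.ext h1 h2
  have hsurj : Function.Surjective T := by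
    refine (LinearMap.injective_iff_surjective_of_finrank_eq_finrank ?_).1 hinj
    simp
  obtain ⟨w, rfl⟩ := hsurj z
  rw [hT, map_add, map_smul, hAE, hAν, inner_add_right, horth, inner_smul_right, hνν]
  simp

end LinearAlgebra

/-! ### Local graph parametrizations over tangent hyperplanes. -/

section Patch

variable {m : ℕ} {M : Type*} [MetricSpace M] [ChartedSpace (EuclideanSpace ℝ (Fin m)) M]

/-- A parametrization of a neighbourhood of `p` in an immersed hypersurface as the graph of a
function `h` over a ball in the tangent hyperplane at `p`. -/
structure Patch (x : M → EuclideanSpace ℝ (Fin (m + 1))) (p : M) where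
  E : EuclideanSpace ℝ (Fin m) →ₗᵢ[ℝ] EuclideanSpace ℝ (Fin (m + 1))
  ν : EuclideanSpace ℝ (Fin (m + 1))
  norm_ν : ‖ν‖ = 1
  inner_ν : ∀ v, inner ℝ ν (E v) = 0
  h : EuclideanSpace ℝ (Fin m) → ℝ
  smooth : ContDiff ℝ ∞ h
  h_zero : h 0 = 0
  fderiv_zero : fderiv ℝ h 0 = 0
  e : OpenPartialHomeomorph M (EuclideanSpace ℝ (Fin m))
  r : ℝ
  r_pos : 0 < r
  target_eq : e.target = Metric.ball 0 r
  mem_source : p ∈ e.source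
  e_self : e p = 0
  x_symm : ∀ y ∈ Metric.ball (0 : EuclideanSpace ℝ (Fin m)) r,
    x (e.symm y) = x p + E y + h y • ν
  contMDiffOn_symm : ContMDiffOn (𝓡 m) (𝓡 m) ∞ e.symm (Metric.ball 0 r)
  source_subset : e.source ⊆ (extChartAt (𝓡 m) p).source

variable [RiemannianBundle (fun p : M => TangentSpace (𝓡 m) p)] [IsManifold (𝓡 m) ∞ M]
  {x : M → EuclideanSpace ℝ (Fin (m + 1))}

omit [IsManifold (𝓡 m) ∞ M] in
theorem injective_fderiv_chart (hx : IsIsometricImmersion x) (p : M) :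
    Function.Injective (fderiv ℝ (x ∘ (extChartAt (𝓡 m) p).symm) (extChartAt (𝓡 m) p p)) := by
  refine (injective_iff_map_eq_zero _).2 fun v hv => ?_
  have h1 : differential x p v = 0 := (differential_eq_fderiv hx p v).trans hv
  have h2 := hx.inner_eq p v v
  rw [h1, inner_zero_left] at h2
  exact (inner_self_eq_zero (𝕜 := ℝ) (E := TangentSpace (𝓡 m) p)).1 h2.symm

/-- The inverse function theorem applied to the tangential projection of `x`; the normal component,
as a function of the tangential one, is the height of the graph. -/
theorem exists_patch (hx : IsIsometricImmersion x) (p : M) : Nonempty (Patch x p) := by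
  set φ := extChartAt (𝓡 m) p with hφ
  set u₀ := φ p with hu₀
  set X := x ∘ φ.symm with hX
  have htarget : IsOpen φ.target := isOpen_extChartAt_target p
  have hu₀t : u₀ ∈ φ.target := mem_extChartAt_target p
  have hXsmooth : ContDiffOn ℝ ∞ X φ.target := hx.contDiffOn p
  have hXat : ∀ u ∈ φ.target, ContDiffAt ℝ ∞ X u := fun u hu =>
    hXsmooth.contDiffAt (htarget.mem_nhds hu)
  obtain ⟨E, ν, hν, horth, hrange⟩ := exists_isometry_normal _ (injective_fderiv_chart hx p)
  set A := E.toContinuousLinearMap.adjoint with hA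
  have hAE : ∀ v, A (E v) = v := by
    intro v
    refine ext_inner_right ℝ fun w => ?_
    rw [ContinuousLinearMap.adjoint_inner_left]
    exact E.inner_map_map v w
  set θ : EuclideanSpace ℝ (Fin m) → EuclideanSpace ℝ (Fin m) := fun u => A (X u - X u₀) with hθ
  have hθat : ∀ u ∈ φ.target, ContDiffAt ℝ ∞ θ u := fun u hu =>
    A.contDiff.contDiffAt.comp u ((hXat u hu).sub contDiffAt_const)
  have hθ' : ∀ u ∈ φ.target, HasFDerivAt θ (A.comp (fderiv ℝ X u)) u := fun u hu =>
    A.hasFDerivAt.comp u ((((hXat u hu).differentiableAt (by simp)).hasFDerivAt).sub_const _)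
  have hinj : Function.Injective (A.comp (fderiv ℝ X u₀)) := by
    refine (injective_iff_map_eq_zero _).2 fun v hv => ?_
    obtain ⟨w, hw⟩ := hrange v
    have : A (fderiv ℝ X u₀ v) = 0 := hv
    rw [hw, hAE] at this
    rw [this, map_zero] at hw
    exact injective_fderiv_chart hx p (hw.trans (map_zero _).symm)
  let L : EuclideanSpace ℝ (Fin m) ≃L[ℝ] EuclideanSpace ℝ (Fin m) :=
    (LinearEquiv.ofInjectiveEndo (A.comp (fderiv ℝ X u₀)).toLinearMap hinj).toContinuousLinearEquiv
  have hL : (L : EuclideanSpace ℝ (Fin m) →L[ℝ] EuclideanSpace ℝ (Fin m)) =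
      A.comp (fderiv ℝ X u₀) := by ext v; rfl
  have hderiv : HasFDerivAt θ (L : EuclideanSpace ℝ (Fin m) →L[ℝ] EuclideanSpace ℝ (Fin m)) u₀ := by
    rw [hL]; exact hθ' u₀ hu₀t
  set g₀ := (hθat u₀ hu₀t).toOpenPartialHomeomorph θ hderiv (by simp) with hg₀
  have hg₀coe : (g₀ : _ → _) = θ := ContDiffAt.toOpenPartialHomeomorph_coe _ _ _
  have hu₀g : u₀ ∈ g₀.source := ContDiffAt.mem_toOpenPartialHomeomorph_source _ _ _
  -- the open set where the derivative of `θ` is invertible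
  have hinv : ∀ᶠ u in 𝓝 u₀, ∃ L' : EuclideanSpace ℝ (Fin m) ≃L[ℝ] EuclideanSpace ℝ (Fin m),
      HasFDerivAt θ (L' : EuclideanSpace ℝ (Fin m) →L[ℝ] EuclideanSpace ℝ (Fin m)) u := by
    have hcont : ContinuousAt (fun u => A.comp (fderiv ℝ X u)) u₀ :=
      (continuous_const.clm_comp continuous_id).continuousAt.comp
        (((hXat u₀ hu₀t).fderiv_right (m := 0) (by simp)).continuousAt)
    have : Set.range ((↑) : (EuclideanSpace ℝ (Fin m) ≃L[ℝ] EuclideanSpace ℝ (Fin m)) → _) ∈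
        𝓝 (A.comp (fderiv ℝ X u₀)) := by
      rw [← hL]; exact ContinuousLinearEquiv.nhds L
    filter_upwards [hcont this, htarget.mem_nhds hu₀t] with u ⟨L', hL'⟩ hut
    refine ⟨L', ?_⟩
    rw [hL']; exact hθ' u hut
  -- Restricting to `O` makes the local inverse smooth on its whole domain and not only at the
  -- centre.
  obtain ⟨O, hO, hOopen, hu₀O⟩ := eventually_nhds_iff.1 hinv
  let g := g₀.restrOpen (O ∩ φ.target) (hOopen.inter htarget)
  have hgs : g.source = g₀.source ∩ (O ∩ φ.target) := g₀.restrOpen_source _ _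
  have hgcoe : (g : _ → _) = θ := hg₀coe
  have hu₀gs : u₀ ∈ g.source := by rw [hgs]; exact ⟨hu₀g, hu₀O, hu₀t⟩
  have hgu₀ : g u₀ = 0 := by rw [hgcoe]; simp [hθ]
  have h0t : (0 : EuclideanSpace ℝ (Fin m)) ∈ g.target := hgu₀ ▸ g.map_source hu₀gs
  have hgsymm0 : g.symm 0 = u₀ := by rw [← hgu₀]; exact g.left_inv hu₀gs
  have hsymm : ∀ y ∈ g.target, ContDiffAt ℝ ∞ g.symm y := by
    intro y hy
    have hys := g.map_target hy
    rw [hgs] at hys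
    obtain ⟨L', hL'⟩ := hO _ hys.2.1
    refine g.contDiffAt_symm hy (f₀' := L') ?_ ?_
    · rw [hgcoe]; exact hL'
    · rw [hgcoe]; exact hθat _ hys.2.2
  obtain ⟨R, hR, hball⟩ := Metric.isOpen_iff.1 g.open_target 0 h0t
  set σ := g.symm with hσ
  have hσt : ∀ y ∈ g.target, σ y ∈ φ.target := fun y hy => by
    have hys := g.map_target hy
    rw [hgs] at hys
    exact hys.2.2
  set h₀ : EuclideanSpace ℝ (Fin m) → ℝ := fun y => inner ℝ ν (X (σ y) - X u₀) with hh₀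
  have hh₀at : ∀ y ∈ g.target, ContDiffAt ℝ ∞ h₀ y := fun y hy =>
    contDiffAt_const.inner ℝ (((hXat _ (hσt y hy)).comp y (hsymm y hy)).sub contDiffAt_const)
  -- The bump extends the height to a globally smooth function, so that later calculus needs no
  -- domain conditions. On the ball of radius `R / 4`, which becomes the patch, nothing changes.
  let β : ContDiffBump (0 : EuclideanSpace ℝ (Fin m)) := ⟨R / 4, R / 2, by positivity, by linarith⟩
  set h : EuclideanSpace ℝ (Fin m) → ℝ := fun y => β y * h₀ y with hh
  have hh_eq : ∀ y ∈ Metric.ball (0 : EuclideanSpace ℝ (Fin m)) (R / 4), h y = h₀ y := by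
    intro y hy
    have : β y = 1 := β.one_of_mem_closedBall (Metric.ball_subset_closedBall hy)
    simp [hh, this]
  have hhsmooth : ContDiff ℝ ∞ h := by
    refine contDiff_iff_contDiffAt.2 fun y => ?_
    by_cases hy : y ∈ Metric.ball (0 : EuclideanSpace ℝ (Fin m)) R
    · exact β.contDiffAt.mul (hh₀at y (hball hy))
    · have : h =ᶠ[𝓝 y] fun _ => 0 := by
        have hy' : y ∉ tsupport β := by
          rw [β.tsupport_eq]
          intro hy'
          exact hy (Metric.closedBall_subset_ball (by change R / 2 < R; linarith) hy')
        filter_upwards [(isClosed_tsupport β).isOpen_compl.mem_nhds hy'] with z hz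
        have : β z = 0 := image_eq_zero_of_notMem_tsupport hz
        simp [hh, this]
      exact contDiffAt_const.congr_of_eventuallyEq this
  have hball4 : Metric.ball (0 : EuclideanSpace ℝ (Fin m)) (R / 4) ⊆ g.target :=
    (Metric.ball_subset_ball (by linarith)).trans hball
  have hfd : fderiv ℝ h 0 = 0 := by
    have h1 : h =ᶠ[𝓝 0] h₀ := by
      filter_upwards [Metric.ball_mem_nhds (0 : EuclideanSpace ℝ (Fin m))
        (show 0 < R / 4 by positivity)] with y hy using hh_eq y hy
    rw [h1.fderiv_eq]
    have h2 : HasFDerivAt (X ∘ σ) ((fderiv ℝ X u₀).comp (fderiv ℝ σ 0)) 0 := by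
      refine HasFDerivAt.comp 0 ?_ ((hsymm 0 h0t).differentiableAt (by simp)).hasFDerivAt
      rw [hgsymm0]
      exact ((hXat u₀ hu₀t).differentiableAt (by simp)).hasFDerivAt
    have h3 : HasFDerivAt h₀
        ((innerSL ℝ ν).comp ((fderiv ℝ X u₀).comp (fderiv ℝ σ 0))) 0 :=
      (innerSL ℝ ν).hasFDerivAt.comp 0 (h2.sub_const _)
    rw [h3.fderiv]
    ext v
    obtain ⟨w, hw⟩ := hrange (fderiv ℝ σ 0 v)
    simp only [ContinuousLinearMap.comp_apply, innerSL_apply_apply]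
    rw [hw, horth]
    simp
  let e₁ := (chartAt (EuclideanSpace ℝ (Fin m)) p).trans g
  have he₁φ : ∀ q, e₁ q = g (φ q) := fun q => by simp [e₁, hφ]
  have he₁symm : ∀ y, e₁.symm y = φ.symm (σ y) := fun y => by simp [e₁, hφ, hσ]
  have htsub : g.source ⊆ (chartAt (EuclideanSpace ℝ (Fin m)) p).target := by
    rw [hgs]
    intro u hu
    simpa [hφ] using hu.2.2
  have he₁t : e₁.target = g.target := by
    rw [OpenPartialHomeomorph.trans_target]
    refine Set.inter_eq_left.2 fun y hy => htsub (g.map_target hy)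
  let e := (e₁.symm.restrOpen (Metric.ball 0 (R / 4)) Metric.isOpen_ball).symm
  have het : e.target = Metric.ball 0 (R / 4) := by
    change (e₁.symm.restrOpen (Metric.ball 0 (R / 4)) Metric.isOpen_ball).source = _
    rw [OpenPartialHomeomorph.restrOpen_source, OpenPartialHomeomorph.symm_source, he₁t]
    exact Set.inter_eq_right.2 hball4
  have hesymm : ∀ y, e.symm y = φ.symm (σ y) := he₁symm
  have hecoe : ∀ q, e q = g (φ q) := he₁φ
  have hesrc : e.source ⊆ φ.source := by
    intro q hq
    have h1 := e.map_source hq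
    have h2 := e.left_inv hq
    rw [hesymm] at h2
    rw [← h2]
    exact φ.map_target (hσt _ (hball4 (het ▸ h1)))
  have hep : e p = 0 := by rw [hecoe, ← hu₀, hgu₀]
  have hmem : p ∈ e.source := by
    have h0 : (0 : EuclideanSpace ℝ (Fin m)) ∈ e.target := by
      rw [het]; exact Metric.mem_ball_self (by positivity)
    have h1 := e.map_target h0
    rw [hesymm, hgsymm0, hu₀] at h1
    rwa [extChartAt_to_inv] at h1
  refine ⟨⟨E, ν, hν, horth, h, hhsmooth, ?_, hfd, e, R / 4, by positivity, het, hmem, hep, ?_, ?_,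
    hesrc⟩⟩
  · rw [hh_eq 0 (Metric.mem_ball_self (by positivity))]
    simp [hh₀, hgsymm0]
  · intro y hy
    have h1 : θ (σ y) = y := by rw [← hgcoe]; exact g.right_inv (hball4 hy)
    have h2 := decompose_normal E hν horth (X (σ y) - X u₀)
    have h3 : E.toContinuousLinearMap.adjoint (X (σ y) - X u₀) = y := h1
    rw [h3] at h2
    have h4 : X u₀ = x p := by simp [hX, hu₀, hφ]
    rw [hh_eq y hy, hesymm, add_assoc, ← h4]
    exact sub_eq_iff_eq_add'.1 h2
  · have h1 : ContMDiffOn (𝓡 m) (𝓡 m) ∞ φ.symm φ.target := contMDiffOn_extChartAt_symm p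
    have h2 : ContMDiffOn (𝓡 m) (𝓡 m) ∞ σ (Metric.ball 0 (R / 4)) :=
      contMDiffOn_iff_contDiffOn.2 fun y hy => (hsymm y (hball4 hy)).contDiffWithinAt
    exact (h1.comp h2 fun y hy => hσt y (hball4 hy)).congr fun y _ => hesymm y

end Patch

namespace Patch

variable {m : ℕ} {M : Type*} [MetricSpace M] [ChartedSpace (EuclideanSpace ℝ (Fin m)) M]
  {x : M → EuclideanSpace ℝ (Fin (m + 1))} {p : M} (P : Patch x p)

/-- The graph parametrization, defined on the whole tangent hyperplane. -/
def Y (y : EuclideanSpace ℝ (Fin m)) : EuclideanSpace ℝ (Fin (m + 1)) := x p + P.E y + P.h y • P.ν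

theorem x_symm_eq {y : EuclideanSpace ℝ (Fin m)} (hy : y ∈ Metric.ball 0 P.r) :
    x (P.e.symm y) = P.Y y := P.x_symm y hy

theorem x_eq {q : M} (hq : q ∈ P.e.source) : x q = P.Y (P.e q) := by
  rw [← P.x_symm_eq (P.target_eq ▸ P.e.map_source hq), P.e.left_inv hq]

theorem e_mem {q : M} (hq : q ∈ P.e.source) : P.e q ∈ Metric.ball 0 P.r :=
  P.target_eq ▸ P.e.map_source hq

theorem symm_mem {y : EuclideanSpace ℝ (Fin m)} (hy : y ∈ Metric.ball 0 P.r) :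
    P.e.symm y ∈ P.e.source := P.e.map_target (P.target_eq.symm ▸ hy)

theorem e_symm {y : EuclideanSpace ℝ (Fin m)} (hy : y ∈ Metric.ball 0 P.r) :
    P.e (P.e.symm y) = y := P.e.right_inv (P.target_eq.symm ▸ hy)

theorem zero_mem : (0 : EuclideanSpace ℝ (Fin m)) ∈ Metric.ball 0 P.r :=
  Metric.mem_ball_self P.r_pos

theorem symm_zero : P.e.symm 0 = p := by
  rw [← P.e_self, P.e.left_inv P.mem_source]

theorem inner_ν' (v : EuclideanSpace ℝ (Fin m)) : inner ℝ (P.E v) P.ν = 0 := by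
  rw [real_inner_comm, P.inner_ν]

theorem inner_ν_ν : inner ℝ P.ν P.ν = (1 : ℝ) := by
  rw [real_inner_self_eq_norm_sq, P.norm_ν, one_pow]

theorem inner_E (v w : EuclideanSpace ℝ (Fin m)) : inner ℝ (P.E v) (P.E w) = inner ℝ v w :=
  P.E.inner_map_map v w

theorem contDiff_Y : ContDiff ℝ ∞ P.Y :=
  (contDiff_const.add P.E.toContinuousLinearMap.contDiff).add (P.smooth.smul contDiff_const)

theorem hasFDerivAt_h (y : EuclideanSpace ℝ (Fin m)) : HasFDerivAt P.h (fderiv ℝ P.h y) y :=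
  ((P.smooth.differentiable (by simp)) y).hasFDerivAt

theorem hasFDerivAt_Y (y : EuclideanSpace ℝ (Fin m)) :
    HasFDerivAt P.Y (P.E.toContinuousLinearMap + (fderiv ℝ P.h y).smulRight P.ν) y :=
  (P.E.toContinuousLinearMap.hasFDerivAt.const_add _).add ((P.hasFDerivAt_h y).smul_const P.ν)

theorem fderiv_Y_apply (y v : EuclideanSpace ℝ (Fin m)) :
    fderiv ℝ P.Y y v = P.E v + fderiv ℝ P.h y v • P.ν := by
  rw [(P.hasFDerivAt_Y y).fderiv]; rfl

theorem inner_fderiv_Y (y v w : EuclideanSpace ℝ (Fin m)) :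
    inner ℝ (fderiv ℝ P.Y y v) (fderiv ℝ P.Y y w) =
      inner ℝ v w + fderiv ℝ P.h y v * fderiv ℝ P.h y w := by
  rw [fderiv_Y_apply, fderiv_Y_apply]
  simp only [inner_add_left, inner_add_right, inner_smul_left, inner_smul_right, P.inner_ν,
    P.inner_ν', P.inner_ν_ν, P.inner_E]
  simp [mul_comm]

theorem injective_fderiv_Y (y : EuclideanSpace ℝ (Fin m)) :
    Function.Injective (fderiv ℝ P.Y y) := by
  refine (injective_iff_map_eq_zero _).2 fun v hv => ?_
  have h := P.inner_fderiv_Y y v v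
  rw [hv, inner_zero_left, real_inner_self_eq_norm_sq] at h
  have : ‖v‖ ^ 2 = 0 := by nlinarith [mul_self_nonneg (fderiv ℝ P.h y v), sq_nonneg ‖v‖]
  simpa using this

/-- The straight segment from `y` to `z` lifts to a path in the hypersurface whose speed is at most
(1 + |dh|) |z - y|. -/
theorem dist_symm_le [RiemannianBundle (fun p : M => TangentSpace (𝓡 m) p)]
    [IsRiemannianManifold (𝓡 m) M] (hx : IsIsometricImmersion x) {s ε : ℝ} (hs : s ≤ P.r)
    (hε : ∀ y ∈ Metric.ball (0 : EuclideanSpace ℝ (Fin m)) s, ‖fderiv ℝ P.h y‖ ≤ ε)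
    {y z : EuclideanSpace ℝ (Fin m)} (hy : y ∈ Metric.ball (0 : EuclideanSpace ℝ (Fin m)) s)
    (hz : z ∈ Metric.ball (0 : EuclideanSpace ℝ (Fin m)) s) :
    dist (P.e.symm y) (P.e.symm z) ≤ (1 + ε) * dist y z := by
  set l : ℝ → EuclideanSpace ℝ (Fin m) := fun t => y + t • (z - y) with hl
  have hl0 : l 0 = y := by simp [hl]
  have hl1 : l 1 = z := by simp [hl]
  have hlc : ContDiff ℝ ∞ l := contDiff_const.add (contDiff_id.smul contDiff_const)
  have hl' : ∀ t, HasDerivAt l (z - y) t := fun t => by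
    have := ((hasDerivAt_id t).smul_const (z - y)).const_add y
    rwa [one_smul] at this
  have hmem : ∀ t ∈ Set.Icc (0 : ℝ) 1, l t ∈ Metric.ball (0 : EuclideanSpace ℝ (Fin m)) s :=
    fun t ht => (convex_ball _ _).add_smul_sub_mem hy hz ht
  have hε0 : 0 ≤ ε := (norm_nonneg _).trans (hε y hy)
  have hsub := Metric.ball_subset_ball (x := (0 : EuclideanSpace ℝ (Fin m))) hs
  have hγ : ContMDiffOn 𝓘(ℝ, ℝ) (𝓡 m) 1 (P.e.symm ∘ l) (Set.Icc 0 1) :=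
    (P.contMDiffOn_symm.of_le (by simp)).comp
      (contMDiffOn_iff_contDiffOn.2 (hlc.of_le (by simp)).contDiffOn)
      fun t ht => hsub (hmem t ht)
  have h1 : edist (P.e.symm y) (P.e.symm z) ≤ ENNReal.ofReal ((1 + ε) * dist y z) := by
    rw [IsRiemannianManifold.out (I := 𝓡 m)]
    refine (Manifold.riemannianEDist_le_pathELength hγ (by simp [hl0]) (by simp [hl1])
      zero_le_one).trans ?_
    rw [pathELength_eq_lintegral_deriv hx hγ, ← restrict_Ioo_eq_restrict_Icc]
    calc ∫⁻ t in Set.Ioo (0 : ℝ) 1, ‖deriv (x ∘ P.e.symm ∘ l) t‖ₑ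
        ≤ ∫⁻ t in Set.Ioo (0 : ℝ) 1, ENNReal.ofReal ((1 + ε) * dist y z) := by
          refine setLIntegral_mono measurable_const fun t ht => ?_
          have h2 : x ∘ P.e.symm ∘ l =ᶠ[𝓝 t] P.Y ∘ l := by
            filter_upwards [Ioo_mem_nhds ht.1 ht.2] with t' ht'
            exact P.x_symm_eq (hsub (hmem t' (Set.Ioo_subset_Icc_self ht')))
          rw [h2.deriv_eq, ((P.contDiff_Y.differentiable (by simp) _).hasFDerivAt.comp_hasDerivAt t
            (hl' t)).deriv, ← ofReal_norm, fderiv_Y_apply]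
          refine ENNReal.ofReal_le_ofReal ((norm_add_le _ _).trans ?_)
          rw [P.E.norm_map, norm_smul, P.norm_ν, mul_one, dist_comm, dist_eq_norm, add_mul, one_mul]
          gcongr
          exact (ContinuousLinearMap.le_opNorm _ _).trans (by
            gcongr; exact hε _ (hmem t (Set.Ioo_subset_Icc_self ht)))
      _ = ENNReal.ofReal ((1 + ε) * dist y z) := by simp
  rw [edist_dist] at h1
  exact (ENNReal.ofReal_le_ofReal_iff (by positivity)).1 h1

/-- The coordinate map of a patch, expressed through the ambient coordinates. -/
theorem e_eq_adjoint {q : M} (hq : q ∈ P.e.source) :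
    P.e q = P.E.toContinuousLinearMap.adjoint (x q - x p) := by
  refine ext_inner_right ℝ fun w => ?_
  rw [ContinuousLinearMap.adjoint_inner_left, P.x_eq hq, Y]
  change _ = inner ℝ _ (P.E w)
  simp [inner_add_left, add_assoc, inner_smul_left, P.inner_ν, P.inner_E]

/-- The coordinate map is `x` followed by an orthogonal projection, and neither increases distances.
-/
theorem dist_e_le [RiemannianBundle (fun p : M => TangentSpace (𝓡 m) p)]
    [IsRiemannianManifold (𝓡 m) M] (hx : IsIsometricImmersion x) {q q' : M}
    (hq : q ∈ P.e.source) (hq' : q' ∈ P.e.source) : dist (P.e q) (P.e q') ≤ dist q q' := by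
  have h1 : dist (x q) (x q') ≤ dist q q' := by
    simpa using (lipschitzWith_immersion hx).dist_le_mul q q'
  refine le_trans ?_ h1
  rw [P.e_eq_adjoint hq, P.e_eq_adjoint hq', dist_eq_norm, dist_eq_norm, ← map_sub,
    sub_sub_sub_cancel_right]
  refine (ContinuousLinearMap.le_opNorm _ _).trans ?_
  have : ‖P.E.toContinuousLinearMap.adjoint‖ ≤ 1 := by
    rw [LinearIsometryEquiv.norm_map]; exact P.E.norm_toContinuousLinearMap_le
  exact mul_le_of_le_one_left (norm_nonneg _) this

end Patch

/-! ### Partial derivatives, the second order chain rule, and metric traces. -/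

section Calculus

variable {m : ℕ}

/-- The partial derivative of a function on Euclidean space. -/
def pd (k : Fin m) (f : EuclideanSpace ℝ (Fin m) → ℝ) (y : EuclideanSpace ℝ (Fin m)) : ℝ :=
  fderiv ℝ f y (EuclideanSpace.single k 1)

theorem fderiv_eq_sum_pd (f : EuclideanSpace ℝ (Fin m) → ℝ) (y v : EuclideanSpace ℝ (Fin m)) :
    fderiv ℝ f y v = ∑ k, v k * pd k f y := by
  conv_lhs => rw [← (EuclideanSpace.basisFun (Fin m) ℝ).sum_repr v]
  simp [pd]

/-- The gradient as a vector of partial derivatives. -/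
def gr (f : EuclideanSpace ℝ (Fin m) → ℝ) (y : EuclideanSpace ℝ (Fin m)) :
    EuclideanSpace ℝ (Fin m) := WithLp.toLp 2 fun k => pd k f y

theorem gr_apply (f : EuclideanSpace ℝ (Fin m) → ℝ) (y : EuclideanSpace ℝ (Fin m)) (k : Fin m) :
    gr f y k = pd k f y := rfl

theorem inner_gr (f : EuclideanSpace ℝ (Fin m) → ℝ) (y v : EuclideanSpace ℝ (Fin m)) :
    inner ℝ (gr f y) v = fderiv ℝ f y v := by
  rw [fderiv_eq_sum_pd, PiLp.inner_apply]
  simp [gr_apply]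

theorem pd_pd {f : EuclideanSpace ℝ (Fin m) → ℝ} {y : EuclideanSpace ℝ (Fin m)}
    (hf : ContDiffAt ℝ 2 f y) (k l : Fin m) :
    pd k (pd l f) y = fderiv ℝ (fderiv ℝ f) y (EuclideanSpace.single k 1)
      (EuclideanSpace.single l 1) := by
  have h1 : DifferentiableAt ℝ (fderiv ℝ f) y :=
    (hf.fderiv_right (m := 1) (by norm_num)).differentiableAt one_ne_zero
  have h2 := h1.hasFDerivAt.clm_apply (hasFDerivAt_const (EuclideanSpace.single l (1 : ℝ)) y)
  change fderiv ℝ (fun z => fderiv ℝ f z (EuclideanSpace.single l 1)) y _ = _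
  rw [h2.fderiv]
  simp

theorem contDiff_pd {f : EuclideanSpace ℝ (Fin m) → ℝ} (hf : ContDiff ℝ ∞ f) (k : Fin m) :
    ContDiff ℝ ∞ (pd k f) :=
  (hf.fderiv_right (m := ∞) (by simp)).clm_apply contDiff_const

theorem fderiv_fderiv_comp {E F G : Type*} [NormedAddCommGroup E] [NormedSpace ℝ E]
    [NormedAddCommGroup F] [NormedSpace ℝ F] [NormedAddCommGroup G] [NormedSpace ℝ G]
    {X : F → G} {κ : E → F} {y : E} (hX : ContDiffAt ℝ 2 X (κ y)) (hκ : ContDiffAt ℝ 2 κ y)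
    (v w : E) :
    fderiv ℝ (fderiv ℝ (X ∘ κ)) y v w =
      fderiv ℝ (fderiv ℝ X) (κ y) (fderiv ℝ κ y v) (fderiv ℝ κ y w) +
        fderiv ℝ X (κ y) (fderiv ℝ (fderiv ℝ κ) y v w) := by
  have hev : fderiv ℝ (X ∘ κ) =ᶠ[𝓝 y] fun z => (fderiv ℝ X (κ z)).comp (fderiv ℝ κ z) := by
    have h2 : ∀ᶠ z in 𝓝 y, ContDiffAt ℝ 2 κ z := hκ.eventually (by decide)
    have h3 : ∀ᶠ u in 𝓝 (κ y), ContDiffAt ℝ 2 X u := hX.eventually (by decide)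
    filter_upwards [h2, hκ.continuousAt.eventually h3] with z hz2 hz3
    exact fderiv_comp z (hz3.differentiableAt two_ne_zero) (hz2.differentiableAt two_ne_zero)
  rw [hev.fderiv_eq]
  have hA : HasFDerivAt (fun z => fderiv ℝ X (κ z))
      ((fderiv ℝ (fderiv ℝ X) (κ y)).comp (fderiv ℝ κ y)) y :=
    (((hX.fderiv_right (m := 1) (by norm_num)).differentiableAt one_ne_zero).hasFDerivAt).comp y
      (hκ.differentiableAt two_ne_zero).hasFDerivAt
  have hB : HasFDerivAt (fderiv ℝ κ) (fderiv ℝ (fderiv ℝ κ) y) y :=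
    ((hκ.fderiv_right (m := 1) (by norm_num)).differentiableAt one_ne_zero).hasFDerivAt
  rw [(hA.clm_comp hB).fderiv]
  simp [add_comm]

end Calculus

section TraceLemma

variable {m : ℕ} {ι : Type*} [Fintype ι]

/-- If `t` is a frame which is orthonormal for the metric `⟪v, w⟫ + ⟪d, v⟫ ⟪d, w⟫`, then tracing
over `t` is tracing against the inverse metric. -/
theorem sum_frame_eq {d : EuclideanSpace ℝ (Fin m)} {t : ι → EuclideanSpace ℝ (Fin m)}
    (ht : ∀ v, v = ∑ i, (inner ℝ (t i) v + inner ℝ d (t i) * inner ℝ d v : ℝ) • t i)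
    (B : EuclideanSpace ℝ (Fin m) →ₗ[ℝ] EuclideanSpace ℝ (Fin m) →ₗ[ℝ] ℝ) :
    ∑ i, B (t i) (t i) =
      ∑ k, B (EuclideanSpace.single k 1) (EuclideanSpace.single k 1) -
        B d d / (1 + ‖d‖ ^ 2) := by
  have hW : (1 + ‖d‖ ^ 2) ≠ 0 := by positivity
  -- The right side is the inverse of I + d dᵀ applied to v, by the Sherman-Morrison formula. Its
  -- expansion in the frame has the coefficients ⟨t i, v⟩.
  have hS : ∀ v, ∑ i, (inner ℝ (t i) v : ℝ) • t i = v - (inner ℝ d v / (1 + ‖d‖ ^ 2)) • d := by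
    intro v
    rw [ht (v - (inner ℝ d v / (1 + ‖d‖ ^ 2)) • d)]
    refine Finset.sum_congr rfl fun i _ => ?_
    congr 1
    rw [inner_sub_right, inner_sub_right, inner_smul_right, inner_smul_right,
      real_inner_self_eq_norm_sq, real_inner_comm (t i) d]
    field_simp
    ring
  have hexp : ∀ v : EuclideanSpace ℝ (Fin m),
      v = ∑ k, v k • EuclideanSpace.single k (1 : ℝ) := by
    intro v
    conv_lhs => rw [← (EuclideanSpace.basisFun (Fin m) ℝ).sum_repr v]
    simp
  calc ∑ i, B (t i) (t i) = ∑ i, ∑ k, (t i) k * B (EuclideanSpace.single k 1) (t i) := by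
        refine Finset.sum_congr rfl fun i _ => ?_
        conv_lhs => enter [1]; rw [hexp (t i)]
        simp
    _ = ∑ k, B (EuclideanSpace.single k 1)
          (∑ i, (inner ℝ (t i) (EuclideanSpace.single k (1 : ℝ)) : ℝ) • t i) := by
        rw [Finset.sum_comm]
        refine Finset.sum_congr rfl fun k _ => ?_
        simp [EuclideanSpace.inner_single_right]
    _ = ∑ k, B (EuclideanSpace.single k 1) (EuclideanSpace.single k 1) -
          (∑ k, d k * B (EuclideanSpace.single k 1) d) / (1 + ‖d‖ ^ 2) := by
        simp only [hS, map_sub, map_smul, Finset.sum_sub_distrib]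
        rw [Finset.sum_div]
        congr 1
        refine Finset.sum_congr rfl fun k _ => ?_
        simp [EuclideanSpace.inner_single_right]
        ring
    _ = _ := by
        congr 2
        conv_rhs => enter [1]; rw [hexp d]
        simp

end TraceLemma

section Gradient

variable {m : ℕ} {M : Type*} [MetricSpace M] [ChartedSpace (EuclideanSpace ℝ (Fin m)) M]

/-- The differential of a real function in the preferred chart. -/
def dif (φ : M → ℝ) (q : M) : EuclideanSpace ℝ (Fin m) →L[ℝ] ℝ :=
  fderiv ℝ (φ ∘ (extChartAt (𝓡 m) q).symm) (extChartAt (𝓡 m) q q)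

variable [RiemannianBundle (fun p : M => TangentSpace (𝓡 m) p)]

variable (m) in
/-- The inner product of the gradients of two functions. -/
def gradInner (φ ψ : M → ℝ) (q : M) : ℝ :=
  ∑ i, dif φ q (stdOrthonormalBasis ℝ (TangentSpace (𝓡 m) q) i) *
    dif ψ q (stdOrthonormalBasis ℝ (TangentSpace (𝓡 m) q) i)

end Gradient

/-! ### Comparison of patch coordinates with the preferred charts. -/

namespace Patch

variable {m : ℕ} {M : Type*} [MetricSpace M] [ChartedSpace (EuclideanSpace ℝ (Fin m)) M]
  {x : M → EuclideanSpace ℝ (Fin (m + 1))} {p : M} (P : Patch x p)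

/-- The coordinate change from a patch to the preferred chart at one of its points. -/
def toChart (y : EuclideanSpace ℝ (Fin m)) : EuclideanSpace ℝ (Fin m) → EuclideanSpace ℝ (Fin m) :=
  extChartAt (𝓡 m) (P.e.symm y) ∘ P.e.symm

theorem eventually_mem {y : EuclideanSpace ℝ (Fin m)} (hy : y ∈ Metric.ball 0 P.r) :
    ∀ᶠ z in 𝓝 y, z ∈ Metric.ball 0 P.r := Metric.isOpen_ball.mem_nhds hy

theorem continuousAt_symm {y : EuclideanSpace ℝ (Fin m)} (hy : y ∈ Metric.ball 0 P.r) :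
    ContinuousAt P.e.symm y :=
  P.e.symm.continuousAt (by rw [OpenPartialHomeomorph.symm_source, P.target_eq]; exact hy)

theorem eventually_chart_source {y : EuclideanSpace ℝ (Fin m)} (hy : y ∈ Metric.ball 0 P.r) :
    ∀ᶠ z in 𝓝 y, P.e.symm z ∈ (extChartAt (𝓡 m) (P.e.symm y)).source :=
  P.continuousAt_symm hy ((isOpen_extChartAt_source _).mem_nhds (mem_extChartAt_source _))

theorem comp_symm_eventuallyEq {F : Type*} (φ : M → F) {y : EuclideanSpace ℝ (Fin m)}
    (hy : y ∈ Metric.ball 0 P.r) :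
    φ ∘ P.e.symm =ᶠ[𝓝 y] (φ ∘ (extChartAt (𝓡 m) (P.e.symm y)).symm) ∘ P.toChart y := by
  filter_upwards [P.eventually_chart_source hy] with z hz
  simp only [Function.comp_apply, toChart]
  rw [(extChartAt (𝓡 m) (P.e.symm y)).left_inv hz]

theorem comp_Y_eventuallyEq {y : EuclideanSpace ℝ (Fin m)} (hy : y ∈ Metric.ball 0 P.r) :
    P.Y =ᶠ[𝓝 y] (x ∘ (extChartAt (𝓡 m) (P.e.symm y)).symm) ∘ P.toChart y := by
  refine EventuallyEq.trans ?_ (P.comp_symm_eventuallyEq x hy)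
  filter_upwards [P.eventually_mem hy] with z hz
  exact (P.x_symm_eq hz).symm

theorem contDiffAt_toChart {y : EuclideanSpace ℝ (Fin m)} (hy : y ∈ Metric.ball 0 P.r) :
    ContDiffAt ℝ ∞ (P.toChart y) y := by
  rw [← contMDiffAt_iff_contDiffAt]
  exact (contMDiffAt_extChartAt (x := P.e.symm y) (n := ∞)).comp y
    (P.contMDiffOn_symm.contMDiffAt (P.eventually_mem hy))

variable [IsManifold (𝓡 m) ∞ M] [RiemannianBundle (fun p : M => TangentSpace (𝓡 m) p)]

theorem contDiffAt_chart (hx : IsIsometricImmersion x) (q : M) :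
    ContDiffAt ℝ ∞ (x ∘ (extChartAt (𝓡 m) q).symm) (extChartAt (𝓡 m) q q) :=
  (hx.contDiffOn q).contDiffAt ((isOpen_extChartAt_target q).mem_nhds (mem_extChartAt_target q))

theorem fderiv_Y_eq (hx : IsIsometricImmersion x) {y : EuclideanSpace ℝ (Fin m)}
    (hy : y ∈ Metric.ball 0 P.r) :
    fderiv ℝ P.Y y = (fderiv ℝ (x ∘ (extChartAt (𝓡 m) (P.e.symm y)).symm)
      (extChartAt (𝓡 m) (P.e.symm y) (P.e.symm y))).comp (fderiv ℝ (P.toChart y) y) := by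
  rw [(P.comp_Y_eventuallyEq hy).fderiv_eq]
  exact fderiv_comp y ((contDiffAt_chart hx _).differentiableAt (by simp))
    ((P.contDiffAt_toChart hy).differentiableAt (by simp))

theorem exists_toChart_equiv (hx : IsIsometricImmersion x) {y : EuclideanSpace ℝ (Fin m)}
    (hy : y ∈ Metric.ball 0 P.r) : ∃ K : EuclideanSpace ℝ (Fin m) ≃L[ℝ] EuclideanSpace ℝ (Fin m),
      (K : EuclideanSpace ℝ (Fin m) →L[ℝ] EuclideanSpace ℝ (Fin m)) = fderiv ℝ (P.toChart y) y := by
  have hinj : Function.Injective (fderiv ℝ (P.toChart y) y) := by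
    have := P.injective_fderiv_Y y
    rw [P.fderiv_Y_eq hx hy] at this
    exact Function.Injective.of_comp this
  exact ⟨(LinearEquiv.ofInjectiveEndo (fderiv ℝ (P.toChart y) y).toLinearMap
    hinj).toContinuousLinearEquiv, by ext v; rfl⟩

theorem fderiv_fderiv_Y_eq (hx : IsIsometricImmersion x) {y : EuclideanSpace ℝ (Fin m)}
    (hy : y ∈ Metric.ball 0 P.r) (v w : EuclideanSpace ℝ (Fin m)) :
    fderiv ℝ (fderiv ℝ P.Y) y v w =
      fderiv ℝ (fderiv ℝ (x ∘ (extChartAt (𝓡 m) (P.e.symm y)).symm))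
        (extChartAt (𝓡 m) (P.e.symm y) (P.e.symm y)) (fderiv ℝ (P.toChart y) y v)
          (fderiv ℝ (P.toChart y) y w) +
      fderiv ℝ (x ∘ (extChartAt (𝓡 m) (P.e.symm y)).symm)
        (extChartAt (𝓡 m) (P.e.symm y) (P.e.symm y)) (fderiv ℝ (fderiv ℝ (P.toChart y)) y v w) := by
  rw [(P.comp_Y_eventuallyEq hy).fderiv.fderiv_eq]
  have h2 : (2 : ℕ∞ω) ≤ ((⊤ : ℕ∞) : ℕ∞ω) := by norm_cast
  exact fderiv_fderiv_comp (X := x ∘ (extChartAt (𝓡 m) (P.e.symm y)).symm) (κ := P.toChart y)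
    ((contDiffAt_chart hx (P.e.symm y)).of_le h2) ((P.contDiffAt_toChart hy).of_le h2) v w

/-- No differentiability of `φ` is needed: the coordinate change is a local diffeomorphism, so
differentiability fails on both sides at once, and then both derivatives have the default value 0.
-/
theorem dif_eq (hx : IsIsometricImmersion x) {y : EuclideanSpace ℝ (Fin m)}
    (hy : y ∈ Metric.ball 0 P.r) (φ : M → ℝ) :
    fderiv ℝ (φ ∘ P.e.symm) y = (dif φ (P.e.symm y)).comp (fderiv ℝ (P.toChart y) y) := by
  set κ := P.toChart y with hκ
  have hκc : ContDiffAt ℝ ∞ κ y := P.contDiffAt_toChart hy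
  rw [(P.comp_symm_eventuallyEq φ hy).fderiv_eq]
  by_cases hd : DifferentiableAt ℝ (φ ∘ (extChartAt (𝓡 m) (P.e.symm y)).symm) (κ y)
  · exact fderiv_comp y hd (hκc.differentiableAt (by simp))
  · obtain ⟨K, hK⟩ := P.exists_toChart_equiv hx hy
    have hd' : ¬ DifferentiableAt ℝ ((φ ∘ (extChartAt (𝓡 m) (P.e.symm y)).symm) ∘ κ) y := by
      intro h
      apply hd
      have hκd : HasStrictFDerivAt κ (K : EuclideanSpace ℝ (Fin m) →L[ℝ] _) y := by
        rw [hK]; exact hκc.hasStrictFDerivAt (by simp)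
      have h1 : DifferentiableAt ℝ (hκd.localInverse κ K y) (κ y) :=
        hκd.to_localInverse.hasFDerivAt.differentiableAt
      have h2 : hκd.localInverse κ K y (κ y) = y := hκd.localInverse_apply_image
      have h3 : DifferentiableAt ℝ
          (((φ ∘ (extChartAt (𝓡 m) (P.e.symm y)).symm) ∘ κ) ∘ hκd.localInverse κ K y) (κ y) :=
        DifferentiableAt.comp (κ y) (h2.symm ▸ h) h1
      refine h3.congr_of_eventuallyEq ?_
      filter_upwards [hκd.eventually_right_inverse] with u hu
      simp only [Function.comp_apply] at hu ⊢
      rw [hu]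
    rw [fderiv_zero_of_not_differentiableAt hd', dif]
    change 0 = (fderiv ℝ (φ ∘ (extChartAt (𝓡 m) (P.e.symm y)).symm) (κ y)).comp _
    rw [fderiv_zero_of_not_differentiableAt hd, ContinuousLinearMap.zero_comp]

end Patch

/-! ### Normal vector, second fundamental form and shrinker equation of a graph. -/

namespace Patch

variable {m : ℕ} {M : Type*} [MetricSpace M] [ChartedSpace (EuclideanSpace ℝ (Fin m)) M]
  {x : M → EuclideanSpace ℝ (Fin (m + 1))} {p : M} (P : Patch x p)

/-- A normal vector of the graph. -/
def normal (y : EuclideanSpace ℝ (Fin m)) : EuclideanSpace ℝ (Fin (m + 1)) :=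
  P.ν - P.E (gr P.h y)

theorem inner_normal_fderiv_Y (y v : EuclideanSpace ℝ (Fin m)) :
    inner ℝ (P.normal y) (fderiv ℝ P.Y y v) = (0 : ℝ) := by
  rw [fderiv_Y_apply, normal]
  simp only [inner_sub_left, inner_add_right, inner_smul_right, P.inner_ν, P.inner_ν',
    P.inner_ν_ν, P.inner_E, inner_gr]
  ring

theorem norm_normal_sq (y : EuclideanSpace ℝ (Fin m)) :
    ‖P.normal y‖ ^ 2 = 1 + ‖gr P.h y‖ ^ 2 := by
  rw [normal, norm_sub_sq_real, P.inner_ν, P.norm_ν, P.E.norm_map]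
  ring

/-- Orthogonality to the normal fixes the `ν`-component of `z` as dh of its tangential component,
which is the shape of a derivative of `Y`. -/
theorem exists_fderiv_Y_eq {y : EuclideanSpace ℝ (Fin m)} {z : EuclideanSpace ℝ (Fin (m + 1))}
    (hz : inner ℝ (P.normal y) z = (0 : ℝ)) : ∃ v, fderiv ℝ P.Y y v = z := by
  have hd := decompose_normal P.E P.norm_ν P.inner_ν z
  set v := P.E.toContinuousLinearMap.adjoint z with hv
  refine ⟨v, ?_⟩
  have h1 : inner ℝ P.ν z = fderiv ℝ P.h y v := by
    rw [normal, inner_sub_left, hd] at hz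
    simp only [inner_add_right, inner_smul_right, P.inner_ν, P.inner_ν', P.inner_ν_ν, P.inner_E,
      inner_gr] at hz
    linarith
  rw [fderiv_Y_apply, ← h1]
  exact hd.symm

theorem fderiv_fderiv_Y (y v w : EuclideanSpace ℝ (Fin m)) :
    fderiv ℝ (fderiv ℝ P.Y) y v w = fderiv ℝ (fderiv ℝ P.h) y v w • P.ν := by
  have h1 : fderiv ℝ P.Y = fun z => P.E.toContinuousLinearMap + (fderiv ℝ P.h z).smulRight P.ν :=
    funext fun z => (P.hasFDerivAt_Y z).fderiv
  have h2 : HasFDerivAt (fderiv ℝ P.h) (fderiv ℝ (fderiv ℝ P.h) y) y :=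
    ((P.smooth.fderiv_right (m := 1) (by norm_cast)).differentiable one_ne_zero y).hasFDerivAt
  have h3 := (((ContinuousLinearMap.smulRightL ℝ _ _).flip P.ν).hasFDerivAt.comp y h2).const_add
    P.E.toContinuousLinearMap
  rw [h1]
  have h4 := h3.fderiv
  simp only [Function.comp_def, ContinuousLinearMap.flip_apply,
    ContinuousLinearMap.smulRightL_apply_apply] at h4
  erw [h4]
  rfl

variable [IsManifold (𝓡 m) ∞ M] [RiemannianBundle (fun p : M => TangentSpace (𝓡 m) p)]

theorem range_differential (hx : IsIsometricImmersion x) {y : EuclideanSpace ℝ (Fin m)}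
    (hy : y ∈ Metric.ball 0 P.r) (z : EuclideanSpace ℝ (Fin (m + 1))) :
    z ∈ (differential x (P.e.symm y)).toLinearMap.range ↔ ∃ v, fderiv ℝ P.Y y v = z := by
  obtain ⟨K, hK⟩ := P.exists_toChart_equiv hx hy
  constructor
  · rintro ⟨v, rfl⟩
    refine ⟨K.symm v, ?_⟩
    rw [P.fderiv_Y_eq hx hy, ← hK]
    exact (congrArg _ (K.apply_symm_apply v)).trans (differential_eq_fderiv hx _ v).symm
  · rintro ⟨v, rfl⟩
    refine ⟨K v, ?_⟩
    rw [P.fderiv_Y_eq hx hy, ← hK]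
    exact differential_eq_fderiv hx _ (K v)

theorem normalPart_eq (hx : IsIsometricImmersion x) {y : EuclideanSpace ℝ (Fin m)}
    (hy : y ∈ Metric.ball 0 P.r) (z : EuclideanSpace ℝ (Fin (m + 1))) :
    normalPart x (P.e.symm y) z =
      ((inner ℝ (P.normal y) z : ℝ) / (1 + ‖gr P.h y‖ ^ 2)) • P.normal y := by
  refine Submodule.eq_starProjection_of_mem_of_inner_eq_zero ?_ fun w hw => ?_
  · refine Submodule.smul_mem _ _ ((Submodule.mem_orthogonal' _ _).2 fun w hw => ?_)
    obtain ⟨v, rfl⟩ := (P.range_differential hx hy w).1 hw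
    exact P.inner_normal_fderiv_Y y v
  · refine (Submodule.mem_orthogonal _ _).1 hw _ ((P.range_differential hx hy _).2
      (P.exists_fderiv_Y_eq ?_))
    have hW : (1 + ‖gr P.h y‖ ^ 2) ≠ 0 := by positivity
    rw [inner_sub_right, inner_smul_right, real_inner_self_eq_norm_sq, P.norm_normal_sq]
    field_simp
    ring

/-- Around each point of a patch there is an orthonormal frame, written in the coordinates of the
patch, which computes the second fundamental form and the gradients. -/
theorem exists_frame (hx : IsIsometricImmersion x) {y : EuclideanSpace ℝ (Fin m)}
    (hy : y ∈ Metric.ball 0 P.r) :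
    ∃ t : Fin (Module.finrank ℝ (TangentSpace (𝓡 m) (P.e.symm y))) → EuclideanSpace ℝ (Fin m),
      (∀ v, v = ∑ i, (inner ℝ (t i) v + inner ℝ (gr P.h y) (t i) * inner ℝ (gr P.h y) v : ℝ) •
        t i) ∧
      (∀ i j, secondFundamentalForm x (P.e.symm y)
          (stdOrthonormalBasis ℝ (TangentSpace (𝓡 m) (P.e.symm y)) i)
          (stdOrthonormalBasis ℝ (TangentSpace (𝓡 m) (P.e.symm y)) j) =
        (fderiv ℝ (fderiv ℝ P.h) y (t i) (t j) / (1 + ‖gr P.h y‖ ^ 2)) • P.normal y) ∧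
      (∀ (φ : M → ℝ) i, dif φ (P.e.symm y)
          (stdOrthonormalBasis ℝ (TangentSpace (𝓡 m) (P.e.symm y)) i) =
        fderiv ℝ (φ ∘ P.e.symm) y (t i)) := by
  obtain ⟨K, hK⟩ := P.exists_toChart_equiv hx hy
  set q := P.e.symm y with hq
  set b := stdOrthonormalBasis ℝ (TangentSpace (𝓡 m) q) with hb
  have hKt : ∀ i, fderiv ℝ (P.toChart y) y (K.symm (b i)) = b i := fun i => by
    rw [← hK]; exact K.apply_symm_apply _
  have hdx : ∀ v, differential x q (K v) = fderiv ℝ P.Y y v := fun v => by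
    rw [P.fderiv_Y_eq hx hy, ← hK]; exact differential_eq_fderiv hx _ (K v)
  have hdb : ∀ i, differential x q (b i) = fderiv ℝ P.Y y (K.symm (b i)) := fun i =>
    (congrArg (differential x q) (K.apply_symm_apply (b i))).symm.trans (hdx _)
  -- The frame consists of the orthonormal basis vectors of the tangent space, transported to patch
  -- coordinates.
  refine ⟨fun i => K.symm (b i), fun v => ?_, fun i j => ?_, fun φ i => ?_⟩
  · let w : TangentSpace (𝓡 m) q := K v
    have hw : differential x q w = fderiv ℝ P.Y y v := hdx v
    have h1 : ∀ i, (inner ℝ (b i) w : ℝ) = inner ℝ (K.symm (b i)) v +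
          inner ℝ (gr P.h y) (K.symm (b i)) * inner ℝ (gr P.h y) v := by
      intro i
      rw [inner_gr, inner_gr, ← P.inner_fderiv_Y, ← hw, ← hdb]
      exact (hx.inner_eq q _ _).symm
    have h2 := b.sum_repr' w
    have h3 := congrArg K.symm h2
    simp only [h1] at h3
    refine (K.symm_apply_apply v).symm.trans (h3.symm.trans ?_)
    exact (map_sum K.symm _ _).trans (Finset.sum_congr rfl fun i _ => K.symm.map_smul _ _)
  · have h1 := P.fderiv_fderiv_Y_eq hx hy (K.symm (b i)) (K.symm (b j))
    rw [hKt, hKt] at h1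
    have h2 : normalPart x q (fderiv ℝ (fderiv ℝ P.Y) y (K.symm (b i)) (K.symm (b j))) =
        secondFundamentalForm x q (b i) (b j) := by
      rw [h1, normalPart_eq P hx hy, inner_add_right]
      -- The second derivative of the coordinate change enters only through a tangent vector, which
      -- the normal projection kills. This is why A is a tensor.
      have h3 : inner ℝ (P.normal y) (fderiv ℝ (x ∘ (extChartAt (𝓡 m) q).symm)
          (extChartAt (𝓡 m) q q) (fderiv ℝ (fderiv ℝ (P.toChart y)) y (K.symm (b i))
            (K.symm (b j)))) = (0 : ℝ) := by
        obtain ⟨v, hv⟩ := (P.range_differential hx hy (differential x q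
          (fderiv ℝ (fderiv ℝ (P.toChart y)) y (K.symm (b i)) (K.symm (b j))))).1 ⟨_, rfl⟩
        have h4 := P.inner_normal_fderiv_Y y v
        rw [hv] at h4
        exact (congrArg (inner ℝ (P.normal y)) (differential_eq_fderiv hx q _)).symm.trans h4
      rw [h3, add_zero, ← normalPart_eq P hx hy]
      rfl
    rw [← h2, P.normalPart_eq hx hy, fderiv_fderiv_Y, inner_smul_right]
    congr 2
    rw [normal, inner_sub_left, P.inner_ν_ν, P.inner_ν', sub_zero, mul_one]
  · rw [P.dif_eq hx hy, ContinuousLinearMap.comp_apply, hKt]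

end Patch

section Calculus

variable {m : ℕ}

theorem hess_apply {f : EuclideanSpace ℝ (Fin m) → ℝ} {y : EuclideanSpace ℝ (Fin m)}
    (hf : ContDiffAt ℝ 2 f y) (v w : EuclideanSpace ℝ (Fin m)) :
    fderiv ℝ (fderiv ℝ f) y v w = ∑ k, ∑ l, v k * w l * pd k (pd l f) y := by
  have hexp : ∀ v : EuclideanSpace ℝ (Fin m), v = ∑ k, v k • EuclideanSpace.single k (1 : ℝ) := by
    intro v
    conv_lhs => rw [← (EuclideanSpace.basisFun (Fin m) ℝ).sum_repr v]
    simp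
  conv_lhs => rw [hexp v, hexp w]
  simp only [map_sum, map_smul, sum_apply, smul_apply,
    smul_eq_mul, Finset.mul_sum, pd_pd hf]
  rw [Finset.sum_comm]
  exact Finset.sum_congr rfl fun k _ => Finset.sum_congr rfl fun l _ => by ring

theorem pd_comm {f : EuclideanSpace ℝ (Fin m) → ℝ} (hf : ContDiff ℝ ∞ f) (k l : Fin m) :
    pd k (pd l f) = pd l (pd k f) := by
  funext y
  have h2 : ContDiffAt ℝ 2 f y := hf.contDiffAt.of_le (by norm_cast)
  rw [pd_pd h2, pd_pd h2]
  exact (h2.isSymmSndFDerivAt (by simp)) _ _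

theorem norm_gr_sq (f : EuclideanSpace ℝ (Fin m) → ℝ) (y : EuclideanSpace ℝ (Fin m)) :
    ‖gr f y‖ ^ 2 = ∑ k, pd k f y ^ 2 := by
  rw [EuclideanSpace.norm_sq_eq]
  simp [gr_apply]

end Calculus

namespace Patch

variable {m : ℕ} {M : Type*} [MetricSpace M] [ChartedSpace (EuclideanSpace ℝ (Fin m)) M]
  {x : M → EuclideanSpace ℝ (Fin (m + 1))} {p : M} (P : Patch x p)

/-- The tangential coordinates of the position vector at the centre. -/
def τ : EuclideanSpace ℝ (Fin m) := P.E.toContinuousLinearMap.adjoint (x p)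

theorem contDiffAt_h (y : EuclideanSpace ℝ (Fin m)) : ContDiffAt ℝ 2 P.h y :=
  P.smooth.contDiffAt.of_le (by norm_cast)

theorem inner_E_center (v : EuclideanSpace ℝ (Fin m)) :
    inner ℝ (P.E v) (x p) = (inner ℝ P.τ v : ℝ) := by
  rw [τ, ContinuousLinearMap.adjoint_inner_left, real_inner_comm]; rfl

theorem sum_frame_hess_sq {ι : Type*} [Fintype ι] {y : EuclideanSpace ℝ (Fin m)}
    {t : ι → EuclideanSpace ℝ (Fin m)}
    (ht : ∀ v, v = ∑ i, (inner ℝ (t i) v + inner ℝ (gr P.h y) (t i) * inner ℝ (gr P.h y) v : ℝ) •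
        t i) (v w : EuclideanSpace ℝ (Fin m)) :
    ∑ j, fderiv ℝ (fderiv ℝ P.h) y v (t j) * fderiv ℝ (fderiv ℝ P.h) y w (t j) =
      ∑ k, fderiv ℝ (fderiv ℝ P.h) y v (EuclideanSpace.single k 1) *
        fderiv ℝ (fderiv ℝ P.h) y w (EuclideanSpace.single k 1) -
      fderiv ℝ (fderiv ℝ P.h) y v (gr P.h y) * fderiv ℝ (fderiv ℝ P.h) y w (gr P.h y) /
        (1 + ‖gr P.h y‖ ^ 2) :=
  sum_frame_eq ht (LinearMap.mk₂ ℝ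
    (fun a b => fderiv ℝ (fderiv ℝ P.h) y v a * fderiv ℝ (fderiv ℝ P.h) y w b)
    (fun _ _ _ => by simp [add_mul]) (fun _ _ _ => by simp [mul_assoc])
    (fun _ _ _ => by simp [mul_add]) (fun _ _ _ => by simp [mul_left_comm]))

variable [IsManifold (𝓡 m) ∞ M] [RiemannianBundle (fun p : M => TangentSpace (𝓡 m) p)]

theorem gradInner_eq (hx : IsIsometricImmersion x) {y : EuclideanSpace ℝ (Fin m)}
    (hy : y ∈ Metric.ball 0 P.r) (φ ψ : M → ℝ) :
    gradInner m φ ψ (P.e.symm y) =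
      ∑ k, pd k (φ ∘ P.e.symm) y * pd k (ψ ∘ P.e.symm) y -
        fderiv ℝ (φ ∘ P.e.symm) y (gr P.h y) * fderiv ℝ (ψ ∘ P.e.symm) y (gr P.h y) /
          (1 + ‖gr P.h y‖ ^ 2) := by
  obtain ⟨t, ht, -, hd⟩ := P.exists_frame hx hy
  simp only [gradInner, hd]
  exact sum_frame_eq ht (LinearMap.mk₂ ℝ
    (fun v w => fderiv ℝ (φ ∘ P.e.symm) y v * fderiv ℝ (ψ ∘ P.e.symm) y w)
    (fun _ _ _ => by simp [add_mul]) (fun _ _ _ => by simp [mul_assoc])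
    (fun _ _ _ => by simp [mul_add]) (fun _ _ _ => by simp [mul_left_comm]))

theorem meanCurvatureVector_eq (hx : IsIsometricImmersion x) {y : EuclideanSpace ℝ (Fin m)}
    (hy : y ∈ Metric.ball 0 P.r) : meanCurvatureVector x (P.e.symm y) =
      ((∑ k, pd k (pd k P.h) y - fderiv ℝ (fderiv ℝ P.h) y (gr P.h y) (gr P.h y) /
        (1 + ‖gr P.h y‖ ^ 2)) / (1 + ‖gr P.h y‖ ^ 2)) • P.normal y := by
  obtain ⟨t, ht, hA, -⟩ := P.exists_frame hx hy
  simp only [meanCurvatureVector, hA, ← Finset.sum_smul, ← Finset.sum_div]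
  congr 2
  refine (sum_frame_eq ht (LinearMap.mk₂ ℝ (fun v w => fderiv ℝ (fderiv ℝ P.h) y v w)
    (fun _ _ _ => by simp) (fun _ _ _ => by simp) (fun _ _ _ => by simp)
    (fun _ _ _ => by simp))).trans ?_
  simp [pd_pd (P.contDiffAt_h y)]

/-- The self-shrinker equation in graph coordinates. -/
theorem shrinker_graph (hx : IsSelfShrinker x) {y : EuclideanSpace ℝ (Fin m)}
    (hy : y ∈ Metric.ball 0 P.r) :
    ∑ k, pd k (pd k P.h) y - fderiv ℝ (fderiv ℝ P.h) y (gr P.h y) (gr P.h y) /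
        (1 + ‖gr P.h y‖ ^ 2) =
      fderiv ℝ P.h y (P.τ + y) - P.h y - inner ℝ P.ν (x p) := by
  have h1 := hx.shrinker_eq (P.e.symm y)
  have hW : (1 + ‖gr P.h y‖ ^ 2) ≠ 0 := by positivity
  have hN : P.normal y ≠ 0 := by
    intro h0
    have := P.norm_normal_sq y
    rw [h0, norm_zero] at this
    exact hW (by rw [← this]; simp)
  rw [P.meanCurvatureVector_eq hx.toIsIsometricImmersion hy,
    P.normalPart_eq hx.toIsIsometricImmersion hy, ← neg_smul, P.x_symm_eq hy, ← neg_div] at h1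
  have h2 := smul_left_injective ℝ hN h1
  rw [div_left_inj' hW] at h2
  have h3 : inner ℝ (P.normal y) (P.Y y) =
      inner ℝ P.ν (x p) + P.h y - fderiv ℝ P.h y (P.τ + y) := by
    rw [normal, Y, ← inner_gr P.h y, inner_add_right (gr P.h y), real_inner_comm P.τ,
      ← P.inner_E_center]
    simp only [inner_sub_left, inner_add_right, inner_smul_right, P.inner_ν, P.inner_ν',
      P.inner_ν_ν, P.inner_E]
    ring
  rw [h3] at h2
  linarith

/-- With H the Hessian of h, W = 1 + |∇h|² and g⁻¹ = I - ∇h ∇hᵀ / W, one has |A|² = tr(g⁻¹ H g⁻¹ H)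
/ W. Tracing the two indices one after the other produces the three terms. -/
theorem normSqA_eq (hx : IsIsometricImmersion x) {y : EuclideanSpace ℝ (Fin m)}
    (hy : y ∈ Metric.ball 0 P.r) : normSqA x (P.e.symm y) =
      (∑ k, ∑ l, pd k (pd l P.h) y ^ 2 -
        2 * (∑ k, (∑ l, pd l P.h y * pd l (pd k P.h) y) ^ 2) / (1 + ‖gr P.h y‖ ^ 2) +
        (∑ k, ∑ l, pd k P.h y * pd l P.h y * pd k (pd l P.h) y) ^ 2 / (1 + ‖gr P.h y‖ ^ 2) ^ 2) /
      (1 + ‖gr P.h y‖ ^ 2) := by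
  obtain ⟨t, ht, hA, -⟩ := P.exists_frame hx hy
  have hW : (1 + ‖gr P.h y‖ ^ 2) ≠ 0 := by positivity
  set W := (1 + ‖gr P.h y‖ ^ 2) with hWdef
  set H := fderiv ℝ (fderiv ℝ P.h) y with hH
  have hsymm : ∀ v w, H v w = H w v := fun v w =>
    ((P.contDiffAt_h y).isSymmSndFDerivAt (by simp)) v w
  have h1 : normSqA x (P.e.symm y) = (∑ i, ∑ j, H (t i) (t j) * H (t i) (t j)) / W := by
    simp only [normSqA, hA, norm_smul, mul_pow, P.norm_normal_sq, Finset.sum_div]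
    refine Finset.sum_congr rfl fun i _ => Finset.sum_congr rfl fun j _ => ?_
    rw [Real.norm_eq_abs, sq_abs, ← hWdef]
    field_simp
  have h2 : ∀ v, ∑ i, H v (t i) * H v (t i) =
      ∑ k, H v (EuclideanSpace.single k 1) * H v (EuclideanSpace.single k 1) -
        H v (gr P.h y) * H v (gr P.h y) / W := fun v => P.sum_frame_hess_sq ht v v
  rw [h1]
  congr 1
  simp only [h2, Finset.sum_sub_distrib]
  rw [Finset.sum_comm, ← Finset.sum_div]
  have h3 : ∀ v, ∑ i, H (t i) v * H (t i) v =
      ∑ k, H (EuclideanSpace.single k 1) v * H (EuclideanSpace.single k 1) v -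
        H (gr P.h y) v * H (gr P.h y) v / W := by
    intro v
    simp only [fun i => hsymm (t i) v, fun k => hsymm (EuclideanSpace.single k 1) v,
      hsymm (gr P.h y) v]
    exact h2 v
  simp only [h3, Finset.sum_sub_distrib]
  have h4 : ∀ k l, H (EuclideanSpace.single k 1) (EuclideanSpace.single l 1) =
      pd k (pd l P.h) y := fun k l => (pd_pd (P.contDiffAt_h y) k l).symm
  have h5 : ∀ k, H (gr P.h y) (EuclideanSpace.single k 1) =
      ∑ l, pd l P.h y * pd l (pd k P.h) y := by
    intro k
    rw [hH, hess_apply (P.contDiffAt_h y)]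
    simp [gr_apply]
  have h6 : H (gr P.h y) (gr P.h y) =
      ∑ k, ∑ l, pd k P.h y * pd l P.h y * pd k (pd l P.h) y :=
    hess_apply (P.contDiffAt_h y) _ _
  simp only [fun k => hsymm (EuclideanSpace.single k 1) (gr P.h y), h4, h5, h6, ← Finset.sum_div]
  rw [Finset.sum_comm (f := fun k l => pd l (pd k P.h) y * pd l (pd k P.h) y)]
  simp only [← sq]
  field_simp
  ring

end Patch

/-! ### Simons' inequality by explicit differentiation at a point with horizontal tangent. -/

section Simons

variable {m : ℕ}

attribute [fun_prop] contDiff_pd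

theorem pd_eventuallyEq {f g : EuclideanSpace ℝ (Fin m) → ℝ} {y : EuclideanSpace ℝ (Fin m)}
    (h : f =ᶠ[𝓝 y] g) (k : Fin m) : pd k f =ᶠ[𝓝 y] pd k g := by
  filter_upwards [h.fderiv (𝕜 := ℝ)] with z hz
  rw [pd, pd, hz]

theorem pd_add {f g : EuclideanSpace ℝ (Fin m) → ℝ} (hf : ContDiff ℝ ∞ f) (hg : ContDiff ℝ ∞ g)
    (k : Fin m) : pd k (fun y => f y + g y) = fun y => pd k f y + pd k g y := by
  funext y
  simp only [pd]
  rw [fderiv_fun_add (hf.differentiable (by simp) y) (hg.differentiable (by simp) y)]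
  rfl

theorem pd_sub {f g : EuclideanSpace ℝ (Fin m) → ℝ} (hf : ContDiff ℝ ∞ f) (hg : ContDiff ℝ ∞ g)
    (k : Fin m) : pd k (fun y => f y - g y) = fun y => pd k f y - pd k g y := by
  funext y
  simp only [pd]
  rw [fderiv_fun_sub (hf.differentiable (by simp) y) (hg.differentiable (by simp) y)]
  rfl

theorem pd_mul {f g : EuclideanSpace ℝ (Fin m) → ℝ} (hf : ContDiff ℝ ∞ f) (hg : ContDiff ℝ ∞ g)
    (k : Fin m) :
    pd k (fun y => f y * g y) = fun y => pd k f y * g y + f y * pd k g y := by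
  funext y
  simp only [pd]
  rw [fderiv_fun_mul (hf.differentiable (by simp) y) (hg.differentiable (by simp) y)]
  simp
  ring

theorem pd_sum {ι : Type*} (s : Finset ι) {f : ι → EuclideanSpace ℝ (Fin m) → ℝ}
    (hf : ∀ i, ContDiff ℝ ∞ (f i)) (k : Fin m) :
    pd k (fun y => ∑ i ∈ s, f i y) = fun y => ∑ i ∈ s, pd k (f i) y := by
  funext y
  simp only [pd]
  rw [fderiv_fun_sum fun i _ => (hf i).differentiable (by simp) y]
  simp

theorem pd_const (c : ℝ) (k : Fin m) : pd k (fun _ => c) = fun _ => 0 := by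
  funext y; simp [pd]

theorem pd_coord (j k : Fin m) :
    pd k (fun y : EuclideanSpace ℝ (Fin m) => y j) = fun _ => if j = k then 1 else 0 := by
  funext y
  have h1 : HasFDerivAt (fun y : EuclideanSpace ℝ (Fin m) => y j)
      (EuclideanSpace.proj j : EuclideanSpace ℝ (Fin m) →L[ℝ] ℝ) y :=
    (EuclideanSpace.proj j : EuclideanSpace ℝ (Fin m) →L[ℝ] ℝ).hasFDerivAt
  rw [pd, h1.fderiv]
  simp

theorem contDiff_coord (j : Fin m) : ContDiff ℝ ∞ fun y : EuclideanSpace ℝ (Fin m) => y j :=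
  (EuclideanSpace.proj j : EuclideanSpace ℝ (Fin m) →L[ℝ] ℝ).contDiff

/-- The inverse of the squared area density of a graph. -/
def invW (h : EuclideanSpace ℝ (Fin m) → ℝ) (y : EuclideanSpace ℝ (Fin m)) : ℝ :=
  (1 + ∑ k, pd k h y * pd k h y)⁻¹

theorem invW_pos (h : EuclideanSpace ℝ (Fin m) → ℝ) (y : EuclideanSpace ℝ (Fin m)) :
    0 < 1 + ∑ k, pd k h y * pd k h y :=
  add_pos_of_pos_of_nonneg one_pos (Finset.sum_nonneg fun _ _ => mul_self_nonneg _)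

theorem invW_eq (h : EuclideanSpace ℝ (Fin m) → ℝ) (y : EuclideanSpace ℝ (Fin m)) :
    invW h y = (1 + ‖gr h y‖ ^ 2)⁻¹ := by
  rw [invW, norm_gr_sq]; simp only [sq]

@[fun_prop]
theorem contDiff_invW {h : EuclideanSpace ℝ (Fin m) → ℝ} (hh : ContDiff ℝ ∞ h) :
    ContDiff ℝ ∞ (invW h) :=
  ContDiff.inv (by fun_prop) fun y => (invW_pos h y).ne'

theorem pd_invW {h : EuclideanSpace ℝ (Fin m) → ℝ} (hh : ContDiff ℝ ∞ h) (k : Fin m) :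
    pd k (invW h) = fun y => -2 * invW h y * invW h y * ∑ l, pd l h y * pd k (pd l h) y := by
  funext y
  have hd : ContDiff ℝ ∞ fun y => 1 + ∑ k, pd k h y * pd k h y := by fun_prop
  have h1 : pd k (fun y => 1 + ∑ k, pd k h y * pd k h y) y =
      2 * ∑ l, pd l h y * pd k (pd l h) y := by
    rw [pd_add contDiff_const (by fun_prop), pd_const, pd_sum _ (fun i => by fun_prop),
      Finset.mul_sum]
    simp only [zero_add]
    refine Finset.sum_congr rfl fun l _ => ?_
    rw [pd_mul (by fun_prop) (by fun_prop)]
    ring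
  have h2 := (hasDerivAt_inv (invW_pos h y).ne').comp_hasFDerivAt y
    (hd.differentiable (by simp) y).hasFDerivAt
  rw [pd, show invW h = (fun t => t⁻¹) ∘ fun y => 1 + ∑ k, pd k h y * pd k h y from rfl]
  erw [h2.fderiv]
  change _ * pd k (fun y => 1 + ∑ k, pd k h y * pd k h y) y = _
  rw [h1]
  simp only [Function.comp_apply]
  have := (invW_pos h y).ne'
  field_simp

/-- The drift Laplacian of a graph in its own coordinates. -/
def driftLap (h : EuclideanSpace ℝ (Fin m) → ℝ) (τ : EuclideanSpace ℝ (Fin m))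
    (F : EuclideanSpace ℝ (Fin m) → ℝ) (y : EuclideanSpace ℝ (Fin m)) : ℝ :=
  ∑ k, pd k (pd k F) y -
    invW h y * ∑ k, ∑ l, pd k h y * pd l h y * pd k (pd l F) y -
    ∑ k, (τ k + y k) * pd k F y

/-- The squared norm of the second fundamental form of a graph. -/
def graphNormSq (h : EuclideanSpace ℝ (Fin m) → ℝ) (y : EuclideanSpace ℝ (Fin m)) : ℝ :=
  invW h y * (∑ k, ∑ l, pd k (pd l h) y * pd k (pd l h) y) -
    2 * (invW h y * invW h y) * (∑ k, (∑ l, pd l h y * pd l (pd k h) y) *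
      (∑ l, pd l h y * pd l (pd k h) y)) +
    invW h y * invW h y * invW h y * ((∑ k, ∑ l, pd k h y * pd l h y * pd k (pd l h) y) *
      (∑ k, ∑ l, pd k h y * pd l h y * pd k (pd l h) y))

theorem contDiff_graphNormSq {h : EuclideanSpace ℝ (Fin m) → ℝ} (hh : ContDiff ℝ ∞ h) :
    ContDiff ℝ ∞ (graphNormSq h) := by
  unfold graphNormSq
  fun_prop

theorem pd_pd_mul {f g : EuclideanSpace ℝ (Fin m) → ℝ} (hf : ContDiff ℝ ∞ f)
    (hg : ContDiff ℝ ∞ g) (j k : Fin m) (y : EuclideanSpace ℝ (Fin m)) :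
    pd j (pd k (fun y => f y * g y)) y =
      pd j (pd k f) y * g y + pd k f y * pd j g y + (pd j f y * pd k g y + f y * pd j (pd k g) y) := by
  rw [pd_mul hf hg, pd_add (by fun_prop) (by fun_prop), pd_mul (by fun_prop) (by fun_prop),
    pd_mul (by fun_prop) (by fun_prop)]

theorem pd_pd_add {f g : EuclideanSpace ℝ (Fin m) → ℝ} (hf : ContDiff ℝ ∞ f)
    (hg : ContDiff ℝ ∞ g) (j k : Fin m) (y : EuclideanSpace ℝ (Fin m)) :
    pd j (pd k (fun y => f y + g y)) y = pd j (pd k f) y + pd j (pd k g) y := by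
  rw [pd_add hf hg, pd_add (by fun_prop) (by fun_prop)]

theorem pd_pd_sub {f g : EuclideanSpace ℝ (Fin m) → ℝ} (hf : ContDiff ℝ ∞ f)
    (hg : ContDiff ℝ ∞ g) (j k : Fin m) (y : EuclideanSpace ℝ (Fin m)) :
    pd j (pd k (fun y => f y - g y)) y = pd j (pd k f) y - pd j (pd k g) y := by
  rw [pd_sub hf hg, pd_sub (by fun_prop) (by fun_prop)]

theorem pd_pd_sum {ι : Type*} (s : Finset ι) {f : ι → EuclideanSpace ℝ (Fin m) → ℝ}
    (hf : ∀ i, ContDiff ℝ ∞ (f i)) (j k : Fin m) (y : EuclideanSpace ℝ (Fin m)) :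
    pd j (pd k (fun y => ∑ i ∈ s, f i y)) y = ∑ i ∈ s, pd j (pd k (f i)) y := by
  rw [pd_sum s hf, pd_sum s fun i => contDiff_pd (hf i) k]

variable {h : EuclideanSpace ℝ (Fin m) → ℝ}

theorem invW_zero (h0 : ∀ k, pd k h 0 = 0) : invW h 0 = 1 := by simp [invW, h0]

theorem pd_invW_zero (hh : ContDiff ℝ ∞ h) (h0 : ∀ k, pd k h 0 = 0) (k : Fin m) :
    pd k (invW h) 0 = 0 := by rw [pd_invW hh]; simp [h0]

theorem pd_pd_invW_zero (hh : ContDiff ℝ ∞ h) (h0 : ∀ k, pd k h 0 = 0) (k : Fin m) :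
    pd k (pd k (invW h)) 0 = -2 * ∑ l, pd k (pd l h) 0 * pd k (pd l h) 0 := by
  rw [pd_invW hh, pd_mul (by fun_prop) (by fun_prop), pd_sum _ (fun i => by fun_prop)]
  simp only [invW_zero h0, h0, zero_mul, Finset.sum_const_zero, mul_zero, zero_add]
  rw [mul_one, mul_one]
  congr 1
  refine Finset.sum_congr rfl fun l _ => ?_
  rw [pd_mul (by fun_prop) (by fun_prop)]
  simp [h0]

/-- The self-shrinker equation of a graph, differentiated twice at a point with horizontal
tangent space. -/
theorem pd_pd_laplacian (hh : ContDiff ℝ ∞ h) (h0 : ∀ k, pd k h 0 = 0)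
    {τ : EuclideanSpace ℝ (Fin m)} {c : ℝ}
    (heq : ∀ᶠ y in 𝓝 (0 : EuclideanSpace ℝ (Fin m)),
      driftLap h τ h y = -h y - c) (i j : Fin m) :
    ∑ k, pd i (pd j (pd k (pd k h))) 0 =
      pd i (pd j h) 0 + ∑ k, τ k * pd i (pd j (pd k h)) 0 +
        2 * ∑ k, ∑ l, pd i (pd k h) 0 * pd j (pd l h) 0 * pd k (pd l h) 0 := by
  set B : EuclideanSpace ℝ (Fin m) → ℝ := fun y =>
    ∑ k, ∑ l, pd k h y * pd l h y * pd k (pd l h) y with hB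
  have hBc : ContDiff ℝ ∞ B := by fun_prop
  set T : EuclideanSpace ℝ (Fin m) → ℝ := fun y => ∑ k, (τ k + y k) * pd k h y with hT
  have hcoord := contDiff_coord (m := m)
  have hTc : ContDiff ℝ ∞ T := by fun_prop
  -- The equation is solved for the flat Laplacian. Since ∇h vanishes at 0, B vanishes there to
  -- second order, and its second derivative keeps only the terms in which each of the two ∇h
  -- factors is differentiated once.
  have hev : (fun y => ∑ k, pd k (pd k h) y) =ᶠ[𝓝 0] fun y => invW h y * B y + T y - h y - c := by
    filter_upwards [heq] with y hy
    rw [driftLap] at hy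
    simp only [hB, hT]
    linarith
  have h1 := (pd_eventuallyEq (pd_eventuallyEq hev j) i).self_of_nhds
  rw [pd_pd_sum _ (fun k => by fun_prop), pd_pd_sub (by fun_prop) (by fun_prop),
    pd_pd_sub (by fun_prop) (by fun_prop), pd_pd_add (by fun_prop) (by fun_prop),
    pd_pd_mul (by fun_prop) (by fun_prop), pd_const, pd_const] at h1
  have hB0 : B 0 = 0 := by simp [hB, h0]
  have hpdB : ∀ k, pd k B 0 = 0 := by
    intro k
    rw [hB, pd_sum _ (fun i => by fun_prop)]
    refine Finset.sum_eq_zero fun a _ => ?_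
    rw [pd_sum _ (fun i => by fun_prop)]
    refine Finset.sum_eq_zero fun b _ => ?_
    rw [pd_mul (by fun_prop) (by fun_prop), pd_mul (by fun_prop) (by fun_prop)]
    simp [h0]
  have hpdpdB : pd i (pd j B) 0 =
      2 * ∑ k, ∑ l, pd i (pd k h) 0 * pd j (pd l h) 0 * pd k (pd l h) 0 := by
    have h2 : pd i (pd j B) 0 =
        ∑ k, ∑ l, (pd j (pd k h) 0 * pd i (pd l h) 0 * pd k (pd l h) 0 +
          pd i (pd k h) 0 * pd j (pd l h) 0 * pd k (pd l h) 0) := by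
      rw [hB, pd_pd_sum _ (fun i => by fun_prop)]
      refine Finset.sum_congr rfl fun a _ => ?_
      rw [pd_pd_sum _ (fun i => by fun_prop)]
      refine Finset.sum_congr rfl fun b _ => ?_
      rw [pd_pd_mul (by fun_prop) (by fun_prop), pd_pd_mul (by fun_prop) (by fun_prop),
        pd_mul (by fun_prop) (by fun_prop), pd_mul (by fun_prop) (by fun_prop)]
      simp only [h0]
      ring
    rw [h2]
    simp only [Finset.sum_add_distrib]
    have h3 : ∑ k, ∑ l, pd j (pd k h) 0 * pd i (pd l h) 0 * pd k (pd l h) 0 =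
        ∑ k, ∑ l, pd i (pd k h) 0 * pd j (pd l h) 0 * pd k (pd l h) 0 := by
      rw [Finset.sum_comm]
      refine Finset.sum_congr rfl fun a _ => Finset.sum_congr rfl fun b _ => ?_
      rw [pd_comm hh b a]
      ring
    rw [h3]
    ring
  have hpdpdT : pd i (pd j T) 0 = 2 * pd i (pd j h) 0 + ∑ k, τ k * pd i (pd j (pd k h)) 0 := by
    have h2 : pd i (pd j T) 0 = ∑ k, ((if k = j then pd i (pd k h) 0 else 0) +
        ((if k = i then pd j (pd k h) 0 else 0) + τ k * pd i (pd j (pd k h)) 0)) := by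
      rw [hT, pd_pd_sum _ (fun i => by fun_prop)]
      refine Finset.sum_congr rfl fun a _ => ?_
      rw [pd_pd_mul (by fun_prop) (by fun_prop), pd_pd_add (by fun_prop) (by fun_prop),
        pd_add (by fun_prop) (by fun_prop), pd_add (by fun_prop) (by fun_prop)]
      simp only [pd_const, pd_coord]
      simp
    rw [h2]
    simp only [Finset.sum_add_distrib, Finset.sum_ite_eq', Finset.mem_univ, if_true]
    rw [pd_comm hh j i]
    ring
  rw [hB0, hpdB, hpdB, hpdpdB, hpdpdT, invW_zero h0] at h1
  linarith

theorem graphNormSq_zero (h0 : ∀ k, pd k h 0 = 0) :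
    graphNormSq h 0 = ∑ k, ∑ l, pd k (pd l h) 0 * pd k (pd l h) 0 := by
  simp [graphNormSq, invW_zero h0, h0]

theorem pd_hessSq (hh : ContDiff ℝ ∞ h) (j : Fin m) (y : EuclideanSpace ℝ (Fin m)) :
    pd j (fun y => ∑ k, ∑ l, pd k (pd l h) y * pd k (pd l h) y) y =
      2 * ∑ k, ∑ l, pd k (pd l h) y * pd j (pd k (pd l h)) y := by
  rw [pd_sum _ (fun i => by fun_prop), Finset.mul_sum]
  refine Finset.sum_congr rfl fun k _ => ?_
  rw [pd_sum _ (fun i => by fun_prop), Finset.mul_sum]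
  refine Finset.sum_congr rfl fun l _ => ?_
  rw [pd_mul (by fun_prop) (by fun_prop)]
  ring

theorem pd_pd_hessSq (hh : ContDiff ℝ ∞ h) (j : Fin m) (y : EuclideanSpace ℝ (Fin m)) :
    pd j (pd j (fun y => ∑ k, ∑ l, pd k (pd l h) y * pd k (pd l h) y)) y =
      2 * ∑ k, ∑ l, (pd j (pd k (pd l h)) y * pd j (pd k (pd l h)) y +
        pd k (pd l h) y * pd j (pd j (pd k (pd l h))) y) := by
  rw [pd_pd_sum _ (fun i => by fun_prop), Finset.mul_sum]
  refine Finset.sum_congr rfl fun k _ => ?_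
  rw [pd_pd_sum _ (fun i => by fun_prop), Finset.mul_sum]
  refine Finset.sum_congr rfl fun l _ => ?_
  rw [pd_pd_mul (by fun_prop) (by fun_prop)]
  ring

/-- At a point with ∇h = 0 the corrections `Q` and `B²` vanish to second and fourth order. The last
two terms of the second derivative come from differentiating `invW` twice and `Q` twice; `B²`
contributes nothing. -/
theorem pd_graphNormSq_zero (hh : ContDiff ℝ ∞ h) (h0 : ∀ k, pd k h 0 = 0) (j : Fin m) :
    pd j (graphNormSq h) 0 = 2 * ∑ k, ∑ l, pd k (pd l h) 0 * pd j (pd k (pd l h)) 0 ∧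
    pd j (pd j (graphNormSq h)) 0 =
      2 * ∑ k, ∑ l, (pd j (pd k (pd l h)) 0 * pd j (pd k (pd l h)) 0 +
        pd k (pd l h) 0 * pd j (pd j (pd k (pd l h))) 0) -
      2 * (∑ l, pd j (pd l h) 0 * pd j (pd l h) 0) *
        (∑ k, ∑ l, pd k (pd l h) 0 * pd k (pd l h) 0) -
      4 * ∑ k, (∑ l, pd j (pd l h) 0 * pd l (pd k h) 0) *
        (∑ l, pd j (pd l h) 0 * pd l (pd k h) 0) := by
  set A : EuclideanSpace ℝ (Fin m) → ℝ := fun y => ∑ k, ∑ l, pd k (pd l h) y * pd k (pd l h) y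
    with hA
  set Q : EuclideanSpace ℝ (Fin m) → ℝ := fun y => ∑ k, (∑ l, pd l h y * pd l (pd k h) y) *
      (∑ l, pd l h y * pd l (pd k h) y) with hQ
  set B : EuclideanSpace ℝ (Fin m) → ℝ := fun y =>
    ∑ k, ∑ l, pd k h y * pd l h y * pd k (pd l h) y with hB
  have hAc : ContDiff ℝ ∞ A := by fun_prop
  have hQc : ContDiff ℝ ∞ Q := by fun_prop
  have hBc : ContDiff ℝ ∞ B := by fun_prop
  have hw := contDiff_invW hh
  have hB0 : B 0 = 0 := by simp [hB, h0]
  have hpdB : ∀ k, pd k B 0 = 0 := by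
    intro k
    rw [hB, pd_sum _ (fun i => by fun_prop)]
    refine Finset.sum_eq_zero fun a _ => ?_
    rw [pd_sum _ (fun i => by fun_prop)]
    refine Finset.sum_eq_zero fun b _ => ?_
    rw [pd_mul (by fun_prop) (by fun_prop), pd_mul (by fun_prop) (by fun_prop)]
    simp [h0]
  have hv : ∀ j k, pd j (fun y => ∑ l, pd l h y * pd l (pd k h) y) 0 =
      ∑ l, pd j (pd l h) 0 * pd l (pd k h) 0 := by
    intro j k
    rw [pd_sum _ (fun i => by fun_prop)]
    refine Finset.sum_congr rfl fun l _ => ?_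
    rw [pd_mul (by fun_prop) (by fun_prop)]
    simp [h0]
  have hQ0 : Q 0 = 0 := by simp [hQ, h0]
  have hpdQ : pd j Q 0 = 0 := by
    rw [hQ, pd_sum _ (fun i => by fun_prop)]
    refine Finset.sum_eq_zero fun a _ => ?_
    rw [pd_mul (by fun_prop) (by fun_prop)]
    simp [h0]
  have hpdpdQ : pd j (pd j Q) 0 = 2 * ∑ k, (∑ l, pd j (pd l h) 0 * pd l (pd k h) 0) *
        (∑ l, pd j (pd l h) 0 * pd l (pd k h) 0) := by
    rw [hQ, pd_pd_sum _ (fun i => by fun_prop), Finset.mul_sum]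
    refine Finset.sum_congr rfl fun k _ => ?_
    rw [pd_pd_mul (by fun_prop) (by fun_prop), hv]
    simp only [h0, zero_mul, Finset.sum_const_zero, mul_zero, zero_add, add_zero]
    ring
  -- Opaque names for the inner products of functions, so that the product rule opens only the
  -- outermost multiplication.
  obtain ⟨B₂, hB₂⟩ : ∃ B₂ : EuclideanSpace ℝ (Fin m) → ℝ, B₂ = fun y => B y * B y := ⟨_, rfl⟩
  obtain ⟨w₂, hw₂⟩ : ∃ w₂ : EuclideanSpace ℝ (Fin m) → ℝ, w₂ = fun y => invW h y * invW h y :=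
    ⟨_, rfl⟩
  obtain ⟨w₃, hw₃⟩ : ∃ w₃ : EuclideanSpace ℝ (Fin m) → ℝ,
    w₃ = fun y => invW h y * invW h y * invW h y := ⟨_, rfl⟩
  have hB₂c : ContDiff ℝ ∞ B₂ := by rw [hB₂]; fun_prop
  have hw₂c : ContDiff ℝ ∞ w₂ := by rw [hw₂]; fun_prop
  have hw₃c : ContDiff ℝ ∞ w₃ := by rw [hw₃]; fun_prop
  have hB₂0 : B₂ 0 = 0 := by simp [hB₂, hB0]
  have hpdB₂ : pd j B₂ 0 = 0 := by rw [hB₂, pd_mul hBc hBc]; simp [hB0]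
  have hpdpdB₂ : pd j (pd j B₂) 0 = 0 := by rw [hB₂, pd_pd_mul hBc hBc]; simp [hB0, hpdB]
  have hg : graphNormSq h = fun y => invW h y * A y - 2 * (w₂ y * Q y) + w₃ y * B₂ y := by
    rw [hw₂, hw₃, hB₂]
    funext y
    simp only [graphNormSq, hA, hB, hQ]
    ring
  have hi0 := invW_zero h0
  have hi1 := pd_invW_zero hh h0 j
  have hi2 := pd_pd_invW_zero hh h0 j
  have hw₂0 : w₂ 0 = 1 := by simp [hw₂, hi0]
  constructor
  · rw [hg, pd_add (by fun_prop) (by fun_prop), pd_sub (by fun_prop) (by fun_prop),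
      pd_mul hw hAc, pd_mul contDiff_const (by fun_prop), pd_mul hw₂c hQc, pd_mul hw₃c hB₂c]
    simp only [hi0, hi1, hB₂0, hpdB₂, hQ0, hpdQ]
    rw [hA, pd_hessSq hh]
    ring
  · rw [hg, pd_pd_add (by fun_prop) (by fun_prop), pd_pd_sub (by fun_prop) (by fun_prop),
      pd_pd_mul hw hAc, pd_pd_mul contDiff_const (by fun_prop), pd_pd_mul hw₂c hQc,
      pd_pd_mul hw₃c hB₂c, pd_const, pd_const]
    simp only [hi0, hi1, hi2, hw₂0, hB₂0, hpdB₂, hpdpdB₂, hQ0, hpdQ, hpdpdQ]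
    rw [hA, pd_pd_hessSq hh]
    ring

/-- Simons' inequality for self-shrinking graphs. -/
theorem simons (hh : ContDiff ℝ ∞ h) (h0 : ∀ k, pd k h 0 = 0)
    {τ : EuclideanSpace ℝ (Fin m)} {c : ℝ}
    (heq : ∀ᶠ y in 𝓝 (0 : EuclideanSpace ℝ (Fin m)),
      driftLap h τ h y = -h y - c) :
    ∑ j, pd j (graphNormSq h) 0 ^ 2 ≤ 2 * graphNormSq h 0 *
      (driftLap h τ (graphNormSq h) 0 - 2 * graphNormSq h 0 * (1 - graphNormSq h 0)) := by
  set G := ∑ j, ∑ k, ∑ l, pd j (pd k (pd l h)) 0 * pd j (pd k (pd l h)) 0 with hG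
  set a := fun k l => pd k (pd l h) 0 with ha
  have hsymm : ∀ k l, a k l = a l k := fun k l => by simp only [ha]; rw [pd_comm hh]
  -- With a the Hessian at 0 and G the squared norm of the third derivatives, L|A|² = 2G + 2|A|²(1 -
  -- |A|²). Commuting derivatives turns Δa into the Hessian of Δh, which the differentiated shrinker
  -- equation expresses through a. The resulting terms in |a²|² cancel those coming from the metric,
  -- and the τ terms cancel the drift.
  have hlap : driftLap h τ (graphNormSq h) 0 -
      2 * graphNormSq h 0 * (1 - graphNormSq h 0) = 2 * G := by
    have h4 : ∑ j, ∑ k, ∑ l, a k l * pd j (pd j (pd k (pd l h))) 0 =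
        ∑ k, ∑ l, a k l * (a k l + ∑ i, τ i * pd i (pd k (pd l h)) 0 +
          2 * ∑ i, ∑ j, a k i * a l j * a i j) := by
      rw [Finset.sum_comm]
      refine Finset.sum_congr rfl fun k _ => ?_
      rw [Finset.sum_comm]
      refine Finset.sum_congr rfl fun l _ => ?_
      rw [← Finset.mul_sum]
      congr 1
      have h5 := pd_pd_laplacian hh h0 heq k l
      have h6 : ∀ j, pd j (pd j (pd k (pd l h))) = pd k (pd l (pd j (pd j h))) := by
        intro j
        rw [pd_comm (contDiff_pd hh l) j k, pd_comm hh j l,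
          pd_comm (contDiff_pd (contDiff_pd hh j) l) j k,
          pd_comm (contDiff_pd hh j) j l]
      have h7 : ∀ j, pd k (pd l (pd j h)) = pd j (pd k (pd l h)) := by
        intro j
        rw [pd_comm hh l j, pd_comm (contDiff_pd hh l) k j]
      simp only [h6]
      simp only [h7] at h5
      exact h5
    have h8 : ∑ k, ∑ l, a k l * (2 * ∑ i, ∑ j, a k i * a l j * a i j) =
        2 * ∑ j, ∑ k, (∑ l, a j l * a l k) * (∑ l, a j l * a l k) := by
      have h9 : ∀ j k, (∑ l, a j l * a l k) * (∑ l, a j l * a l k) =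
          ∑ i, ∑ l, a j i * a i k * (a j l * a l k) := fun j k => Finset.sum_mul_sum _ _ _ _
      rw [← Finset.sum_congr rfl fun j _ => Finset.sum_congr rfl fun k _ => (h9 j k).symm]
      rw [Finset.sum_comm, Finset.mul_sum]
      refine Finset.sum_congr rfl fun l _ => ?_
      simp only [Finset.mul_sum]
      rw [Finset.sum_comm]
      refine Finset.sum_congr rfl fun i _ => Finset.sum_congr rfl fun k _ =>
        Finset.sum_congr rfl fun j _ => ?_
      rw [hsymm k l, hsymm i j]
      ring
    have h10 : ∑ k, ∑ l, a k l * ∑ i, τ i * pd i (pd k (pd l h)) 0 =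
        ∑ i, τ i * ∑ k, ∑ l, a k l * pd i (pd k (pd l h)) 0 := by
      simp only [Finset.mul_sum]
      conv_rhs => rw [Finset.sum_comm]
      refine Finset.sum_congr rfl fun k _ => ?_
      rw [Finset.sum_comm]
      exact Finset.sum_congr rfl fun i _ => Finset.sum_congr rfl fun l _ => by ring
    have h11 : driftLap h τ (graphNormSq h) 0 =
        ∑ j, pd j (pd j (graphNormSq h)) 0 - ∑ j, τ j * pd j (graphNormSq h) 0 := by
      simp [driftLap, h0]
    rw [h11, graphNormSq_zero h0]
    simp only [fun j => (pd_graphNormSq_zero hh h0 j).1, fun j => (pd_graphNormSq_zero hh h0 j).2]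
    simp only [mul_add, Finset.sum_add_distrib, h8, h10] at h4
    simp only [Finset.sum_sub_distrib, ← Finset.mul_sum, ← Finset.sum_mul, Finset.sum_add_distrib]
    change _ = 2 * G
    simp only [mul_left_comm _ (2 : ℝ), ← Finset.mul_sum]
    simp only [ha] at h4
    rw [h4, ← hG]
    ring
  -- Cauchy-Schwarz over pairs of indices: each derivative of |A|² is 2⟨A, ∂ⱼA⟩ at the centre.
  have hgrad : ∑ j, pd j (graphNormSq h) 0 ^ 2 ≤ 4 * graphNormSq h 0 * G := by
    rw [graphNormSq_zero h0, hG, Finset.mul_sum]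
    refine Finset.sum_le_sum fun j _ => ?_
    rw [(pd_graphNormSq_zero hh h0 j).1, mul_pow]
    have := Finset.sum_mul_sq_le_sq_mul_sq (Finset.univ (α := Fin m × Fin m))
      (fun i => pd i.1 (pd i.2 h) 0) (fun i => pd j (pd i.1 (pd i.2 h)) 0)
    simp only [Fintype.sum_prod_type, sq] at this ⊢
    linarith
  rw [hlap]
  linarith

end Simons

/-! ### The drift Laplacian in a patch and its independence of the patch. -/

namespace Patch

variable {m : ℕ} {M : Type*} [MetricSpace M] [ChartedSpace (EuclideanSpace ℝ (Fin m)) M]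
  {x : M → EuclideanSpace ℝ (Fin (m + 1))} {p : M} (P : Patch x p)

theorem gr_zero : gr P.h 0 = 0 := by
  ext k
  simp [gr_apply, pd, P.fderiv_zero]

theorem pd_zero (k : Fin m) : pd k P.h 0 = 0 := by simp [pd, P.fderiv_zero]

theorem driftLap_eq_hess {F : EuclideanSpace ℝ (Fin m) → ℝ} {y : EuclideanSpace ℝ (Fin m)}
    (hF : ContDiffAt ℝ 2 F y) :
    driftLap P.h P.τ F y = ∑ k, fderiv ℝ (fderiv ℝ F) y (EuclideanSpace.single k 1)
      (EuclideanSpace.single k 1) -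
      fderiv ℝ (fderiv ℝ F) y (gr P.h y) (gr P.h y) / (1 + ‖gr P.h y‖ ^ 2) -
      fderiv ℝ F y (P.τ + y) := by
  rw [driftLap, hess_apply hF (gr P.h y), fderiv_eq_sum_pd, invW_eq, inv_mul_eq_div]
  simp only [pd_pd hF, gr_apply]
  rfl

/-- Written as a trace over an orthonormal frame, the second order part transforms well under a
change of patch and has a visible sign at a minimum. -/
theorem driftLap_frame {ι : Type*} [Fintype ι] {F : EuclideanSpace ℝ (Fin m) → ℝ}
    {y : EuclideanSpace ℝ (Fin m)} (hF : ContDiffAt ℝ 2 F y) {t : ι → EuclideanSpace ℝ (Fin m)}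
    (ht : ∀ v, v = ∑ i, (inner ℝ (t i) v + inner ℝ (gr P.h y) (t i) * inner ℝ (gr P.h y) v : ℝ) •
        t i) :
    driftLap P.h P.τ F y =
      ∑ i, fderiv ℝ (fderiv ℝ F) y (t i) (t i) - fderiv ℝ F y (P.τ + y) := by
  rw [P.driftLap_eq_hess hF]
  congr 1
  exact (sum_frame_eq ht (LinearMap.mk₂ ℝ (fun v w => fderiv ℝ (fderiv ℝ F) y v w)
    (fun _ _ _ => by simp) (fun _ _ _ => by simp) (fun _ _ _ => by simp)
    (fun _ _ _ => by simp))).symm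

theorem center_eq : x p = P.E P.τ + (inner ℝ P.ν (x p) : ℝ) • P.ν :=
  decompose_normal P.E P.norm_ν P.inner_ν (x p)

theorem hasFDerivAt_inner_Y (b : EuclideanSpace ℝ (Fin (m + 1))) (y : EuclideanSpace ℝ (Fin m)) :
    HasFDerivAt (fun y => inner ℝ b (P.Y y) : EuclideanSpace ℝ (Fin m) → ℝ)
      ((innerSL ℝ b).comp (fderiv ℝ P.Y y)) y :=
  (innerSL ℝ b).hasFDerivAt.comp y ((P.contDiff_Y.differentiable (by simp)) y).hasFDerivAt

theorem contDiff_inner_Y (b : EuclideanSpace ℝ (Fin (m + 1))) :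
    ContDiff ℝ ∞ (fun y => inner ℝ b (P.Y y) : EuclideanSpace ℝ (Fin m) → ℝ) :=
  contDiff_const.inner ℝ P.contDiff_Y

theorem pd_inner_Y (b : EuclideanSpace ℝ (Fin (m + 1))) (k : Fin m) :
    pd k (fun y => inner ℝ b (P.Y y) : EuclideanSpace ℝ (Fin m) → ℝ) =
      fun y => inner ℝ b (P.E (EuclideanSpace.single k 1)) + inner ℝ b P.ν * pd k P.h y := by
  funext y
  rw [pd, (P.hasFDerivAt_inner_Y b y).fderiv, ContinuousLinearMap.comp_apply,
    innerSL_apply_apply, fderiv_Y_apply, inner_add_right, inner_smul_right, mul_comm]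
  rfl

theorem contDiffAt_two {F : Type*} [NormedAddCommGroup F] [NormedSpace ℝ F]
    {f : EuclideanSpace ℝ (Fin m) → F} (hf : ContDiff ℝ ∞ f) (y : EuclideanSpace ℝ (Fin m)) :
    ContDiffAt ℝ 2 f y := hf.contDiffAt.of_le (by norm_cast)

variable [IsManifold (𝓡 m) ∞ M] [RiemannianBundle (fun p : M => TangentSpace (𝓡 m) p)]

theorem driftLap_h (hx : IsSelfShrinker x) {y : EuclideanSpace ℝ (Fin m)}
    (hy : y ∈ Metric.ball 0 P.r) :
    driftLap P.h P.τ P.h y = -P.h y - inner ℝ P.ν (x p) := by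
  rw [P.driftLap_eq_hess (P.contDiffAt_h y)]
  have := P.shrinker_graph hx hy
  simp only [pd_pd (P.contDiffAt_h y)] at this
  rw [this]
  ring

theorem eventually_driftLap_h (hx : IsSelfShrinker x) :
    ∀ᶠ y in 𝓝 (0 : EuclideanSpace ℝ (Fin m)),
      driftLap P.h P.τ P.h y = -P.h y - inner ℝ P.ν (x p) := by
  filter_upwards [P.eventually_mem P.zero_mem] with y hy using P.driftLap_h hx hy

/-- Each coordinate of the position vector is an eigenfunction of the drift Laplacian. -/
theorem driftLap_inner_Y (hx : IsSelfShrinker x) (b : EuclideanSpace ℝ (Fin (m + 1)))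
    {y : EuclideanSpace ℝ (Fin m)} (hy : y ∈ Metric.ball 0 P.r) :
    driftLap P.h P.τ (fun y => inner ℝ b (P.Y y)) y = -inner ℝ b (P.Y y) := by
  have hpd : ∀ k l, pd k (pd l (fun y => inner ℝ b (P.Y y) : EuclideanSpace ℝ (Fin m) → ℝ)) =
      fun y => inner ℝ b P.ν * pd k (pd l P.h) y := by
    intro k l
    rw [pd_inner_Y, pd_add contDiff_const (contDiff_const.mul (contDiff_pd P.smooth l)),
      pd_mul contDiff_const (contDiff_pd P.smooth l), pd_const, pd_const]
    simp
  have h1 := P.driftLap_h hx hy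
  have hexp : ∀ v : EuclideanSpace ℝ (Fin m), inner ℝ b (P.E v) =
      ∑ k, v k * inner ℝ b (P.E (EuclideanSpace.single k (1 : ℝ))) := by
    intro v
    conv_lhs => rw [← (EuclideanSpace.basisFun (Fin m) ℝ).sum_repr v]
    simp [inner_sum, inner_smul_right]
  have h2 : inner ℝ b (P.Y y) = inner ℝ b (P.E (P.τ + y)) +
      inner ℝ b P.ν * (P.h y + inner ℝ P.ν (x p)) := by
    rw [Y, P.center_eq]
    simp only [inner_add_right, inner_smul_right, map_add, P.inner_ν, P.inner_ν_ν]
    ring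
  rw [h2, hexp]
  rw [driftLap] at h1 ⊢
  simp only [hpd]
  simp only [P.pd_inner_Y b, mul_add, Finset.sum_add_distrib]
  simp only [mul_left_comm _ (inner ℝ b P.ν : ℝ), ← Finset.mul_sum]
  simp only [PiLp.add_apply]
  simp only [add_mul, Finset.sum_add_distrib] at h1 ⊢
  linear_combination (inner ℝ b P.ν : ℝ) * h1

theorem exists_frame_at (hx : IsIsometricImmersion x) {q : M} (hq : q ∈ P.e.source) :
    ∃ t : Fin (Module.finrank ℝ (TangentSpace (𝓡 m) q)) → EuclideanSpace ℝ (Fin m),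
      (∀ v, v = ∑ i, (inner ℝ (t i) v +
        inner ℝ (gr P.h (P.e q)) (t i) * inner ℝ (gr P.h (P.e q)) v : ℝ) • t i) ∧
      (∀ (φ : M → ℝ) i, dif φ q (stdOrthonormalBasis ℝ (TangentSpace (𝓡 m) q) i) =
        fderiv ℝ (φ ∘ P.e.symm) (P.e q) (t i)) := by
  obtain ⟨y, hy, rfl⟩ : ∃ y ∈ Metric.ball 0 P.r, P.e.symm y = q :=
    ⟨P.e q, P.e_mem hq, P.e.left_inv hq⟩
  obtain ⟨t, ht, -, hd⟩ := P.exists_frame hx hy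
  rw [P.e_symm hy]
  exact ⟨t, ht, hd⟩

/-- The drift Laplacian does not depend on the patch. -/
theorem driftLap_invariant (hx : IsSelfShrinker x) {p' : M} (P' : Patch x p') {q : M}
    (hq : q ∈ P.e.source) (hq' : q ∈ P'.e.source) {F : M → ℝ}
    {F₁ F₂ : EuclideanSpace ℝ (Fin m) → ℝ} (hF₁ : F ∘ P.e.symm =ᶠ[𝓝 (P.e q)] F₁)
    (hF₂ : F ∘ P'.e.symm =ᶠ[𝓝 (P'.e q)] F₂) (hF₂c : ContDiff ℝ ∞ F₂) :
    driftLap P.h P.τ F₁ (P.e q) = driftLap P'.h P'.τ F₂ (P'.e q) := by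
  set y := P.e q with hy
  have hyb : y ∈ Metric.ball 0 P.r := P.e_mem hq
  have hsymm : P.e.symm y = q := P.e.left_inv hq
  have hsrc : ∀ᶠ z in 𝓝 y, P.e.symm z ∈ P'.e.source :=
    P.continuousAt_symm hyb (by rw [hsymm]; exact P'.e.open_source.mem_nhds hq')
  set A' := P'.E.toContinuousLinearMap.adjoint with hA'
  -- The transition map between the two patches, extended to a globally smooth map by the projection
  -- formula for patch coordinates.
  set Ψ : EuclideanSpace ℝ (Fin m) → EuclideanSpace ℝ (Fin m) := fun z => A' (P.Y z - x p') with hΨ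
  have hΨc : ContDiff ℝ ∞ Ψ := A'.contDiff.comp (P.contDiff_Y.sub contDiff_const)
  have hΨe : (fun z => P'.e (P.e.symm z)) =ᶠ[𝓝 y] Ψ := by
    filter_upwards [hsrc, P.eventually_mem hyb] with z hz hz'
    rw [P'.e_eq_adjoint hz, P.x_symm_eq hz']
  have hΨy : Ψ y = P'.e q := by
    rw [← hΨe.self_of_nhds]; exact congrArg _ hsymm
  have hΨD : ∀ z, HasFDerivAt Ψ (A'.comp (fderiv ℝ P.Y z)) z := fun z =>
    A'.hasFDerivAt.comp z (((P.contDiff_Y.differentiable (by simp) z).hasFDerivAt).sub_const _)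
  have hcomp : F₁ =ᶠ[𝓝 y] F₂ ∘ Ψ := by
    have h1 : ∀ᶠ z in 𝓝 y, F (P'.e.symm (Ψ z)) = F₂ (Ψ z) :=
      (hΨc.continuous.tendsto' y _ hΨy).eventually hF₂
    filter_upwards [hF₁, h1, hΨe, hsrc] with z h1 h2 h3 h4
    rw [Function.comp_apply, ← h2, ← h3, P'.e.left_inv h4, ← h1, Function.comp_apply]
  obtain ⟨t, ht, hd⟩ := P.exists_frame_at hx.toIsIsometricImmersion hq
  obtain ⟨t', ht', hd'⟩ := P'.exists_frame_at hx.toIsIsometricImmersion hq'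
  -- Both frames represent the same tangent vectors; applying them to the coordinate functions of
  -- the second patch compares their components.
  have htt' : ∀ i, fderiv ℝ Ψ y (t i) = t' i := by
    intro i
    ext k
    have h1 := hd (fun z => P'.e z k) i
    rw [hd' (fun z => P'.e z k) i] at h1
    have h2 : (fun z => P'.e z k) ∘ P'.e.symm =ᶠ[𝓝 (P'.e q)]
        (EuclideanSpace.proj k : EuclideanSpace ℝ (Fin m) →L[ℝ] ℝ) := by
      filter_upwards [P'.eventually_mem (P'.e_mem hq')] with z hz
      simp [P'.e_symm hz]
    have h3 : (fun z => P'.e z k) ∘ P.e.symm =ᶠ[𝓝 y]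
        (EuclideanSpace.proj k : EuclideanSpace ℝ (Fin m) →L[ℝ] ℝ) ∘ Ψ := by
      filter_upwards [hΨe] with z hz
      simp [← hz]
    rw [h2.fderiv_eq, h3.fderiv_eq, ContinuousLinearMap.fderiv,
      ((EuclideanSpace.proj k : EuclideanSpace ℝ (Fin m) →L[ℝ] ℝ).hasFDerivAt.comp y
        (hΨD y)).fderiv] at h1
    rw [(hΨD y).fderiv]
    simpa using h1.symm
  have hF₁c : ContDiffAt ℝ 2 F₁ y := (contDiffAt_two (hF₂c.comp hΨc) y).congr_of_eventuallyEq hcomp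
  have hΨ2 : ContDiffAt ℝ 2 Ψ y := contDiffAt_two hΨc y
  rw [P.driftLap_frame hF₁c ht, P'.driftLap_frame (contDiffAt_two hF₂c _) ht',
    hcomp.fderiv.fderiv_eq, hcomp.fderiv_eq]
  simp only [fderiv_fderiv_comp (contDiffAt_two hF₂c (Ψ y)) hΨ2, htt', hΨy,
    Finset.sum_add_distrib]
  rw [fderiv_comp y (hF₂c.differentiable (by simp) _) (hΨc.differentiable (by simp) _),
    ContinuousLinearMap.comp_apply, hΨy, add_sub_assoc, sub_eq_add_neg _ (fderiv ℝ F₂ _ _)]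
  -- The Hessian traces of `F₂` agree because Ψ carries one frame to the other. What remains is the
  -- first order part, L Ψ = -(τ' + Ψ).
  congr 1
  rw [← map_sum, ← sub_eq_add_neg, ← map_sub, ← map_neg]
  congr 1
  -- the drift Laplacian of the coordinates
  have hkey : ∀ k, (∑ i, fderiv ℝ (fderiv ℝ Ψ) y (t i) (t i) - fderiv ℝ Ψ y (P.τ + y)) k =
      driftLap P.h P.τ (fun z => Ψ z k) y := by
    intro k
    have hk : ContDiff ℝ ∞ fun z => Ψ z k := (contDiff_coord k).comp hΨc
    have hkD : ∀ z, fderiv ℝ (fun z => Ψ z k) z =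
        (EuclideanSpace.proj k : EuclideanSpace ℝ (Fin m) →L[ℝ] ℝ).comp (fderiv ℝ Ψ z) := fun z =>
      ((EuclideanSpace.proj k : EuclideanSpace ℝ (Fin m) →L[ℝ] ℝ).hasFDerivAt.comp z
        (hΨc.differentiable (by simp) z).hasFDerivAt).fderiv
    have hkDD : ∀ v w, fderiv ℝ (fderiv ℝ fun z => Ψ z k) y v w =
        fderiv ℝ (fderiv ℝ Ψ) y v w k := by
      intro v w
      have h1 := fderiv_fderiv_comp (X := fun z : EuclideanSpace ℝ (Fin m) => z k) (κ := Ψ)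
        (contDiffAt_two (contDiff_coord k) (Ψ y)) hΨ2 v w
      have h2 : fderiv ℝ (fun z : EuclideanSpace ℝ (Fin m) => z k) = fun _ =>
          (EuclideanSpace.proj k : EuclideanSpace ℝ (Fin m) →L[ℝ] ℝ) := funext fun z =>
        ((EuclideanSpace.proj k : EuclideanSpace ℝ (Fin m) →L[ℝ] ℝ).hasFDerivAt).fderiv
      rw [h2] at h1
      simpa [Function.comp_def] using h1
    rw [P.driftLap_frame (contDiffAt_two hk y) ht, hkD]
    simp [hkDD]
  -- Each coordinate of the second patch is ⟨b, x⟩ minus a constant. L ignores the constant and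
  -- sends ⟨b, x⟩ to its negative, so the shrinker equation is what makes L invariant in this form.
  have hfin : ∀ k, driftLap P.h P.τ (fun z => Ψ z k) y = -(P'.τ + P'.e q) k := by
    intro k
    set b := P'.E (EuclideanSpace.single k 1) with hb
    have h1 : ∀ z, A' z k = inner ℝ b z := by
      intro z
      have := ContinuousLinearMap.adjoint_inner_left P'.E.toContinuousLinearMap
        (EuclideanSpace.single k (1 : ℝ)) z
      rw [EuclideanSpace.inner_single_right] at this
      rw [real_inner_comm]
      simpa using this
    have h2 : (fun z => Ψ z k) = fun z => inner ℝ b (P.Y z) - inner ℝ b (x p') := by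
      funext z
      rw [hΨ]
      simp only [h1, inner_sub_right]
    have h3 : ∀ l, pd l (fun z => Ψ z k) = pd l fun z => inner ℝ b (P.Y z) := by
      intro l
      rw [h2, pd_sub (P.contDiff_inner_Y b) contDiff_const, pd_const]
      simp
    have h4 : driftLap P.h P.τ (fun z => Ψ z k) y =
        driftLap P.h P.τ (fun z => inner ℝ b (P.Y z)) y := by
      simp only [driftLap, h3]
    rw [h4, P.driftLap_inner_Y hx b hyb, ← P.x_eq hq, ← h1, P'.e_eq_adjoint hq', map_sub]
    simp [τ, hA']
  ext k
  rw [hkey, hfin]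
  rfl

end Patch

/-! ### The drift Laplacian as a weighted divergence, and integration by parts in a patch. -/

section Divergence

variable {m : ℕ} {h : EuclideanSpace ℝ (Fin m) → ℝ}

/-- The area density of a graph. -/
def areaDens (h : EuclideanSpace ℝ (Fin m) → ℝ) (y : EuclideanSpace ℝ (Fin m)) : ℝ :=
  Real.sqrt (1 + ∑ k, pd k h y * pd k h y)

@[fun_prop]
theorem contDiff_areaDens (hh : ContDiff ℝ ∞ h) : ContDiff ℝ ∞ (areaDens h) :=
  ContDiff.sqrt (by fun_prop) fun y => (invW_pos h y).ne'

theorem areaDens_pos (y : EuclideanSpace ℝ (Fin m)) : 0 < areaDens h y :=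
  Real.sqrt_pos.2 (invW_pos h y)

/-- Obtained by differentiating `areaDens`² · `invW` = 1 instead of the square root. -/
theorem pd_areaDens (hh : ContDiff ℝ ∞ h) (k : Fin m) (y : EuclideanSpace ℝ (Fin m)) :
    pd k (areaDens h) y = areaDens h y * invW h y * ∑ l, pd l h y * pd k (pd l h) y := by
  have h1 : areaDens h y * areaDens h y * invW h y = 1 := by
    rw [areaDens, Real.mul_self_sqrt (invW_pos h y).le, invW, mul_inv_cancel₀ (invW_pos h y).ne']
  have h2 : (fun y => areaDens h y * areaDens h y * invW h y) = fun _ => (1 : ℝ) := by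
    funext y
    rw [areaDens, Real.mul_self_sqrt (invW_pos h y).le, invW, mul_inv_cancel₀ (invW_pos h y).ne']
  have h3 := congrFun (congrArg (pd k) h2) y
  have hW := contDiff_areaDens hh
  rw [pd_const, pd_mul (by fun_prop) (by fun_prop), pd_mul (by fun_prop) (by fun_prop),
    pd_invW hh] at h3
  have hpos := areaDens_pos (h := h) y
  have h4 : 0 < invW h y := inv_pos.2 (invW_pos h y)
  have h5 : areaDens h y * invW h y ≠ 0 := by positivity
  apply mul_left_cancel₀ h5
  linear_combination (1 / 2 : ℝ) * h3

/-- The flux of the gradient of `F` for the density `ρ` on a graph. -/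
def flux (h ρ F : EuclideanSpace ℝ (Fin m) → ℝ) (k : Fin m) (y : EuclideanSpace ℝ (Fin m)) : ℝ :=
  ρ y * (pd k F y - pd k h y * (∑ j, pd j h y * pd j F y) * invW h y)

theorem contDiff_flux {ρ F : EuclideanSpace ℝ (Fin m) → ℝ} (hh : ContDiff ℝ ∞ h)
    (hρ : ContDiff ℝ ∞ ρ) (hF : ContDiff ℝ ∞ F) (k : Fin m) : ContDiff ℝ ∞ (flux h ρ F k) := by
  unfold flux
  fun_prop

/-- Expanding the divergence of ρ g⁻¹∇F leaves, besides ρ L F, a multiple of the mean curvature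
expression of the graph plus the normal component of x. The shrinker equation `heq` makes it vanish;
`hpg` says that `g` is the Gaussian weight. -/
theorem sum_pd_flux {ρ F g : EuclideanSpace ℝ (Fin m) → ℝ} (hh : ContDiff ℝ ∞ h)
    (hF : ContDiff ℝ ∞ F) (hg : ContDiff ℝ ∞ g) {τ : EuclideanSpace ℝ (Fin m)} {c : ℝ}
    {y : EuclideanSpace ℝ (Fin m)} (heq : driftLap h τ h y = -h y - c)
    (hρ : ρ = fun y => areaDens h y * g y)
    (hpg : ∀ k, pd k g y = -(((τ k + y k) + (c + h y) * pd k h y) * g y)) :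
    ∑ k, pd k (flux h ρ F k) y = ρ y * driftLap h τ F y := by
  have hW := contDiff_areaDens hh
  obtain ⟨θ, hθ⟩ : ∃ θ : EuclideanSpace ℝ (Fin m) → ℝ, θ = fun y => ∑ j, pd j h y * pd j F y :=
    ⟨_, rfl⟩
  have hθc : ContDiff ℝ ∞ θ := by rw [hθ]; fun_prop
  have hflux : ∀ k, flux h ρ F k = fun y => areaDens h y * g y *
      (pd k F y - pd k h y * θ y * invW h y) := by
    intro k; funext y; rw [flux, hρ, hθ]
  have hpθ : ∀ k, pd k θ y = ∑ j, pd k (pd j h) y * pd j F y + ∑ j, pd j h y * pd k (pd j F) y := by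
    intro k
    rw [hθ, pd_sum _ (fun i => by fun_prop), ← Finset.sum_add_distrib]
    exact Finset.sum_congr rfl fun j _ => by rw [pd_mul (by fun_prop) (by fun_prop)]
  set κ := invW h y with hκ
  set w := areaDens h y with hw
  set δ : Fin m → ℝ := fun k => ∑ l, pd l h y * pd k (pd l h) y with hδ
  have hpflux : ∀ k, pd k (flux h ρ F k) y = w * g y *
      ((κ * δ k - (τ k + y k) - (c + h y) * pd k h y) * (pd k F y - pd k h y * θ y * κ) +
      (pd k (pd k F) y - pd k (pd k h) y * θ y * κ - pd k h y * pd k θ y * κ +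
        2 * κ * κ * θ y * (pd k h y * δ k))) := by
    intro k
    rw [hflux, pd_mul (by fun_prop) (by fun_prop), pd_mul (by fun_prop) (by fun_prop),
      pd_sub (by fun_prop) (by fun_prop), pd_mul (by fun_prop) (by fun_prop),
      pd_mul (by fun_prop) (by fun_prop)]
    simp only [pd_areaDens hh, pd_invW hh, hpg]
    ring
  have hrw : ∀ k, ((κ * δ k - (τ k + y k) - (c + h y) * pd k h y) *
      (pd k F y - pd k h y * θ y * κ) +
      (pd k (pd k F) y - pd k (pd k h) y * θ y * κ - pd k h y * pd k θ y * κ +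
        2 * κ * κ * θ y * (pd k h y * δ k))) =
      κ * (δ k * pd k F y) + κ * κ * θ y * (pd k h y * δ k) - (τ k + y k) * pd k F y +
      θ y * κ * ((τ k + y k) * pd k h y) - (c + h y) * (pd k h y * pd k F y) +
      (c + h y) * θ y * κ * (pd k h y * pd k h y) + pd k (pd k F) y -
      θ y * κ * pd k (pd k h) y - κ * (pd k h y * pd k θ y) := fun k => by ring
  have hθy : ∑ k, pd k h y * pd k F y = θ y := by rw [hθ]
  have hκ1 : κ * ∑ k, pd k h y * pd k h y = 1 - κ := by
    have := invW_pos h y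
    rw [hκ, invW]
    field_simp
    ring
  have hB : ∑ k, pd k h y * δ k = ∑ k, ∑ l, pd k h y * pd l h y * pd k (pd l h) y := by
    simp only [hδ, Finset.mul_sum, mul_assoc]
  have hdθ : ∑ k, pd k h y * pd k θ y =
      ∑ k, δ k * pd k F y + ∑ k, ∑ l, pd k h y * pd l h y * pd k (pd l F) y := by
    simp only [hpθ, mul_add, Finset.sum_add_distrib]
    congr 1
    · simp only [hδ, Finset.mul_sum, Finset.sum_mul]
      rw [Finset.sum_comm]
      refine Finset.sum_congr rfl fun k _ => Finset.sum_congr rfl fun l _ => ?_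
      rw [pd_comm hh l k]; ring
    · simp only [Finset.mul_sum, mul_assoc]
  simp only [hpflux, hrw]
  rw [← Finset.mul_sum]
  simp only [Finset.sum_sub_distrib, Finset.sum_add_distrib, ← Finset.mul_sum]
  rw [hdθ, hB, hθy, hρ, driftLap]
  rw [driftLap, ← hκ] at heq
  simp only [← hκ, ← hw]
  linear_combination (-(w * g y * θ y * κ)) * heq + (w * g y * (c + h y) * θ y) * hκ1

/-- `V` is cut off by a bump equal to 1 on the support of `ψ`, which makes it Lipschitz with compact
support. Integration by parts for line derivatives then applies, and Rademacher's theorem identifies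
the line derivative of `ψ` with the partial derivative almost everywhere. -/
theorem integral_flux_mul {ψ : EuclideanSpace ℝ (Fin m) → ℝ} {C : NNReal}
    (hψ : LipschitzWith C ψ) {s : ℝ} (hs : tsupport ψ ⊆ Metric.ball 0 s)
    {V : EuclideanSpace ℝ (Fin m) → ℝ} (hV : ContDiff ℝ ∞ V) (k : Fin m) :
    Integrable (fun y => V y * pd k ψ y) ∧
      ∫ y, V y * pd k ψ y = -∫ y, ψ y * pd k V y := by
  by_cases hs0 : 0 < s
  swap
  · have hψ0 : ψ = 0 := by
      rw [Metric.ball_eq_empty.2 (not_lt.1 hs0), Set.subset_empty_iff, tsupport_eq_empty_iff] at hs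
      exact hs
    have h1 : ∀ y, pd k ψ y = 0 := fun y => by rw [hψ0]; simp [pd]
    simp only [h1]
    simp [hψ0]
  let β : ContDiffBump (0 : EuclideanSpace ℝ (Fin m)) := ⟨s, 2 * s, hs0, by linarith⟩
  set g : EuclideanSpace ℝ (Fin m) → ℝ := fun y => β y * V y with hg
  have hgc : ContDiff ℝ ∞ g := β.contDiff.mul hV
  have hgs : HasCompactSupport g := β.hasCompactSupport.mul_right
  obtain ⟨D, hD⟩ := hgc.lipschitzWith_of_hasCompactSupport hgs (by simp)
  have heqOn : ∀ y ∈ Metric.ball (0 : EuclideanSpace ℝ (Fin m)) s, g y = V y := fun y hy => by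
    have : β y = 1 := β.one_of_mem_closedBall (Metric.ball_subset_closedBall hy)
    simp [hg, this]
  have hout : ∀ y, y ∉ tsupport ψ → pd k ψ y = 0 := fun y hy => by
    have : fderiv ℝ ψ y = 0 := by
      have h1 : ψ =ᶠ[𝓝 y] fun _ => 0 := notMem_tsupport_iff_eventuallyEq.1 hy
      rw [h1.fderiv_eq]; simp
    simp [pd, this]
  have h1 : ∀ y, V y * pd k ψ y = g y * pd k ψ y := fun y => by
    by_cases hy : y ∈ tsupport ψ
    · rw [heqOn y (hs hy)]
    · rw [hout y hy, mul_zero, mul_zero]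
  have h2 : ∀ y, ψ y * pd k V y = ψ y * pd k g y := fun y => by
    by_cases hy : y ∈ tsupport ψ
    · have : g =ᶠ[𝓝 y] V := by
        filter_upwards [Metric.isOpen_ball.mem_nhds (hs hy)] with z hz using heqOn z hz
      rw [(pd_eventuallyEq this k).self_of_nhds]
    · rw [image_eq_zero_of_notMem_tsupport hy, zero_mul, zero_mul]
  simp only [h1, h2]
  have hbound : ∀ y, ‖pd k ψ y‖ ≤ C := fun y => by
    refine (ContinuousLinearMap.le_opNorm _ _).trans ?_
    simpa using norm_fderiv_le_of_lipschitz ℝ hψ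
  have hmeas : Measurable (pd k ψ) := measurable_fderiv_apply_const ℝ ψ _
  have hint : Integrable (fun y => g y * pd k ψ y) :=
    (hgc.continuous.integrable_of_hasCompactSupport hgs).mul_bdd
      hmeas.aestronglyMeasurable (Eventually.of_forall hbound)
  refine ⟨hint, ?_⟩
  have h3 := LipschitzWith.integral_lineDeriv_mul_eq (μ := volume) hψ hD hgs
    (EuclideanSpace.single k (1 : ℝ))
  have h4 : ∫ y, g y * pd k ψ y = ∫ y, lineDeriv ℝ ψ y (EuclideanSpace.single k 1) * g y := by
    refine integral_congr_ae ?_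
    filter_upwards [hψ.ae_differentiableAt] with y hy
    rw [hy.lineDeriv_eq_fderiv, mul_comm]
    rfl
  rw [h4, h3, ← integral_neg]
  refine integral_congr_ae (Eventually.of_forall fun y => ?_)
  simp only
  rw [(hgc.differentiable (by simp) y).lineDeriv_eq_fderiv, map_neg, neg_mul, mul_comm]
  rfl

end Divergence

namespace Patch

variable {m : ℕ} {M : Type*} [MetricSpace M] [ChartedSpace (EuclideanSpace ℝ (Fin m)) M]
  {x : M → EuclideanSpace ℝ (Fin (m + 1))} {p : M} (P : Patch x p)

/-- The Gaussian weight in a patch. -/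
def gauss (y : EuclideanSpace ℝ (Fin m)) : ℝ := Real.exp (-(‖P.Y y‖ ^ 2 / 2))

theorem contDiff_gauss : ContDiff ℝ ∞ P.gauss :=
  ((P.contDiff_Y.norm_sq ℝ).div_const 2).neg.exp

theorem pd_gauss (k : Fin m) (y : EuclideanSpace ℝ (Fin m)) :
    pd k P.gauss y = -(((P.τ k + y k) + (inner ℝ P.ν (x p) + P.h y) * pd k P.h y) * P.gauss y) := by
  have h1 := (P.contDiff_Y.differentiable (by simp) y).hasFDerivAt.norm_sq
  have h2 := ((h1.mul_const (1 / 2 : ℝ)).neg).exp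
  have h3 : P.gauss = fun y => Real.exp (-(‖P.Y y‖ ^ 2 * (1 / 2))) := by
    funext y; rw [gauss]; congr 2; ring
  rw [pd, h3]
  erw [h2.fderiv]
  have h4 : inner ℝ (P.Y y) (fderiv ℝ P.Y y (EuclideanSpace.single k 1)) =
      (P.τ k + y k) + (inner ℝ P.ν (x p) + P.h y) * pd k P.h y := by
    rw [fderiv_Y_apply, Y, P.center_eq]
    simp only [inner_add_left, inner_add_right, inner_smul_left, inner_smul_right, P.inner_ν,
      P.inner_ν', P.inner_ν_ν, P.inner_E, EuclideanSpace.inner_single_right]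
    simp [pd]
    ring
  rw [← h4]
  simp
  ring

/-- The density of the weighted volume in a patch. -/
def dens (y : EuclideanSpace ℝ (Fin m)) : ℝ := areaDens P.h y * P.gauss y

theorem dens_pos (y : EuclideanSpace ℝ (Fin m)) : 0 < P.dens y :=
  mul_pos (areaDens_pos y) (Real.exp_pos _)

theorem contDiff_dens : ContDiff ℝ ∞ P.dens := (contDiff_areaDens P.smooth).mul P.contDiff_gauss

variable [IsManifold (𝓡 m) ∞ M] [RiemannianBundle (fun p : M => TangentSpace (𝓡 m) p)]

theorem integral_patch (hx : IsSelfShrinker x) {ψ F : EuclideanSpace ℝ (Fin m) → ℝ} {C : NNReal}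
    (hψ : LipschitzWith C ψ) (hs : tsupport ψ ⊆ Metric.ball 0 P.r) (hF : ContDiff ℝ ∞ F) :
    Integrable (fun y => ∑ k, flux P.h P.dens F k y * pd k ψ y) ∧
      ∫ y, ∑ k, flux P.h P.dens F k y * pd k ψ y =
        -∫ y, ψ y * (P.dens y * driftLap P.h P.τ F y) := by
  have hV := fun k => contDiff_flux P.smooth P.contDiff_dens hF k
  have h1 := fun k => integral_flux_mul hψ hs (hV k) k
  refine ⟨integrable_finsetSum _ fun k _ => (h1 k).1, ?_⟩
  have hψc : HasCompactSupport ψ :=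
    HasCompactSupport.of_support_subset_isCompact (isCompact_closedBall 0 P.r)
      ((subset_tsupport ψ).trans (hs.trans Metric.ball_subset_closedBall))
  rw [integral_finsetSum _ fun k _ => (h1 k).1]
  simp only [fun k => (h1 k).2]
  rw [Finset.sum_neg_distrib, ← integral_finsetSum]
  · congr 1
    refine integral_congr_ae (Eventually.of_forall fun y => ?_)
    simp only [← Finset.mul_sum]
    by_cases hy : y ∈ tsupport ψ
    · rw [sum_pd_flux (ρ := P.dens) P.smooth hF P.contDiff_gauss (P.driftLap_h hx (hs hy)) rfl
        fun k => P.pd_gauss k y]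
    · rw [image_eq_zero_of_notMem_tsupport hy, zero_mul, zero_mul]
  · intro k _
    exact (hψ.continuous.mul (contDiff_pd (hV k) k).continuous).integrable_of_hasCompactSupport
      hψc.mul_right

end Patch

/-! ### Riemannian and weighted volume in chart and patch coordinates. -/

section ChartVolume

variable {m : ℕ} {M : Type*} [MetricSpace M] [ChartedSpace (EuclideanSpace ℝ (Fin m)) M]
  [MeasurableSpace M] [BorelSpace M]

theorem measurableSet_inter_preimage {α β : Type*} [TopologicalSpace α] [MeasurableSpace α]
    [BorelSpace α] [TopologicalSpace β] [MeasurableSpace β] [BorelSpace β] {f : α → β} {s : Set α}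
    {t : Set β} (hf : ContinuousOn f s) (hs : MeasurableSet s) (ht : MeasurableSet t) :
    MeasurableSet (f ⁻¹' t ∩ s) := by
  have h1 : MeasurableSet (s.domRestrict f ⁻¹' t) := hf.domRestrict.measurable ht
  convert hs.subtype_image h1 using 1
  ext a
  constructor
  · rintro ⟨h, ha⟩
    exact ⟨⟨a, ha⟩, h, rfl⟩
  · rintro ⟨⟨b, hb⟩, h, rfl⟩
    exact ⟨h, hb⟩

theorem chartVolume_apply [RiemannianBundle (fun p : M => TangentSpace (𝓡 m) p)] (c : M)
    {A : Set M} (hA : MeasurableSet A) :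
    chartVolume (m := m) c A =
      ∫⁻ u in (extChartAt (𝓡 m) c).symm ⁻¹' A ∩ (extChartAt (𝓡 m) c).target,
        ENNReal.ofReal (Real.sqrt (metricMatrix c u).det) := by
  have hT : MeasurableSet (extChartAt (𝓡 m) c).target :=
    (isOpen_extChartAt_target (I := 𝓡 m) c).measurableSet
  rw [chartVolume, Measure.map_apply_of_aemeasurable _ hA, withDensity_apply',
    Measure.restrict_restrict' hT]
  exact ((continuousOn_extChartAt_symm c).aemeasurable hT).mono_ac
    (withDensity_absolutelyContinuous _ _)

end ChartVolume

namespace Patch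

variable {m : ℕ} {M : Type*} [MetricSpace M] [ChartedSpace (EuclideanSpace ℝ (Fin m)) M]
  {x : M → EuclideanSpace ℝ (Fin (m + 1))} {p : M} (P : Patch x p)

theorem continuousOn_symm : ContinuousOn P.e.symm (Metric.ball 0 P.r) := by
  rw [← P.target_eq]; exact P.e.continuousOn_symm

/-- The Gram matrix is the identity plus a rank one matrix, so the matrix determinant lemma applies.
-/
theorem det_gram (y : EuclideanSpace ℝ (Fin m)) :
    (Matrix.of fun i j : Fin m => (inner ℝ (fderiv ℝ P.Y y (EuclideanSpace.single i 1))
      (fderiv ℝ P.Y y (EuclideanSpace.single j 1)) : ℝ)).det = 1 + ∑ k, pd k P.h y * pd k P.h y := by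
  have : (Matrix.of fun i j : Fin m => (inner ℝ (fderiv ℝ P.Y y (EuclideanSpace.single i 1))
      (fderiv ℝ P.Y y (EuclideanSpace.single j 1)) : ℝ)) =
      1 + Matrix.vecMulVec (fun k => pd k P.h y) (fun k => pd k P.h y) := by
    ext i j
    rw [Matrix.of_apply, inner_fderiv_Y, Matrix.add_apply, Matrix.vecMulVec_apply]
    congr 1
    rw [EuclideanSpace.inner_single_left]
    simp [Matrix.one_apply]
  rw [this, Matrix.vecMulVec_eq Unit, Matrix.det_one_add_replicateCol_mul_replicateRow]
  rfl

variable [IsManifold (𝓡 m) ∞ M] [RiemannianBundle (fun p : M => TangentSpace (𝓡 m) p)]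

/-- The Gram matrix pulls back to Kᵀ g K under a coordinate change with Jacobian matrix K. The
factor |det K| is the one in the change of variables formula. -/
theorem areaDens_eq (hx : IsIsometricImmersion x) (c : M) {y : EuclideanSpace ℝ (Fin m)}
    (hy : y ∈ Metric.ball 0 P.r) (hc : P.e.symm y ∈ (extChartAt (𝓡 m) c).source) :
    HasFDerivAt (extChartAt (𝓡 m) c ∘ P.e.symm) (fderiv ℝ (extChartAt (𝓡 m) c ∘ P.e.symm) y) y ∧
    areaDens P.h y = |(fderiv ℝ (extChartAt (𝓡 m) c ∘ P.e.symm) y).det| *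
      Real.sqrt (metricMatrix c ((extChartAt (𝓡 m) c ∘ P.e.symm) y)).det := by
  set κ := extChartAt (𝓡 m) c ∘ P.e.symm with hκ
  have hκc : ContDiffAt ℝ ∞ κ y := by
    rw [← contMDiffAt_iff_contDiffAt]
    exact (contMDiffAt_extChartAt' (n := ∞) (by simpa using hc)).comp y
      (P.contMDiffOn_symm.contMDiffAt (P.eventually_mem hy))
  have hκd := (hκc.differentiableAt (by simp)).hasFDerivAt
  refine ⟨hκd, ?_⟩
  have hu : κ y ∈ (extChartAt (𝓡 m) c).target := (extChartAt (𝓡 m) c).map_source hc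
  have hX : DifferentiableAt ℝ (x ∘ (extChartAt (𝓡 m) c).symm) (κ y) :=
    ((hx.contDiffOn c).contDiffAt ((isOpen_extChartAt_target c).mem_nhds hu)).differentiableAt
      (by simp)
  have hY : fderiv ℝ P.Y y =
      (fderiv ℝ (x ∘ (extChartAt (𝓡 m) c).symm) (κ y)).comp (fderiv ℝ κ y) := by
    have : P.Y =ᶠ[𝓝 y] (x ∘ (extChartAt (𝓡 m) c).symm) ∘ κ := by
      filter_upwards [P.eventually_mem hy,
        P.continuousAt_symm hy ((isOpen_extChartAt_source (I := 𝓡 m) c).mem_nhds hc)] with z hz hz'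
      simp only [hκ, Function.comp_apply]
      rw [(extChartAt (𝓡 m) c).left_inv hz', P.x_symm_eq hz]
    rw [this.fderiv_eq, fderiv_comp y hX hκd.differentiableAt]
  set K := LinearMap.toMatrix (EuclideanSpace.basisFun (Fin m) ℝ).toBasis
    (EuclideanSpace.basisFun (Fin m) ℝ).toBasis (fderiv ℝ κ y).toLinearMap with hK
  have hKe : ∀ j, fderiv ℝ κ y (EuclideanSpace.single j 1) =
      ∑ i, K i j • EuclideanSpace.single i (1 : ℝ) := by
    intro j
    conv_lhs => rw [← (EuclideanSpace.basisFun (Fin m) ℝ).sum_repr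
      (fderiv ℝ κ y (EuclideanSpace.single j 1))]
    simp [hK, LinearMap.toMatrix_apply]
  have hgram : (Matrix.of fun i j : Fin m => (inner ℝ (fderiv ℝ P.Y y (EuclideanSpace.single i 1))
      (fderiv ℝ P.Y y (EuclideanSpace.single j 1)) : ℝ)) =
      K.transpose * metricMatrix c (κ y) * K := by
    ext i j
    rw [Matrix.of_apply, hY, ContinuousLinearMap.comp_apply, ContinuousLinearMap.comp_apply, hKe,
      hKe, map_sum, map_sum, sum_inner, Matrix.mul_assoc, Matrix.mul_apply]
    refine Finset.sum_congr rfl fun k _ => ?_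
    rw [inner_sum, Matrix.mul_apply, Matrix.transpose_apply, Finset.mul_sum]
    refine Finset.sum_congr rfl fun l _ => ?_
    rw [map_smul, map_smul, inner_smul_left, inner_smul_right, metricMatrix_apply hx c hu,
      conj_trivial]
    ring
  have hdet : (fderiv ℝ κ y).det = K.det := by
    rw [hK, LinearMap.det_toMatrix]
  rw [areaDens, ← P.det_gram, hgram, Matrix.det_mul, Matrix.det_mul, Matrix.det_transpose, hdet,
    ← Real.sqrt_mul_self_eq_abs, ← Real.sqrt_mul (mul_self_nonneg _)]
  congr 1
  ring

variable [MeasurableSpace M] [BorelSpace M]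

theorem chartVolume_eq (hx : IsIsometricImmersion x) (c : M) {A : Set M} (hA : MeasurableSet A)
    (hAs : A ⊆ P.e.source) (hAc : A ⊆ (extChartAt (𝓡 m) c).source) :
    chartVolume (m := m) c A =
      ∫⁻ y in P.e.symm ⁻¹' A ∩ Metric.ball 0 P.r, ENNReal.ofReal (areaDens P.h y) := by
  have hT := measurableSet_inter_preimage P.continuousOn_symm measurableSet_ball hA
  have himg : (extChartAt (𝓡 m) c).symm ⁻¹' A ∩ (extChartAt (𝓡 m) c).target =
      (extChartAt (𝓡 m) c ∘ P.e.symm) '' (P.e.symm ⁻¹' A ∩ Metric.ball 0 P.r) := by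
    ext u
    constructor
    · rintro ⟨hu, hut⟩
      refine ⟨P.e ((extChartAt (𝓡 m) c).symm u), ⟨?_, P.e_mem (hAs hu)⟩, ?_⟩
      · rw [Set.mem_preimage, P.e.left_inv (hAs hu)]; exact hu
      · rw [Function.comp_apply, P.e.left_inv (hAs hu), (extChartAt (𝓡 m) c).right_inv hut]
    · rintro ⟨y, ⟨hy, -⟩, rfl⟩
      refine ⟨?_, (extChartAt (𝓡 m) c).map_source (hAc hy)⟩
      rw [Set.mem_preimage, Function.comp_apply, (extChartAt (𝓡 m) c).left_inv (hAc hy)]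
      exact hy
  have hinj : Set.InjOn (extChartAt (𝓡 m) c ∘ P.e.symm) (P.e.symm ⁻¹' A ∩ Metric.ball 0 P.r) := by
    intro y hy z hz hyz
    have h1 := (extChartAt (𝓡 m) c).injOn (hAc hy.1) (hAc hz.1) hyz
    rw [← P.e_symm hy.2, h1, P.e_symm hz.2]
  rw [chartVolume_apply c hA, himg, lintegral_image_eq_lintegral_abs_det_fderiv_mul volume hT
    (fun y hy => ((P.areaDens_eq hx c hy.2 (hAc hy.1)).1).hasFDerivWithinAt) hinj]
  refine setLIntegral_congr_fun hT fun y hy => ?_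
  rw [← ENNReal.ofReal_mul (abs_nonneg _), ← (P.areaDens_eq hx c hy.2 (hAc hy.1)).2]

/-- The Riemannian volume in a patch. -/
theorem riemannianVolume_eq (hx : IsIsometricImmersion x) {A : Set M} (hA : MeasurableSet A)
    (hAs : A ⊆ P.e.source) :
    riemannianVolume m M A =
      ∫⁻ y in P.e.symm ⁻¹' A ∩ Metric.ball 0 P.r, ENNReal.ofReal (areaDens P.h y) := by
  have hS : MeasurableSet P.e.source := P.e.open_source.measurableSet
  set ν : Measure M := Measure.map P.e.symm ((volume.restrict (Metric.ball 0 P.r)).withDensity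
    fun y => ENNReal.ofReal (areaDens P.h y)) with hν
  have hν_apply : ∀ B : Set M, MeasurableSet B →
      ν B = ∫⁻ y in P.e.symm ⁻¹' B ∩ Metric.ball 0 P.r, ENNReal.ofReal (areaDens P.h y) := by
    intro B hB
    rw [hν, Measure.map_apply_of_aemeasurable _ hB, withDensity_apply',
      Measure.restrict_restrict' measurableSet_ball]
    exact (P.continuousOn_symm.aemeasurable measurableSet_ball).mono_ac
      (withDensity_absolutelyContinuous _ _)
  -- A supremum of measures is not computed set by set. It is bounded by exhibiting one measure
  -- above every `chartVolume`: the expected one on the patch plus the volume itself outside.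
  have hle : riemannianVolume m M ≤ ν + (riemannianVolume m M).restrict P.e.sourceᶜ := by
    refine iSup_le fun c => Measure.le_iff.2 fun B hB => ?_
    have hC : MeasurableSet (extChartAt (𝓡 m) c).source :=
      (isOpen_extChartAt_source c).measurableSet
    rw [Measure.add_apply, ← measure_inter_add_sdiff B hS]
    refine add_le_add ?_ ?_
    · have h0 : chartVolume (m := m) c ((B ∩ P.e.source) \ (extChartAt (𝓡 m) c).source) = 0 := by
        rw [chartVolume_apply c ((hB.inter hS).diff hC)]
        convert setLIntegral_empty _ using 2
        · refine congrArg _ (Set.eq_empty_of_forall_notMem ?_)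
          rintro u ⟨hu, hut⟩
          exact hu.2 ((extChartAt (𝓡 m) c).map_target hut)
      rw [← measure_inter_add_sdiff (B ∩ P.e.source) hC, h0, add_zero,
        P.chartVolume_eq hx c ((hB.inter hS).inter hC)
          (Set.inter_subset_left.trans Set.inter_subset_right) Set.inter_subset_right, hν_apply B hB]
      exact lintegral_mono_set (Set.inter_subset_inter_left _ fun y hy => hy.1.1)
    · rw [Measure.restrict_apply hB]
      exact Measure.le_iff'.1 (le_iSup (fun c : M => chartVolume (m := m) c) c) _
  refine le_antisymm ?_ ?_
  · refine (Measure.le_iff'.1 hle A).trans ?_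
    rw [Measure.add_apply, Measure.restrict_apply hA, hν_apply A hA,
      (Set.disjoint_compl_right_iff_subset.2 hAs).inter_eq, measure_empty, add_zero]
  · rw [← P.chartVolume_eq hx p hA hAs (hAs.trans P.source_subset)]
    exact Measure.le_iff'.1 (le_iSup (fun c : M => chartVolume (m := m) c) p) _

/-- The Riemannian volume restricted to a patch. -/
theorem restrict_riemannianVolume (hx : IsIsometricImmersion x) :
    (riemannianVolume m M).restrict P.e.source = Measure.map P.e.symm
      ((volume.restrict (Metric.ball 0 P.r)).withDensity
        fun y => ENNReal.ofReal (areaDens P.h y)) := by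
  ext A hA
  rw [Measure.restrict_apply hA, P.riemannianVolume_eq hx (hA.inter P.e.open_source.measurableSet)
    Set.inter_subset_right, Measure.map_apply_of_aemeasurable _ hA, withDensity_apply',
    Measure.restrict_restrict' measurableSet_ball]
  · congr 2
    ext y
    simp only [Set.mem_inter_iff, Set.mem_preimage, and_congr_left_iff, and_iff_left_iff_imp]
    exact fun hy _ => P.symm_mem hy
  · exact (P.continuousOn_symm.aemeasurable measurableSet_ball).mono_ac
      (withDensity_absolutelyContinuous _ _)

omit [IsManifold (𝓡 m) ∞ M] [RiemannianBundle fun p : M => TangentSpace (𝓡 m) p] in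
theorem aemeasurable_symm : AEMeasurable P.e.symm (volume.restrict (Metric.ball 0 P.r)) :=
  P.continuousOn_symm.aemeasurable measurableSet_ball

/-- The weighted volume restricted to a patch. -/
theorem restrict_weightedVolume (hx : IsIsometricImmersion x) :
    (weightedVolume x).restrict P.e.source = Measure.map P.e.symm
      ((volume.restrict (Metric.ball 0 P.r)).withDensity fun y => ENNReal.ofReal (P.dens y)) := by
  have hxc : Continuous x := hx.contMDiff.continuous
  have hw : Measurable fun p => ENNReal.ofReal (Real.exp (-(‖x p‖ ^ 2 / 2))) := by
    have : Continuous fun p => Real.exp (-(‖x p‖ ^ 2 / 2)) := by fun_prop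
    exact this.measurable.ennreal_ofReal
  have hac := P.aemeasurable_symm.mono_ac (withDensity_absolutelyContinuous
    (volume.restrict (Metric.ball 0 P.r)) fun y => ENNReal.ofReal (areaDens P.h y))
  have hac' := P.aemeasurable_symm.mono_ac (withDensity_absolutelyContinuous
    (volume.restrict (Metric.ball 0 P.r)) fun y => ENNReal.ofReal (P.dens y))
  rw [weightedVolume, restrict_withDensity P.e.open_source.measurableSet,
    P.restrict_riemannianVolume hx]
  ext A hA
  rw [withDensity_apply _ hA, ← lintegral_indicator hA, lintegral_map' (hw.indicator hA).aemeasurable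
    hac, Measure.map_apply_of_aemeasurable hac' hA, withDensity_apply',
    lintegral_withDensity_eq_lintegral_mul₀'
      (g := fun y => A.indicator (fun p => ENNReal.ofReal (Real.exp (-(‖x p‖ ^ 2 / 2))))
        (P.e.symm y))
      (contDiff_areaDens P.smooth).continuous.measurable.ennreal_ofReal.aemeasurable
      ((hw.indicator hA).comp_aemeasurable hac),
    Measure.restrict_restrict' measurableSet_ball,
    ← lintegral_indicator (measurableSet_inter_preimage P.continuousOn_symm measurableSet_ball hA),
    ← lintegral_indicator measurableSet_ball]
  refine lintegral_congr fun y => ?_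
  by_cases hy : y ∈ Metric.ball (0 : EuclideanSpace ℝ (Fin m)) P.r
  · by_cases hyA : P.e.symm y ∈ A
    · simp [Set.indicator, hy, hyA, -Metric.mem_ball, dens, gauss, P.x_symm_eq hy,
        ENNReal.ofReal_mul (areaDens_pos y).le]
    · simp [Set.indicator, hy, hyA, -Metric.mem_ball]
  · simp [Set.indicator, hy, -Metric.mem_ball]

end Patch

section LocalToGlobal

variable {α : Type*} [TopologicalSpace α] [SecondCountableTopology α] [MeasurableSpace α]

theorem ae_of_forall_nhds {μ : Measure α} {p : α → Prop}
    (h : ∀ a, ∃ U ∈ 𝓝 a, ∀ᵐ b ∂μ.restrict U, p b) : ∀ᵐ a ∂μ, p a := by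
  choose U hU hp using h
  obtain ⟨s, hs, hsU⟩ := TopologicalSpace.countable_cover_nhds hU
  rw [← Measure.restrict_univ (μ := μ), ← hsU, ae_restrict_biUnion_iff _ hs]
  exact fun i _ => hp i

theorem aemeasurable_of_forall_nhds {β : Type*} [MeasurableSpace β] {μ : Measure α} {f : α → β}
    (h : ∀ a, ∃ U ∈ 𝓝 a, AEMeasurable f (μ.restrict U)) : AEMeasurable f μ := by
  choose U hU hp using h
  obtain ⟨s, hs, hsU⟩ := TopologicalSpace.countable_cover_nhds hU
  have : Countable s := hs
  rw [← Measure.restrict_univ (μ := μ), ← hsU, Set.biUnion_eq_iUnion, aemeasurable_iUnion_iff]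
  exact fun i => hp i

end LocalToGlobal

/-! ### Rules for differentials and gradient products on the hypersurface. -/

section DifRules

variable {m : ℕ} {M : Type*} [MetricSpace M] [ChartedSpace (EuclideanSpace ℝ (Fin m)) M]

/-- Differentiability of a real function at a point, read in the preferred chart. -/
def HasDif (m : ℕ) {M : Type*} [MetricSpace M] [ChartedSpace (EuclideanSpace ℝ (Fin m)) M]
    (φ : M → ℝ) (q : M) : Prop :=
  DifferentiableAt ℝ (φ ∘ (extChartAt (𝓡 m) q).symm) (extChartAt (𝓡 m) q q)

theorem continuousAt_extChartAt_symm_self (q : M) :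
    Tendsto (extChartAt (𝓡 m) q).symm (𝓝 (extChartAt (𝓡 m) q q)) (𝓝 q) := by
  have := continuousAt_extChartAt_symm (I := 𝓡 m) q
  rwa [ContinuousAt, extChartAt_to_inv] at this

theorem dif_congr {φ ψ : M → ℝ} {q : M} (h : φ =ᶠ[𝓝 q] ψ) : dif (m := m) φ q = dif ψ q :=
  Filter.EventuallyEq.fderiv_eq (h.comp_tendsto (continuousAt_extChartAt_symm_self q))

theorem dif_const (c : ℝ) (q : M) : dif (m := m) (fun _ => c) q = 0 := by
  change fderiv ℝ (fun _ => c) _ = 0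
  simp

theorem dif_add {φ ψ : M → ℝ} {q : M} (hφ : HasDif m φ q) (hψ : HasDif m ψ q) :
    dif (m := m) (fun q => φ q + ψ q) q = dif φ q + dif ψ q := fderiv_add hφ hψ

theorem HasDif.mul {φ ψ : M → ℝ} {q : M} (hφ : HasDif m φ q) (hψ : HasDif m ψ q) :
    HasDif m (fun q => φ q * ψ q) q := DifferentiableAt.mul hφ hψ

theorem dif_mul {φ ψ : M → ℝ} {q : M} (hφ : HasDif m φ q) (hψ : HasDif m ψ q) :
    dif (m := m) (fun q => φ q * ψ q) q = φ q • dif ψ q + ψ q • dif φ q := by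
  have := fderiv_mul hφ hψ
  simp only [Function.comp_apply, extChartAt_to_inv] at this
  exact this

theorem HasDif.comp {φ : M → ℝ} {q : M} (hφ : HasDif m φ q) {g : ℝ → ℝ} {g' : ℝ}
    (hg : HasDerivAt g g' (φ q)) : HasDif m (fun q => g (φ q)) q := by
  have : HasDerivAt g g' ((φ ∘ (extChartAt (𝓡 m) q).symm) (extChartAt (𝓡 m) q q)) := by
    rwa [Function.comp_apply, extChartAt_to_inv]
  exact (this.comp_hasFDerivAt _ (DifferentiableAt.hasFDerivAt hφ)).differentiableAt

theorem dif_comp {φ : M → ℝ} {q : M} (hφ : HasDif m φ q) {g : ℝ → ℝ} {g' : ℝ}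
    (hg : HasDerivAt g g' (φ q)) : dif (m := m) (fun q => g (φ q)) q = g' • dif φ q := by
  have : HasDerivAt g g' ((φ ∘ (extChartAt (𝓡 m) q).symm) (extChartAt (𝓡 m) q q)) := by
    rwa [Function.comp_apply, extChartAt_to_inv]
  exact (this.comp_hasFDerivAt _ (DifferentiableAt.hasFDerivAt hφ)).fderiv

theorem dif_eq_zero {φ : M → ℝ} {q : M} (hq : q ∉ tsupport φ) : dif (m := m) φ q = 0 := by
  have : φ =ᶠ[𝓝 q] fun _ => 0 := notMem_tsupport_iff_eventuallyEq.1 hq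
  rw [dif_congr this, dif_const]

variable [RiemannianBundle (fun p : M => TangentSpace (𝓡 m) p)]

theorem gradInner_comm (φ ψ : M → ℝ) (q : M) : gradInner m φ ψ q = gradInner m ψ φ q :=
  Finset.sum_congr rfl fun _ _ => mul_comm _ _

theorem gradInner_self_nonneg (φ : M → ℝ) (q : M) : 0 ≤ gradInner m φ φ q :=
  Finset.sum_nonneg fun _ _ => mul_self_nonneg _

/-- Through this lemma the product and chain rules for gradient products reduce to identities
between differentials. -/
theorem gradInner_of_dif_eq {φ φ₁ φ₂ : M → ℝ} {q : M} {a b : ℝ}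
    (h : dif (m := m) φ q = a • dif φ₁ q + b • dif φ₂ q) (ψ : M → ℝ) :
    gradInner m φ ψ q = a * gradInner m φ₁ ψ q + b * gradInner m φ₂ ψ q := by
  have h' : ∀ v, dif φ q v = a * dif φ₁ q v + b * dif φ₂ q v := fun v => by rw [h]; rfl
  simp only [gradInner, Finset.mul_sum, ← Finset.sum_add_distrib]
  refine Finset.sum_congr rfl fun i _ => ?_
  have h1 := h' (stdOrthonormalBasis ℝ (TangentSpace (𝓡 m) q) i)
  refine (congrArg (· * dif ψ q (stdOrthonormalBasis ℝ (TangentSpace (𝓡 m) q) i)) h1).trans ?_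
  ring

theorem gradInner_eq_zero {φ : M → ℝ} {q : M} (hq : q ∉ tsupport φ) (ψ : M → ℝ) :
    gradInner m φ ψ q = 0 := by
  have h' : ∀ v, dif (m := m) φ q v = 0 := fun v => by rw [dif_eq_zero hq]; rfl
  exact Finset.sum_eq_zero fun i _ => mul_eq_zero_of_left (h' _) _

theorem two_mul_gradInner_le (φ ψ : M → ℝ) (q : M) (a b : ℝ) :
    2 * (a * b) * gradInner m φ ψ q ≤ a ^ 2 * gradInner m φ φ q + b ^ 2 * gradInner m ψ ψ q := by
  simp only [gradInner, Finset.mul_sum, ← Finset.sum_add_distrib]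
  refine Finset.sum_le_sum fun i _ => ?_
  nlinarith [sq_nonneg (a * dif φ q (stdOrthonormalBasis ℝ (TangentSpace (𝓡 m) q) i) -
    b * dif ψ q (stdOrthonormalBasis ℝ (TangentSpace (𝓡 m) q) i))]

theorem abs_gradInner_le (φ ψ : M → ℝ) (q : M) :
    |gradInner m φ ψ q| ≤ (gradInner m φ φ q + gradInner m ψ ψ q) / 2 := by
  have h1 := two_mul_gradInner_le (m := m) φ ψ q 1 1
  have h2 := two_mul_gradInner_le (m := m) φ ψ q 1 (-1)
  rw [abs_le]
  constructor <;> linarith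

end DifRules

namespace Patch

variable {m : ℕ} {M : Type*} [MetricSpace M] [ChartedSpace (EuclideanSpace ℝ (Fin m)) M]
  {x : M → EuclideanSpace ℝ (Fin (m + 1))} {p : M} (P : Patch x p)

theorem symm_eventually {q : M} (hq : q ∈ P.e.source) :
    ∀ᶠ u in 𝓝 (extChartAt (𝓡 m) q q), (extChartAt (𝓡 m) q).symm u ∈ P.e.source :=
  continuousAt_extChartAt_symm_self q (P.e.open_source.mem_nhds hq)

variable [IsManifold (𝓡 m) ∞ M] [RiemannianBundle (fun p : M => TangentSpace (𝓡 m) p)]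

theorem hasDif_of_comp_symm (hx : IsIsometricImmersion x) {φ : M → ℝ}
    {y : EuclideanSpace ℝ (Fin m)} (hy : y ∈ Metric.ball 0 P.r)
    (h : DifferentiableAt ℝ (φ ∘ P.e.symm) y) : HasDif m φ (P.e.symm y) := by
  set q := P.e.symm y with hq
  have hqs : q ∈ P.e.source := P.symm_mem hy
  have h1 : DifferentiableAt ℝ (fun u => P.E.toContinuousLinearMap.adjoint
      ((x ∘ (extChartAt (𝓡 m) q).symm) u - x p)) (extChartAt (𝓡 m) q q) :=
    (ContinuousLinearMap.differentiableAt _).comp _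
      (((contDiffAt_chart hx q).differentiableAt (by simp)).sub_const _)
  have h2 : P.e ∘ (extChartAt (𝓡 m) q).symm =ᶠ[𝓝 (extChartAt (𝓡 m) q q)]
      fun u => P.E.toContinuousLinearMap.adjoint ((x ∘ (extChartAt (𝓡 m) q).symm) u - x p) := by
    filter_upwards [P.symm_eventually hqs] with u hu
    exact P.e_eq_adjoint hu
  have h3 := h1.congr_of_eventuallyEq h2
  have h4 : (P.e ∘ (extChartAt (𝓡 m) q).symm) (extChartAt (𝓡 m) q q) = y := by
    rw [Function.comp_apply, extChartAt_to_inv, hq, P.e_symm hy]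
  rw [← h4] at h
  refine (h.comp _ h3).congr_of_eventuallyEq ?_
  filter_upwards [P.symm_eventually hqs] with u hu
  simp only [Function.comp_apply]
  rw [P.e.left_inv hu]

theorem gradInner_center (hx : IsIsometricImmersion x) (φ ψ : M → ℝ) :
    gradInner m φ ψ p = ∑ k, pd k (φ ∘ P.e.symm) 0 * pd k (ψ ∘ P.e.symm) 0 := by
  have := P.gradInner_eq hx P.zero_mem φ ψ
  rw [P.symm_zero, P.gr_zero] at this
  simpa using this

end Patch

/-! ### Measure, Lipschitz and measurability statements carried over from a patch. -/

namespace Patch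

variable {m : ℕ} {M : Type*} [MetricSpace M] [ChartedSpace (EuclideanSpace ℝ (Fin m)) M]
  {x : M → EuclideanSpace ℝ (Fin (m + 1))} {p : M} (P : Patch x p)
  [IsManifold (𝓡 m) ∞ M] [RiemannianBundle (fun p : M => TangentSpace (𝓡 m) p)]

section Measure

variable [MeasurableSpace M] [BorelSpace M]

theorem weightedVolume_apply (hx : IsIsometricImmersion x) {A : Set M} (hA : MeasurableSet A)
    (hAs : A ⊆ P.e.source) : weightedVolume x A =
      ∫⁻ y in P.e.symm ⁻¹' A ∩ Metric.ball 0 P.r, ENNReal.ofReal (P.dens y) := by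
  rw [← Set.inter_eq_self_of_subset_left hAs, ← Measure.restrict_apply hA,
    P.restrict_weightedVolume hx, Measure.map_apply_of_aemeasurable _ hA, withDensity_apply',
    Measure.restrict_restrict' measurableSet_ball, Set.inter_eq_self_of_subset_left hAs]
  exact P.aemeasurable_symm.mono_ac (withDensity_absolutelyContinuous _ _)

theorem ae_restrict_source (hx : IsIsometricImmersion x) {A : M → Prop}
    (h : ∀ᵐ y ∂volume.restrict (Metric.ball 0 P.r), A (P.e.symm y)) :
    ∀ᵐ q ∂(weightedVolume x).restrict P.e.source, A q := by
  obtain ⟨N, hN, hNm, hN0⟩ := exists_measurable_superset_of_null (ae_iff.1 h)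
  rw [Measure.restrict_apply hNm] at hN0
  have hS := P.e.open_source.measurableSet
  have hm : MeasurableSet (P.e ⁻¹' N ∩ P.e.source) :=
    measurableSet_inter_preimage P.e.continuousOn hS hNm
  have h0 : weightedVolume x (P.e ⁻¹' N ∩ P.e.source) = 0 := by
    rw [P.weightedVolume_apply hx hm Set.inter_subset_right]
    refine setLIntegral_measure_zero _ _ (measure_mono_null ?_ hN0)
    rintro y ⟨hy, hyb⟩
    refine ⟨?_, hyb⟩
    have := hy.1
    rwa [Set.mem_preimage, P.e_symm hyb] at this
  rw [ae_restrict_iff' hS, ae_iff]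
  refine measure_mono_null ?_ h0
  intro q hq
  simp only [Set.mem_ofPred_eq, Classical.not_imp] at hq
  refine ⟨hN ?_, hq.1⟩
  rw [Set.mem_ofPred_eq, P.e.left_inv hq.1]
  exact hq.2

theorem setIntegral_source (hx : IsIsometricImmersion x) {g : M → ℝ}
    (hg : AEMeasurable g (weightedVolume x)) :
    ∫ q in P.e.source, g q ∂weightedVolume x =
      ∫ y in Metric.ball 0 P.r, P.dens y * g (P.e.symm y) := by
  have hg' : AEStronglyMeasurable g (Measure.map P.e.symm
      ((volume.restrict (Metric.ball 0 P.r)).withDensity fun y => ENNReal.ofReal (P.dens y))) := by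
    rw [← P.restrict_weightedVolume hx]
    exact hg.aestronglyMeasurable.restrict
  rw [P.restrict_weightedVolume hx, integral_map (P.aemeasurable_symm.mono_ac
    (withDensity_absolutelyContinuous _ _)) hg']
  have hm : Measurable fun y => (P.dens y).toNNReal :=
    P.contDiff_dens.continuous.measurable.real_toNNReal
  have := integral_withDensity_eq_integral_smul (μ := volume.restrict
    (Metric.ball (0 : EuclideanSpace ℝ (Fin m)) P.r)) hm fun y => g (P.e.symm y)
  refine this.trans (integral_congr_ae (Eventually.of_forall fun y => ?_))
  change ((P.dens y).toNNReal : ℝ) * _ = _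
  rw [Real.coe_toNNReal _ (P.dens_pos y).le]

end Measure

section Lipschitz

variable [IsRiemannianManifold (𝓡 m) M]

omit [IsManifold (𝓡 m) ∞ M] in
theorem exists_lipschitzOnWith_symm (hx : IsIsometricImmersion x)
    {y : EuclideanSpace ℝ (Fin m)} (hy : y ∈ Metric.ball 0 P.r) :
    ∃ K : NNReal, ∃ t ∈ 𝓝 y, LipschitzOnWith K P.e.symm t := by
  obtain ⟨s, hys, hsr⟩ := exists_between (mem_ball_zero_iff.1 hy)
  have hc : Continuous fun y => ‖fderiv ℝ P.h y‖ := (P.smooth.continuous_fderiv (by simp)).norm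
  obtain ⟨C, hC⟩ := (isCompact_closedBall (0 : EuclideanSpace ℝ (Fin m)) s).exists_bound_of_continuousOn
    hc.continuousOn
  have hC' : ∀ z ∈ Metric.ball (0 : EuclideanSpace ℝ (Fin m)) s, ‖fderiv ℝ P.h z‖ ≤ C := fun z hz => by
    simpa using hC z (Metric.ball_subset_closedBall hz)
  have hys' : y ∈ Metric.ball (0 : EuclideanSpace ℝ (Fin m)) s := mem_ball_zero_iff.2 hys
  have hC0 : 0 ≤ C := (norm_nonneg _).trans (hC' y hys')
  refine ⟨⟨1 + C, by positivity⟩, _, Metric.isOpen_ball.mem_nhds hys', ?_⟩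
  exact LipschitzOnWith.of_dist_le_mul fun z hz w hw => P.dist_symm_le hx hsr.le hC' hz hw

omit [IsManifold (𝓡 m) ∞ M] in
theorem exists_lipschitzOnWith_comp_symm (hx : IsIsometricImmersion x) {φ : M → ℝ}
    (hφ : LocallyLipschitz φ) {y : EuclideanSpace ℝ (Fin m)} (hy : y ∈ Metric.ball 0 P.r) :
    ∃ K : NNReal, ∃ t ∈ 𝓝 y, LipschitzOnWith K (φ ∘ P.e.symm) t := by
  obtain ⟨K, t, ht, hK⟩ := P.exists_lipschitzOnWith_symm hx hy
  obtain ⟨K', t', ht', hK'⟩ := hφ (P.e.symm y)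
  refine ⟨K' * K, t ∩ P.e.symm ⁻¹' t', inter_mem ht (P.continuousAt_symm hy ht'), ?_⟩
  exact hK'.comp (hK.mono Set.inter_subset_left) fun z hz => hz.2

/-- Rademacher's theorem for a Lipschitz extension of the function near each point; a set that is
locally null is null. -/
theorem ae_differentiableAt (hx : IsIsometricImmersion x) {φ : M → ℝ}
    (hφ : LocallyLipschitz φ) :
    ∀ᵐ y ∂volume.restrict (Metric.ball 0 P.r), DifferentiableAt ℝ (φ ∘ P.e.symm) y := by
  rw [ae_restrict_iff' measurableSet_ball, ae_iff]
  refine measure_null_of_locally_null _ fun y hy => ?_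
  simp only [Set.mem_ofPred_eq, Classical.not_imp] at hy
  obtain ⟨K, t, ht, hK⟩ := P.exists_lipschitzOnWith_comp_symm hx hφ hy.1
  obtain ⟨V, hVt, hV, hyV⟩ := mem_nhds_iff.1 ht
  obtain ⟨g, hg, hgt⟩ := hK.extend_real
  refine ⟨_, inter_mem self_mem_nhdsWithin (mem_nhdsWithin_of_mem_nhds (hV.mem_nhds hyV)), ?_⟩
  refine measure_mono_null ?_ (ae_iff.1 hg.ae_differentiableAt)
  rintro z ⟨hz, hzV⟩ hd
  refine hz fun _ => hd.congr_of_eventuallyEq ?_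
  filter_upwards [hV.mem_nhds hzV] with w hw using hgt (hVt hw)

end Lipschitz

section Measurable

variable [MeasurableSpace M] [BorelSpace M]

/-- No regularity of `φ` or `ψ` is required, because `fderiv` of an arbitrary real function on
Euclidean space is measurable. -/
theorem aemeasurable_gradInner (hx : IsIsometricImmersion x) (φ ψ : M → ℝ) :
    AEMeasurable (gradInner m φ ψ) ((weightedVolume x).restrict P.e.source) := by
  set G : EuclideanSpace ℝ (Fin m) → ℝ := fun y =>
    ∑ k, pd k (φ ∘ P.e.symm) y * pd k (ψ ∘ P.e.symm) y -
      (∑ k, pd k P.h y * pd k (φ ∘ P.e.symm) y) * (∑ k, pd k P.h y * pd k (ψ ∘ P.e.symm) y) /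
          (1 + ‖gr P.h y‖ ^ 2) with hG
  have hpd : ∀ (f : EuclideanSpace ℝ (Fin m) → ℝ) k, Measurable (pd k f) :=
    fun f k => measurable_fderiv_apply_const ℝ f _
  have hGm : Measurable G := by
    have := hpd (φ ∘ P.e.symm)
    have := hpd (ψ ∘ P.e.symm)
    have := hpd P.h
    simp only [hG, norm_gr_sq]
    fun_prop
  have hS := P.e.open_source.measurableSet
  refine (hGm.comp_aemeasurable (P.e.continuousOn.aemeasurable hS)).congr ?_
  filter_upwards [ae_restrict_mem hS] with q hq
  have h1 := P.gradInner_eq hx (P.e_mem hq) φ ψ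
  rw [P.e.left_inv hq, fderiv_eq_sum_pd, fderiv_eq_sum_pd] at h1
  exact h1.symm

end Measurable

end Patch

/-! ### Gradient bounds, local finiteness, and Rademacher's theorem on the hypersurface. -/

section Global

variable {m : ℕ} {M : Type*} [MetricSpace M] [ChartedSpace (EuclideanSpace ℝ (Fin m)) M]
  {x : M → EuclideanSpace ℝ (Fin (m + 1))}
  [IsManifold (𝓡 m) ∞ M] [RiemannianBundle (fun p : M => TangentSpace (𝓡 m) p)]

/-- Near its centre a patch distorts distances by at most a factor 1 + ε, because dh vanishes there.
So the Euclidean derivative at the centre is at most C(1 + ε) for every ε. -/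
theorem gradInner_le_sq [IsRiemannianManifold (𝓡 m) M] (hx : IsIsometricImmersion x) {φ : M → ℝ}
    {C : NNReal} {p : M} {N : Set M} (hN : N ∈ 𝓝 p) (hφ : LipschitzOnWith C φ N) : gradInner m φ φ p ≤ C ^ 2 := by
  obtain ⟨P⟩ := exists_patch hx p
  have h1 : ∀ ε : ℝ, 0 < ε → ‖fderiv ℝ (φ ∘ P.e.symm) 0‖ ≤ C * (1 + ε) := by
    intro ε hε
    have hc : ContinuousAt (fun y => ‖fderiv ℝ P.h y‖) 0 :=
      (P.smooth.continuous_fderiv (by simp)).norm.continuousAt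
    have h2 : ∀ᶠ y in 𝓝 (0 : EuclideanSpace ℝ (Fin m)), ‖fderiv ℝ P.h y‖ < ε ∧
        y ∈ Metric.ball 0 P.r ∧ P.e.symm y ∈ N :=
      (hc.eventually_lt_const (by simpa [P.fderiv_zero] using hε)).and
        ((P.eventually_mem P.zero_mem).and
          (P.continuousAt_symm P.zero_mem (by rwa [P.symm_zero])))
    obtain ⟨s, hs, hsb⟩ := Metric.eventually_nhds_iff_ball.1 h2
    have hs' : 0 < min s P.r := lt_min hs P.r_pos
    refine norm_fderiv_le_of_lip' ℝ (by positivity) ?_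
    filter_upwards [Metric.isOpen_ball.mem_nhds (Metric.mem_ball_self (x :=
      (0 : EuclideanSpace ℝ (Fin m))) hs')] with y hy
    have hsub := Metric.ball_subset_ball (x := (0 : EuclideanSpace ℝ (Fin m))) (min_le_left s P.r)
    have h0 := Metric.mem_ball_self (x := (0 : EuclideanSpace ℝ (Fin m))) hs'
    have h3 := P.dist_symm_le hx (min_le_right s P.r) (fun z hz => (hsb z (hsub hz)).1.le) hy h0
    have h4 := hφ.dist_le_mul _ (hsb y (hsub hy)).2.2 _ (hsb 0 (hsub h0)).2.2
    rw [← dist_eq_norm, Function.comp_apply, Function.comp_apply, mul_assoc, ← dist_eq_norm]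
    exact h4.trans (by gcongr)
  have h2 : ‖fderiv ℝ (φ ∘ P.e.symm) 0‖ ≤ C := by
    refine le_of_forall_pos_le_add fun δ hδ => ?_
    refine (h1 (δ / (C + 1)) (by positivity)).trans ?_
    rw [mul_add, mul_one]
    gcongr
    rw [mul_div_assoc', div_le_iff₀ (by positivity)]
    nlinarith [C.2]
  have h3 : ‖gr (φ ∘ P.e.symm) 0‖ ≤ ‖fderiv ℝ (φ ∘ P.e.symm) 0‖ := by
    by_cases h0 : ‖gr (φ ∘ P.e.symm) 0‖ = 0
    · rw [h0]; exact norm_nonneg _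
    · have h4 := (fderiv ℝ (φ ∘ P.e.symm) 0).le_opNorm (gr (φ ∘ P.e.symm) 0)
      rw [← inner_gr, real_inner_self_eq_norm_sq, Real.norm_of_nonneg (sq_nonneg _), sq] at h4
      exact le_of_mul_le_mul_right h4 (lt_of_le_of_ne (norm_nonneg _) (Ne.symm h0))
  rw [P.gradInner_center hx]
  have h5 := norm_gr_sq (φ ∘ P.e.symm) 0
  simp only [sq] at h5
  rw [← h5, ← sq]
  exact pow_le_pow_left₀ (norm_nonneg _) (h3.trans h2) 2

variable [MeasurableSpace M] [BorelSpace M]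

theorem exists_nhds_weightedVolume_lt_top (hx : IsIsometricImmersion x) (p : M) :
    ∃ U ∈ 𝓝 p, weightedVolume x U < ⊤ := by
  obtain ⟨P⟩ := exists_patch hx p
  have ho : IsOpen (P.e.source ∩ P.e ⁻¹' Metric.ball 0 (P.r / 2)) :=
    P.e.isOpen_inter_preimage Metric.isOpen_ball
  refine ⟨_, ho.mem_nhds ⟨P.mem_source, ?_⟩, ?_⟩
  · rw [Set.mem_preimage, P.e_self]; exact Metric.mem_ball_self (half_pos P.r_pos)
  rw [P.weightedVolume_apply hx ho.measurableSet Set.inter_subset_left]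
  have hi : IntegrableOn P.dens (Metric.closedBall 0 (P.r / 2)) :=
    P.contDiff_dens.continuous.continuousOn.integrableOn_compact (isCompact_closedBall _ _)
  refine lt_of_le_of_lt (lintegral_mono_set ?_) (Integrable.lintegral_lt_top hi)
  rintro y ⟨hy, hyb⟩
  have := hy.2
  rw [Set.mem_preimage, P.e_symm hyb] at this
  exact Metric.ball_subset_closedBall this

theorem weightedVolume_pos (hx : IsIsometricImmersion x) {p : M} {U : Set M} (hU : U ∈ 𝓝 p) :
    0 < weightedVolume x U := by
  obtain ⟨P⟩ := exists_patch hx p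
  obtain ⟨V, hVU, hV, hpV⟩ := mem_nhds_iff.1 (inter_mem hU (P.e.open_source.mem_nhds P.mem_source))
  refine lt_of_lt_of_le ?_ (measure_mono (hVU.trans Set.inter_subset_left))
  rw [P.weightedVolume_apply hx hV.measurableSet (hVU.trans Set.inter_subset_right)]
  have hT : IsOpen (P.e.symm ⁻¹' V ∩ Metric.ball 0 P.r) := by
    rw [Set.inter_comm]
    exact P.continuousOn_symm.isOpen_inter_preimage Metric.isOpen_ball hV
  rw [setLIntegral_pos_iff P.contDiff_dens.continuous.measurable.ennreal_ofReal]
  have : Function.support (fun y => ENNReal.ofReal (P.dens y)) = Set.univ := by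
    ext y; simp [P.dens_pos y]
  rw [this, Set.univ_inter]
  exact hT.measure_pos volume ⟨0, by rw [Set.mem_preimage, P.symm_zero]; exact hpV, P.zero_mem⟩

theorem isLocallyFiniteMeasure_weightedVolume (hx : IsIsometricImmersion x) :
    IsLocallyFiniteMeasure (weightedVolume x) :=
  ⟨exists_nhds_weightedVolume_lt_top hx⟩

theorem isOpenPosMeasure_weightedVolume (hx : IsIsometricImmersion x) :
    (weightedVolume x).IsOpenPosMeasure :=
  ⟨fun _ hU ⟨_, hp⟩ =>
    (weightedVolume_pos hx (hU.mem_nhds hp)).ne'⟩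

variable [SecondCountableTopology M]

theorem aemeasurable_gradInner (hx : IsIsometricImmersion x) (φ ψ : M → ℝ) :
    AEMeasurable (gradInner m φ ψ) (weightedVolume x) :=
  aemeasurable_of_forall_nhds fun p =>
    ⟨_, (exists_patch hx p).some.e.open_source.mem_nhds (exists_patch hx p).some.mem_source,
      (exists_patch hx p).some.aemeasurable_gradInner hx φ ψ⟩

variable [IsRiemannianManifold (𝓡 m) M]

/-- A form of Rademacher's theorem on a hypersurface. -/
theorem ae_hasDif (hx : IsIsometricImmersion x) {φ : M → ℝ} (hφ : LocallyLipschitz φ) :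
    ∀ᵐ q ∂weightedVolume x, HasDif m φ q := by
  refine ae_of_forall_nhds fun p => ?_
  obtain ⟨P⟩ := exists_patch hx p
  refine ⟨_, P.e.open_source.mem_nhds P.mem_source, P.ae_restrict_source hx ?_⟩
  filter_upwards [P.ae_differentiableAt hx hφ, ae_restrict_mem measurableSet_ball] with y hy hyb
  exact P.hasDif_of_comp_symm hx hyb hy

/-- The product of gradients of two locally Lipschitz functions, one of them with compact support,
is integrable. -/
theorem integrable_gradInner (hx : IsIsometricImmersion x) {φ ψ : M → ℝ} (hφ : LocallyLipschitz φ)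
    (hφc : HasCompactSupport φ) (hψ : LocallyLipschitz ψ) :
    Integrable (gradInner m φ ψ) (weightedVolume x) := by
  have := isLocallyFiniteMeasure_weightedVolume hx
  have hb : ∀ p, ∃ U ∈ 𝓝 p, ∃ C : ℝ, ∀ q ∈ U, |gradInner m φ ψ q| ≤ C := by
    intro p
    obtain ⟨K, t, ht, hK⟩ := hφ p
    obtain ⟨K', t', ht', hK'⟩ := hψ p
    refine ⟨_, interior_mem_nhds.2 (inter_mem ht ht'), ((K : ℝ) ^ 2 + (K' : ℝ) ^ 2) / 2,
      fun q hq => (abs_gradInner_le φ ψ q).trans ?_⟩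
    have hq' := mem_interior_iff_mem_nhds.1 hq
    have h1 := gradInner_le_sq hx hq' (hK.mono Set.inter_subset_left)
    have h2 := gradInner_le_sq hx hq' (hK'.mono Set.inter_subset_right)
    linarith
  have hC : ∃ C : ℝ, ∀ q ∈ tsupport φ, |gradInner m φ ψ q| ≤ C := by
    refine hφc.isCompact.induction_on (p := fun S => ∃ C : ℝ, ∀ q ∈ S, |gradInner m φ ψ q| ≤ C)
      ⟨0, by simp⟩ (fun s t hst ⟨C, hC⟩ => ⟨C, fun q hq => hC q (hst hq)⟩) ?_ ?_
    · rintro s t ⟨C, hC⟩ ⟨C', hC'⟩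
      refine ⟨max C C', fun q hq => hq.elim (fun h => (hC q h).trans (le_max_left _ _))
        fun h => (hC' q h).trans (le_max_right _ _)⟩
    · intro p _
      obtain ⟨U, hU, C, hC⟩ := hb p
      exact ⟨U, mem_nhdsWithin_of_mem_nhds hU, C, hC⟩
  obtain ⟨C, hC⟩ := hC
  have h1 : IntegrableOn (gradInner m φ ψ) (tsupport φ) (weightedVolume x) :=
    Measure.integrableOn_of_bounded (M := C) hφc.isCompact.measure_lt_top.ne
      (aemeasurable_gradInner hx φ ψ).aestronglyMeasurable
      ((ae_restrict_iff' (isClosed_tsupport φ).measurableSet).2 (Eventually.of_forall hC))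
  exact (integrableOn_iff_integrable_of_support_subset fun q hq =>
    by_contra fun h => hq (gradInner_eq_zero h ψ)).1 h1

end Global

/-! ### Locally Lipschitz functions and distance cutoffs. -/

section LocallyLipschitz

variable {α : Type*} [PseudoMetricSpace α]

theorem locallyLipschitz_comp {φ : α → ℝ} (hφ : LocallyLipschitz φ) {g : ℝ → ℝ}
    (hg : ∀ a, ContDiffAt ℝ 1 g (φ a)) : LocallyLipschitz fun a => g (φ a) := by
  intro a
  obtain ⟨K, t, ht, hK⟩ := (hg a).exists_lipschitzOnWith
  obtain ⟨K', t', ht', hK'⟩ := hφ a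
  exact ⟨K * K', t' ∩ φ ⁻¹' t, inter_mem ht' (hφ.continuous.continuousAt ht),
    hK.comp (hK'.mono Set.inter_subset_left) fun b hb => hb.2⟩

theorem locallyLipschitz_mul {φ ψ : α → ℝ} (hφ : LocallyLipschitz φ)
    (hψ : LocallyLipschitz ψ) : LocallyLipschitz fun a => φ a * ψ a :=
  (contDiff_mul (𝕜 := ℝ) (n := 1)).locallyLipschitz.comp (hφ.prodMk hψ)

theorem lipschitzOnWith_congr {φ ψ : α → ℝ} {K : NNReal} {s : Set α} (hφ : LipschitzOnWith K φ s)
    (h : Set.EqOn φ ψ s) : LipschitzOnWith K ψ s := fun a ha b hb => by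
  rw [← h ha, ← h hb]
  exact hφ ha hb

/-- A Lipschitz cut-off function at distance scale `ρ`. -/
def cutoff (p : α) (ρ : ℝ) (q : α) : ℝ := max 0 (min 1 (2 - dist q p / ρ))

theorem cutoff_nonneg (p : α) (ρ : ℝ) (q : α) : 0 ≤ cutoff p ρ q := le_max_left _ _

theorem cutoff_le_one (p : α) (ρ : ℝ) (q : α) : cutoff p ρ q ≤ 1 :=
  max_le zero_le_one (min_le_left _ _)

theorem cutoff_eq_one {p : α} {ρ : ℝ} (hρ : 0 < ρ) {q : α} (hq : dist q p ≤ ρ) :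
    cutoff p ρ q = 1 := by
  have : dist q p / ρ ≤ 1 := (div_le_one hρ).2 hq
  rw [cutoff, min_eq_left (by linarith), max_eq_right zero_le_one]

theorem cutoff_eq_zero {p : α} {ρ : ℝ} (hρ : 0 < ρ) {q : α} (hq : 2 * ρ ≤ dist q p) :
    cutoff p ρ q = 0 := by
  have : 2 ≤ dist q p / ρ := (le_div_iff₀ hρ).2 hq
  rw [cutoff, max_eq_left ((min_le_right _ _).trans (by linarith))]

theorem tsupport_cutoff_subset (p : α) {ρ : ℝ} (hρ : 0 < ρ) :
    tsupport (cutoff p ρ) ⊆ Metric.closedBall p (2 * ρ) := by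
  refine closure_minimal (fun q hq => ?_) Metric.isClosed_closedBall
  by_contra h
  exact hq (cutoff_eq_zero hρ (not_le.1 h).le)

theorem lipschitzWith_cutoff (p : α) {ρ : ℝ} (hρ : 0 < ρ) :
    LipschitzWith (Real.toNNReal (1 / ρ)) (cutoff p ρ) := by
  refine LipschitzWith.const_max (LipschitzWith.const_min (LipschitzWith.of_dist_le_mul
    fun a b => ?_) 1) 0
  rw [Real.coe_toNNReal _ (by positivity), Real.dist_eq, one_div_mul_eq_div]
  have : 2 - dist a p / ρ - (2 - dist b p / ρ) = (dist b p - dist a p) / ρ := by ring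
  rw [this, abs_div, abs_of_pos hρ]
  gcongr
  rw [dist_comm a b]
  exact abs_dist_sub_le b a p

/-- A locally Lipschitz function with compact support on a Euclidean space is Lipschitz. -/
theorem exists_lipschitzWith_of_locallyLipschitz {E : Type*} [NormedAddCommGroup E] [NormedSpace ℝ E]
    [FiniteDimensional ℝ E] {ψ : E → ℝ} (hψ : LocallyLipschitz ψ) (hc : HasCompactSupport ψ) :
    ∃ C, LipschitzWith C ψ := by
  obtain ⟨S, hS⟩ := hc.isCompact.exists_bound_of_continuousOn hψ.continuous.continuousOn
  obtain ⟨R, hR⟩ := hc.isCompact.isBounded.subset_closedBall (0 : E)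
  obtain ⟨K, hK⟩ := (LocallyLipschitz.locallyLipschitzOn
    hψ).exists_lipschitzOnWith_of_compact (isCompact_closedBall (0 : E) (R + 1))
  have h0 : ∀ y, y ∉ Metric.closedBall (0 : E) R → ψ y = 0 := fun y hy =>
    image_eq_zero_of_notMem_tsupport fun h => hy (hR h)
  have hS' : ∀ y, ‖ψ y‖ ≤ max S 0 := fun y => by
    by_cases hy : y ∈ tsupport ψ
    · exact (hS y hy).trans (le_max_left _ _)
    · rw [image_eq_zero_of_notMem_tsupport hy, norm_zero]; exact le_max_right _ _
  -- Outside the support and at distance at least 1 from it, the bound on `|ψ|` itself serves as a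
  -- Lipschitz constant. The margin of 1 in the radius is there for this.
  have key : ∀ y z, z ∉ Metric.closedBall (0 : E) (R + 1) →
      dist (ψ y) (ψ z) ≤ (K + max S 0) * dist y z := by
    intro y z hz
    rw [Metric.mem_closedBall, dist_zero_right, not_le] at hz
    rw [h0 z (by rw [Metric.mem_closedBall, dist_zero_right]; linarith), dist_zero_right]
    by_cases hy : y ∈ Metric.closedBall (0 : E) R
    · rw [Metric.mem_closedBall, dist_zero_right] at hy
      have h1 : 1 ≤ dist y z := by
        rw [dist_comm, dist_eq_norm]
        linarith [norm_sub_norm_le z y]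
      refine (hS' y).trans ?_
      calc max S 0 ≤ (K + max S 0) * 1 := by linarith [K.2]
        _ ≤ _ := by gcongr
    · rw [h0 y hy, norm_zero]; positivity
  refine ⟨⟨K + max S 0, by positivity⟩, LipschitzWith.of_dist_le_mul fun y z => ?_⟩
  change _ ≤ (K + max S 0) * dist y z
  by_cases hz : z ∈ Metric.closedBall (0 : E) (R + 1)
  · by_cases hy : y ∈ Metric.closedBall (0 : E) (R + 1)
    · refine (hK.dist_le_mul y hy z hz).trans ?_
      gcongr
      linarith [le_max_right S 0]
    · rw [dist_comm, dist_comm y]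
      exact key z y hy
  · exact key y z hz

end LocallyLipschitz

/-! ### Green's formula for Lipschitz test functions. -/

section Weak

variable {m : ℕ} {M : Type*} [MetricSpace M] [ChartedSpace (EuclideanSpace ℝ (Fin m)) M]

/-- `F` is smooth and its drift Laplacian `Δ F - ⟪x, ∇F⟫` is `G`. -/
def HasDriftLap (x : M → EuclideanSpace ℝ (Fin (m + 1))) (F G : M → ℝ) : Prop :=
  ∀ (p : M) (P : Patch x p), ∃ Φ : EuclideanSpace ℝ (Fin m) → ℝ, ContDiff ℝ ∞ Φ ∧
    ∀ y ∈ Metric.ball 0 P.r, F (P.e.symm y) = Φ y ∧ G (P.e.symm y) = driftLap P.h P.τ Φ y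

theorem contDiff_driftLap {h F : EuclideanSpace ℝ (Fin m) → ℝ} (hh : ContDiff ℝ ∞ h)
    (hF : ContDiff ℝ ∞ F) (τ : EuclideanSpace ℝ (Fin m)) : ContDiff ℝ ∞ (driftLap h τ F) := by
  have : ∀ k, ContDiff ℝ ∞ fun y : EuclideanSpace ℝ (Fin m) => y k := contDiff_coord
  unfold driftLap
  fun_prop

variable {x : M → EuclideanSpace ℝ (Fin (m + 1))}
  [IsManifold (𝓡 m) ∞ M] [RiemannianBundle (fun p : M => TangentSpace (𝓡 m) p)]

theorem HasDriftLap.continuous (hx : IsIsometricImmersion x) {F G : M → ℝ}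
    (h : HasDriftLap x F G) : Continuous G := by
  refine continuous_iff_continuousAt.2 fun p => ?_
  obtain ⟨P⟩ := exists_patch hx p
  obtain ⟨Φ, hΦ, hFG⟩ := h p P
  have h1 : ContinuousAt (fun q => driftLap P.h P.τ Φ (P.e q)) p :=
    (contDiff_driftLap P.smooth hΦ P.τ).continuous.continuousAt.comp
      (P.e.continuousAt P.mem_source)
  refine h1.congr ?_
  filter_upwards [P.e.open_source.mem_nhds P.mem_source] with q hq
  rw [← (hFG _ (P.e_mem hq)).2, P.e.left_inv hq]

variable [IsRiemannianManifold (𝓡 m) M]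

theorem HasDriftLap.locallyLipschitz (hx : IsIsometricImmersion x) {F G : M → ℝ}
    (h : HasDriftLap x F G) : LocallyLipschitz F := by
  intro p
  obtain ⟨P⟩ := exists_patch hx p
  obtain ⟨Φ, hΦ, hFG⟩ := h p P
  obtain ⟨K, t, ht, hK⟩ := (hΦ.of_le (by simp)).locallyLipschitz (P.e p)
  refine ⟨K * 1, P.e.source ∩ P.e ⁻¹' t, inter_mem (P.e.open_source.mem_nhds P.mem_source)
    (P.e.continuousAt P.mem_source ht), ?_⟩
  have h1 : LipschitzOnWith 1 P.e (P.e.source ∩ P.e ⁻¹' t) :=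
    LipschitzOnWith.of_dist_le_mul fun q hq q' hq' => by
      simpa using P.dist_e_le hx hq.1 hq'.1
  refine lipschitzOnWith_congr (hK.comp h1 fun q hq => hq.2) fun q hq => ?_
  rw [Function.comp_apply, ← (hFG _ (P.e_mem hq.1)).1, P.e.left_inv hq.1]

variable [MeasurableSpace M] [BorelSpace M] [SecondCountableTopology M]

/-- Integration by parts inside a patch. -/
theorem Patch.integral_gradInner (hx : IsSelfShrinker x) {p : M} (P : Patch x p) {F G φ : M → ℝ}
    (h : HasDriftLap x F G) (hφ : LocallyLipschitz φ) (hφc : HasCompactSupport φ)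
    (hs : tsupport φ ⊆ P.e.source) :
    ∫ q, gradInner m φ F q ∂weightedVolume x = -∫ q, φ q * G q ∂weightedVolume x := by
  have hxi := hx.toIsIsometricImmersion
  obtain ⟨Φ, hΦ, hFG⟩ := h p P
  -- Extension by zero keeps the function locally Lipschitz, since its support is a compact subset
  -- of the open ball.
  set ψ : EuclideanSpace ℝ (Fin m) → ℝ := (Metric.ball 0 P.r).indicator (φ ∘ P.e.symm) with hψ
  have hKc : IsCompact (P.e '' tsupport φ) :=
    hφc.isCompact.image_of_continuousOn (P.e.continuousOn.mono hs)
  have hKb : P.e '' tsupport φ ⊆ Metric.ball 0 P.r := by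
    rintro _ ⟨q, hq, rfl⟩
    exact P.e_mem (hs hq)
  have hsupp : Function.support ψ ⊆ P.e '' tsupport φ := by
    intro y hy
    rw [hψ, Set.support_indicator] at hy
    exact ⟨P.e.symm y, subset_tsupport _ hy.2, P.e_symm hy.1⟩
  have hts : tsupport ψ ⊆ P.e '' tsupport φ := closure_minimal hsupp hKc.isClosed
  have hψc : HasCompactSupport ψ := HasCompactSupport.of_support_subset_isCompact hKc hsupp
  have hψeq : ∀ y ∈ Metric.ball (0 : EuclideanSpace ℝ (Fin m)) P.r, ψ =ᶠ[𝓝 y] φ ∘ P.e.symm := by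
    intro y hy
    filter_upwards [P.eventually_mem hy] with z hz using Set.indicator_of_mem hz _
  have hψL : LocallyLipschitz ψ := by
    intro y
    by_cases hy : y ∈ Metric.ball (0 : EuclideanSpace ℝ (Fin m)) P.r
    · obtain ⟨K, t, ht, hK⟩ := P.exists_lipschitzOnWith_comp_symm hxi hφ hy
      refine ⟨K, t ∩ Metric.ball 0 P.r, inter_mem ht (P.eventually_mem hy), ?_⟩
      exact lipschitzOnWith_congr (hK.mono Set.inter_subset_left) fun z hz =>
        (Set.indicator_of_mem hz.2 _).symm
    · have h0 : ψ =ᶠ[𝓝 y] fun _ => 0 :=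
        notMem_tsupport_iff_eventuallyEq.1 fun h => hy (hKb (hts h))
      exact ⟨0, _, h0, LipschitzOnWith.of_dist_le_mul fun z hz w hw => by
        rw [Set.mem_ofPred_eq] at hz hw; simp [hz, hw]⟩
  obtain ⟨C, hC⟩ := exists_lipschitzWith_of_locallyLipschitz hψL hψc
  have hibp := (P.integral_patch hx hC (hts.trans hKb) hΦ).2
  have h1 : ∫ q, gradInner m φ F q ∂weightedVolume x =
      ∫ q in P.e.source, gradInner m φ F q ∂weightedVolume x :=
    (setIntegral_eq_integral_of_forall_compl_eq_zero fun q hq =>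
      gradInner_eq_zero (fun h => hq (hs h)) F).symm
  have h2 : ∫ q, φ q * G q ∂weightedVolume x =
      ∫ q in P.e.source, φ q * G q ∂weightedVolume x :=
    (setIntegral_eq_integral_of_forall_compl_eq_zero fun q hq => by
      rw [image_eq_zero_of_notMem_tsupport fun h => hq (hs h), zero_mul]).symm
  have hmeas : AEMeasurable (fun q => φ q * G q) (weightedVolume x) :=
    (hφ.continuous.mul (h.continuous hxi)).measurable.aemeasurable
  rw [h1, h2, P.setIntegral_source hxi (SelfShrinker.aemeasurable_gradInner hxi φ F),
    P.setIntegral_source hxi hmeas]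
  have h3 : ∫ y in Metric.ball 0 P.r, P.dens y * gradInner m φ F (P.e.symm y) =
      ∫ y, ∑ k, flux P.h P.dens Φ k y * pd k ψ y := by
    refine Eq.trans ?_ (setIntegral_eq_integral_of_forall_compl_eq_zero
      (s := Metric.ball 0 P.r) ?_)
    · refine setIntegral_congr_fun measurableSet_ball fun y hy => ?_
      have hFe : F ∘ P.e.symm =ᶠ[𝓝 y] Φ := by
        filter_upwards [P.eventually_mem hy] with z hz using (hFG z hz).1
      have hFp : ∀ k, pd k (F ∘ P.e.symm) y = pd k Φ y :=
        fun k => (pd_eventuallyEq hFe k).self_of_nhds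
      have hψp : ∀ k, pd k (φ ∘ P.e.symm) y = pd k ψ y :=
        fun k => (pd_eventuallyEq (hψeq y hy).symm k).self_of_nhds
      rw [P.gradInner_eq hxi hy, fderiv_eq_sum_pd, fderiv_eq_sum_pd, ← inv_mul_eq_div, ← invW_eq]
      simp only [hFp, hψp, flux, gr_apply, sub_mul, mul_sub, Finset.sum_sub_distrib,
        Finset.mul_sum, Finset.sum_mul]
      congr 1
      · exact Finset.sum_congr rfl fun k _ => by ring
      · rw [Finset.sum_comm]
        refine Finset.sum_congr rfl fun k _ => Finset.sum_congr rfl fun l _ => by ring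
    · intro y hy
      have h0 : ψ =ᶠ[𝓝 y] fun _ => 0 :=
        notMem_tsupport_iff_eventuallyEq.1 fun h => hy (hKb (hts h))
      refine Finset.sum_eq_zero fun k _ => ?_
      rw [(pd_eventuallyEq h0 k).self_of_nhds, pd_const, mul_zero]
  rw [h3, hibp]
  congr 1
  refine Eq.trans (setIntegral_eq_integral_of_forall_compl_eq_zero
    (s := Metric.ball 0 P.r) ?_).symm ?_
  swap
  · refine setIntegral_congr_fun measurableSet_ball fun y hy => ?_
    rw [hψ, Set.indicator_of_mem hy, (hFG y hy).2, Function.comp_apply]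
    ring
  · intro y hy
    rw [hψ, Set.indicator_of_notMem hy, zero_mul]

omit [IsRiemannianManifold (𝓡 m) M] [SecondCountableTopology M] in
theorem integrable_mul_of_hasCompactSupport (hx : IsIsometricImmersion x) {φ G : M → ℝ}
    (hφ : Continuous φ) (hφc : HasCompactSupport φ) (hG : Continuous G) :
    Integrable (fun q => φ q * G q) (weightedVolume x) := by
  have := isLocallyFiniteMeasure_weightedVolume hx
  exact (hφ.mul hG).integrable_of_hasCompactSupport hφc.mul_right

theorem integral_gradInner (hx : IsSelfShrinker x) {F G φ : M → ℝ}
    (h : HasDriftLap x F G) (hφ : LocallyLipschitz φ) (hφc : HasCompactSupport φ) :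
    ∫ q, gradInner m φ F q ∂weightedVolume x = -∫ q, φ q * G q ∂weightedVolume x := by
  have hxi := hx.toIsIsometricImmersion
  have hF := h.locallyLipschitz hxi
  have hG := h.continuous hxi
  have hχ : ∀ p : M, ∃ χ : M → ℝ, LocallyLipschitz χ ∧
      tsupport χ ⊆ (exists_patch hxi p).some.e.source ∧ ∃ U ∈ 𝓝 p, ∀ q ∈ U, χ q = 1 := by
    intro p
    obtain ⟨ε, hε, hεs⟩ := Metric.nhds_basis_closedBall.mem_iff.1
      ((exists_patch hxi p).some.e.open_source.mem_nhds (exists_patch hxi p).some.mem_source)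
    have hε2 := half_pos hε
    refine ⟨cutoff p (ε / 2), (lipschitzWith_cutoff p hε2).locallyLipschitz,
      (tsupport_cutoff_subset p hε2).trans ?_, Metric.ball p (ε / 2), Metric.ball_mem_nhds p hε2,
      fun q hq => cutoff_eq_one hε2 (Metric.mem_ball.1 hq).le⟩
    rwa [mul_div_cancel₀ _ two_ne_zero]
  choose χ hχL hχs U hU hχU using hχ
  have hone : ∀ p, LocallyLipschitz fun q => 1 - χ p q := fun p =>
    locallyLipschitz_comp (hχL p) (g := fun t => 1 - t) fun a => by fun_prop
  -- A partition of unity peeled off one patch at a time. The product condition says that wherever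
  -- `ψ` is nonzero some χ with index in `s` equals 1. Splitting ψ = ψχ + ψ(1 - χ) settles one patch
  -- and leaves a function satisfying the condition for a smaller set.
  have key : ∀ s : Finset M, ∀ ψ : M → ℝ, LocallyLipschitz ψ → HasCompactSupport ψ →
      (∀ q, ψ q * ∏ p ∈ s, (1 - χ p q) = 0) →
      ∫ q, gradInner m ψ F q ∂weightedVolume x = -∫ q, ψ q * G q ∂weightedVolume x := by
    intro s
    classical
    induction s using Finset.induction_on with
    | empty =>
      intro ψ _ _ h0
      have h0' : ψ = 0 := funext fun q => by simpa using h0 q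
      have h1 : ∀ q, gradInner m ψ F q = 0 := fun q =>
        gradInner_eq_zero (by simp [h0']) F
      rw [integral_congr_ae (Eventually.of_forall h1), h0']
      simp
    | insert p s hp ih =>
      intro ψ hψ hψc h0
      have hψ1 := locallyLipschitz_mul hψ (hχL p)
      have hψ2 := locallyLipschitz_mul hψ (hone p)
      have hc1 : HasCompactSupport fun q => ψ q * χ p q := hψc.mul_right
      have hc2 : HasCompactSupport fun q => ψ q * (1 - χ p q) := hψc.mul_right
      have h1 := Patch.integral_gradInner hx (exists_patch hxi p).some h hψ1 hc1
        ((closure_mono (Function.support_mul_subset_right _ _)).trans (hχs p))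
      have h2 := ih _ hψ2 hc2 fun q => by
        rw [← h0 q, Finset.prod_insert hp, mul_assoc]
      have h3 : ∫ q, gradInner m ψ F q ∂weightedVolume x =
          ∫ q, (gradInner m (fun q => ψ q * χ p q) F q +
            gradInner m (fun q => ψ q * (1 - χ p q)) F q) ∂weightedVolume x := by
        refine integral_congr_ae ?_
        filter_upwards [ae_hasDif (m := m) hxi hψ1, ae_hasDif (m := m) hxi hψ2] with q hq1 hq2
        have h4 := dif_add hq1 hq2
        have h5 : (fun q => ψ q * χ p q + ψ q * (1 - χ p q)) = ψ := funext fun q => by ring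
        rw [h5] at h4
        rw [gradInner_of_dif_eq (φ₁ := fun q => ψ q * χ p q) (φ₂ := fun q => ψ q * (1 - χ p q))
          (a := 1) (b := 1) (by rw [h4, one_smul, one_smul]), one_mul, one_mul]
      rw [h3, integral_add (integrable_gradInner hxi hψ1 hc1 hF)
        (integrable_gradInner hxi hψ2 hc2 hF), h1, h2, ← neg_add, ← integral_add
          (integrable_mul_of_hasCompactSupport hxi hψ1.continuous hc1 hG)
          (integrable_mul_of_hasCompactSupport hxi hψ2.continuous hc2 hG)]
      congr 1
      exact integral_congr_ae (Eventually.of_forall fun q => by ring)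
  obtain ⟨s, -, hs⟩ := hφc.isCompact.elim_nhds_subcover U fun p _ => hU p
  refine key s φ hφ hφc fun q => ?_
  by_cases hq : q ∈ tsupport φ
  · obtain ⟨p, hp, hqp⟩ := Set.mem_iUnion₂.1 (hs hq)
    rw [Finset.prod_eq_zero hp (by rw [hχU p q hqp, sub_self]), mul_zero]
  · rw [image_eq_zero_of_notMem_tsupport hq, zero_mul]

end Weak

/-! ### Length spaces and the Hopf-Rinow theorem. -/

section HopfRinow

/-- In a length space, one can split distances up to arbitrarily small errors. -/
def SplitsDistances (α : Type*) [PseudoMetricSpace α] : Prop :=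
  ∀ p q : α, ∀ s ∈ Set.Icc 0 (dist p q), ∀ ε > 0, ∃ z, dist p z = s ∧ dist z q ≤ dist p q - s + ε

/-- Intermediate value theorem for the distance from `p` along an almost shortest path to `q`. -/
theorem splitsDistances {m : ℕ} {M : Type*} [MetricSpace M]
    [ChartedSpace (EuclideanSpace ℝ (Fin m)) M] [IsManifold (𝓡 m) ∞ M]
    [RiemannianBundle (fun p : M => TangentSpace (𝓡 m) p)] [IsRiemannianManifold (𝓡 m) M] :
    SplitsDistances M := by
  intro p q s hs ε hε
  have h1 : Manifold.riemannianEDist (𝓡 m) p q < edist p q + ENNReal.ofReal ε := by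
    rw [← IsRiemannianManifold.out (I := 𝓡 m) p q]
    exact ENNReal.lt_add_right (edist_ne_top p q) (by simpa using hε)
  obtain ⟨γ, h0, h1, hγ, hlen⟩ := Manifold.exists_lt_of_riemannianEDist_lt h1
  have hc : ContinuousOn (fun t => dist p (γ t)) (Set.Icc 0 1) :=
    (continuous_const.dist continuous_id).comp_continuousOn hγ.continuousOn
  have hs' : s ∈ Set.Icc (dist p (γ 0)) (dist p (γ 1)) := by
    rwa [h0, h1, dist_self]
  obtain ⟨t, ht, hts⟩ := intermediate_value_Icc zero_le_one hc hs'
  refine ⟨γ t, hts, ?_⟩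
  have h2 : edist p (γ t) ≤ Manifold.pathELength (𝓡 m) γ 0 t := by
    rw [IsRiemannianManifold.out (I := 𝓡 m)]
    exact Manifold.riemannianEDist_le_pathELength
      (hγ.mono (Set.Icc_subset_Icc_right ht.2)) h0 rfl ht.1
  have h3 : edist (γ t) q ≤ Manifold.pathELength (𝓡 m) γ t 1 := by
    rw [IsRiemannianManifold.out (I := 𝓡 m)]
    exact Manifold.riemannianEDist_le_pathELength
      (hγ.mono (Set.Icc_subset_Icc_left ht.1)) rfl h1 ht.2
  have h4 := (add_le_add h2 h3).trans_lt
    ((Manifold.pathELength_add (I := 𝓡 m) (γ := γ) ht.1 ht.2).trans_lt hlen)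
  rw [edist_dist, edist_dist, edist_dist, ← ENNReal.ofReal_add dist_nonneg dist_nonneg,
    ← ENNReal.ofReal_add dist_nonneg hε.le, ENNReal.ofReal_lt_ofReal_iff (by positivity)] at h4
  linarith

/-- The Hopf-Rinow theorem: a complete locally compact length space is proper. -/
theorem properSpace_of_splitsDistances {α : Type*} [PseudoMetricSpace α] [CompleteSpace α]
    [WeaklyLocallyCompactSpace α] (hα : SplitsDistances α) : ProperSpace α := by
  refine ⟨fun o => ?_⟩
  by_contra! hcon
  obtain ⟨r₁, hr₁⟩ := hcon
  -- If some closed ball is not compact, the compact radii are bounded. Their supremum is shown to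
  -- be a compact radius, by total boundedness, and then to be exceeded, by a compact neighbourhood
  -- of that ball.
  set S : Set ℝ := {r | IsCompact (Metric.closedBall o r)} with hS
  have hmono : ∀ r ∈ S, ∀ r' ≤ r, r' ∈ S := fun r hr r' hr' =>
    hr.of_isClosed_subset Metric.isClosed_closedBall (Metric.closedBall_subset_closedBall hr')
  have hbdd : BddAbove S := ⟨r₁, fun r hr => not_lt.1 fun h => hr₁ (hmono r hr r₁ h.le)⟩
  obtain ⟨K, hK, hoK⟩ := exists_compact_mem_nhds o
  obtain ⟨r₀, hr₀, hr₀K⟩ := Metric.nhds_basis_closedBall.mem_iff.1 hoK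
  have hr₀S : r₀ ∈ S := hK.of_isClosed_subset Metric.isClosed_closedBall hr₀K
  set R := sSup S with hR
  have hRpos : 0 < R := hr₀.trans_le (le_csSup hbdd hr₀S)
  have hlt : ∀ r < R, r ∈ S := fun r hr => by
    obtain ⟨r', hr', hrr'⟩ := exists_lt_of_lt_csSup ⟨r₀, hr₀S⟩ hr
    exact hmono r' hr' r hrr'.le
  -- The 3δ is at most 2δ for the distance between the radii R - δ and R + δ, plus the error δ in
  -- splitting the distance.
  have hnear : ∀ {q : α} {δ : ℝ}, 0 < δ → δ ≤ R → dist o q ≤ R + δ →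
      ∃ z ∈ Metric.closedBall o (R - δ), dist q z ≤ 3 * δ := by
    intro q δ hδ hδR hq
    by_cases h : dist o q ≤ R - δ
    · exact ⟨q, by rwa [Metric.mem_closedBall, dist_comm], by rw [dist_self]; positivity⟩
    · obtain ⟨z, hz, hzq⟩ := hα o q (R - δ) ⟨by linarith, (not_le.1 h).le⟩ δ hδ
      exact ⟨z, by rw [Metric.mem_closedBall, dist_comm, hz], by rw [dist_comm]; linarith⟩
  have hRS : R ∈ S := by
    refine isCompact_iff_totallyBounded_isComplete.2 ⟨?_, Metric.isClosed_closedBall.isComplete⟩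
    refine Metric.totallyBounded_iff.2 fun ε hε => ?_
    set δ := min (ε / 8) R with hδ
    have hδ0 : 0 < δ := lt_min (by positivity) hRpos
    have hδε : δ ≤ ε / 8 := min_le_left _ _
    obtain ⟨t, ht, htc⟩ := Metric.totallyBounded_iff.1
      (hlt (R - δ) (by linarith)).totallyBounded (ε / 2) (by positivity)
    refine ⟨t, ht, fun q hq => ?_⟩
    rw [Metric.mem_closedBall, dist_comm] at hq
    obtain ⟨z, hz, hzq⟩ := hnear hδ0 (min_le_right _ _) (hq.trans (by linarith))
    obtain ⟨w, hw, hzw⟩ := Set.mem_iUnion₂.1 (htc hz)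
    refine Set.mem_iUnion₂.2 ⟨w, hw, ?_⟩
    rw [Metric.mem_ball] at hzw ⊢
    linarith [dist_triangle q z w]
  obtain ⟨K', hK', hKK'⟩ := exists_compact_superset hRS
  obtain ⟨δ, hδ, hδK⟩ := hRS.exists_thickening_subset_open isOpen_interior hKK'
  set δ' := min (δ / 4) R with hδ'
  have hδ'0 : 0 < δ' := lt_min (by positivity) hRpos
  have hδ'δ : δ' ≤ δ / 4 := min_le_left _ _
  have : R + δ' ∈ S := by
    refine hK'.of_isClosed_subset Metric.isClosed_closedBall fun q hq => ?_
    rw [Metric.mem_closedBall, dist_comm] at hq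
    obtain ⟨z, hz, hzq⟩ := hnear hδ'0 (min_le_right _ _) hq
    refine interior_subset (hδK (Metric.mem_thickening_iff.2
      ⟨z, Metric.closedBall_subset_closedBall (by linarith) hz, by linarith⟩))
  linarith [le_csSup hbdd this]

end HopfRinow

/-! ### Complete hypersurfaces contained in a hyperplane. -/

section Rigidity

/-- Spheres are compact in a proper space, so a point of the sphere nearest to `q` removes the error
ε. -/
theorem SplitsDistances.exists_dist_eq {α : Type*} [PseudoMetricSpace α] [ProperSpace α]
    (hα : SplitsDistances α) {p q : α} {s : ℝ} (hs : s ∈ Set.Icc 0 (dist p q)) :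
    ∃ z, dist p z = s ∧ dist z q = dist p q - s := by
  have hc : IsCompact (Metric.sphere p s) := isCompact_sphere p s
  have hne : (Metric.sphere p s).Nonempty := by
    obtain ⟨z, hz, -⟩ := hα p q s hs 1 one_pos
    exact ⟨z, by rwa [Metric.mem_sphere, dist_comm]⟩
  obtain ⟨z, hz, hmin⟩ := hc.exists_isMinOn hne
    (continuous_id.dist (continuous_const (y := q))).continuousOn
  rw [Metric.mem_sphere, dist_comm] at hz
  refine ⟨z, hz, le_antisymm (le_of_forall_pos_le_add fun ε hε => ?_) ?_⟩
  · obtain ⟨w, hw, hwq⟩ := hα p q s hs ε hε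
    refine le_trans ?_ hwq
    exact hmin (by rwa [Metric.mem_sphere, dist_comm])
  · linarith [dist_triangle p z q]

theorem SplitsDistances.exists_chain {α : Type*} [PseudoMetricSpace α] [ProperSpace α]
    (hα : SplitsDistances α) {δ : ℝ} (hδ : 0 ≤ δ) (q : α) : ∀ (N : ℕ) (p : α),
    dist p q = N * δ → ∃ z : ℕ → α, z 0 = p ∧ dist (z N) q = 0 ∧
      ∀ i < N, dist (z i) (z (i + 1)) = δ
  | 0, p, h => ⟨fun _ => p, rfl, by simpa using h, by simp⟩
  | N + 1, p, h => by
    push_cast at h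
    have hN : (0 : ℝ) ≤ N * δ := by positivity
    obtain ⟨w, hw, hwq⟩ := hα.exists_dist_eq (p := p) (q := q) (s := δ)
      ⟨hδ, by rw [h]; linarith⟩
    obtain ⟨z, hz0, hzN, hz⟩ := SplitsDistances.exists_chain hα hδ q N w (by rw [hwq, h]; ring)
    refine ⟨fun i => Nat.casesOn i p z, rfl, hzN, fun i hi => ?_⟩
    cases i with
    | zero => exact (congrArg (dist p) hz0).trans hw
    | succ i => exact hz i (by omega)

/-- A map to a strictly convex space which preserves small distances preserves all distances. -/
theorem dist_eq_of_locally_isometric {α : Type*} [PseudoMetricSpace α] [ProperSpace α]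
    (hα : SplitsDistances α) {E : Type*} [NormedAddCommGroup E] [InnerProductSpace ℝ E] {f : α → E}
    (hf : ∀ p, ∃ ρ > 0, ∀ q ∈ Metric.ball p ρ, ∀ q' ∈ Metric.ball p ρ,
      dist (f q) (f q') = dist q q') (p q : α) : dist (f p) (f q) = dist p q := by
  choose ρ hρ hfρ using hf
  -- A Lebesgue number gives one radius r on which `f` is isometric along a whole minimizing chain
  -- with steps shorter than r.
  obtain ⟨r, hr, hball⟩ := lebesgue_number_lemma_of_metric (isCompact_closedBall p (dist p q))
    (c := fun a : α => Metric.ball a (ρ a)) (fun a => Metric.isOpen_ball)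
    fun a _ => Set.mem_iUnion.2 ⟨a, Metric.mem_ball_self (hρ a)⟩
  obtain ⟨N, hN⟩ := exists_nat_gt (dist p q / r)
  have hN0 : (0 : ℝ) < N := lt_of_le_of_lt (by positivity) hN
  set δ := dist p q / N with hδ
  have hδ0 : 0 ≤ δ := by positivity
  have hδr : δ < r := by
    rw [hδ, div_lt_iff₀ hN0]
    rwa [div_lt_iff₀ hr, mul_comm] at hN
  have hpq : dist p q = N * δ := by rw [hδ]; field_simp
  obtain ⟨z, hz0, hzN, hz⟩ := hα.exists_chain hδ0 q N p hpq
  have hle : ∀ i j, i + j ≤ N → dist (z i) (z (i + j)) ≤ j * δ := by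
    intro i j
    induction j with
    | zero => intro _; simp
    | succ j ih =>
      intro hij
      have h1 := dist_triangle (z i) (z (i + j)) (z (i + (j + 1)))
      have h2 := hz (i + j) (by omega)
      push_cast
      rw [← add_assoc] at h1 ⊢
      linarith [ih (by omega)]
  have hloc : ∀ i ≤ N, ∀ a ∈ Metric.ball (z i) r, ∀ b ∈ Metric.ball (z i) r,
      dist (f a) (f b) = dist a b := by
    intro i hi a ha b hb
    have h1 := hle 0 i (by omega)
    rw [zero_add, hz0] at h1
    obtain ⟨c, hc⟩ := hball (z i) (by
      rw [Metric.mem_closedBall, dist_comm, hpq]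
      refine h1.trans ?_
      gcongr)
    exact hfρ c a (hc ha) b (hc hb)
  have hstep : ∀ i < N, dist (f (z i)) (f (z (i + 1))) = δ := by
    intro i hi
    rw [hloc i hi.le _ (Metric.mem_ball_self hr) _ (by
      rw [Metric.mem_ball, dist_comm, hz i hi]; exact hδr), hz i hi]
  -- Points two steps apart on a minimizing chain have distance 2δ, and `f` preserves this. Equality
  -- in the triangle inequality, through the parallelogram law, makes consecutive increments equal,
  -- so the image of the chain is straight.
  have hmid : ∀ i, i + 1 < N → f (z (i + 2)) - f (z (i + 1)) = f (z (i + 1)) - f (z i) := by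
    intro i hi
    have h1 : dist (z i) (z (i + 2)) = 2 * δ := by
      refine le_antisymm (by simpa using hle i 2 (by omega)) ?_
      have h2 := hle 0 i (by omega)
      obtain ⟨k, rfl⟩ : ∃ k, N = i + 2 + k := ⟨N - (i + 2), by omega⟩
      have h3 := hle (i + 2) k le_rfl
      rw [zero_add, hz0] at h2
      have h4 := dist_triangle p (z i) q
      have h5 := dist_triangle (z i) (z (i + 2)) q
      have h6 := dist_triangle (z (i + 2)) (z (i + 2 + k)) q
      push_cast at hpq
      linarith
    have h2 : dist (f (z i)) (f (z (i + 2))) = 2 * δ := by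
      rw [hloc (i + 1) hi.le _ (by rw [Metric.mem_ball, hz i (by omega)]; exact hδr) _ (by
        rw [Metric.mem_ball, dist_comm, hz (i + 1) hi]; exact hδr), h1]
    have h3 := hstep i (by omega)
    have h4 := hstep (i + 1) hi
    rw [dist_comm, dist_eq_norm] at h2 h3 h4
    have h5 := parallelogram_law_with_norm ℝ (f (z (i + 2)) - f (z (i + 1)))
      (f (z (i + 1)) - f (z i))
    rw [sub_add_sub_cancel, h2, h3, h4] at h5
    have h6 : ‖f (z (i + 2)) - f (z (i + 1)) - (f (z (i + 1)) - f (z i))‖ = 0 := by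
      rw [← mul_self_eq_zero]; linarith
    exact sub_eq_zero.1 (norm_eq_zero.1 h6)
  have hdiff : ∀ i < N, f (z (i + 1)) - f (z i) = f (z 1) - f (z 0) := by
    intro i
    induction i with
    | zero => intro _; rfl
    | succ i ih => intro hi; rw [hmid i hi, ih (by omega)]
  have hsum : ∀ i ≤ N, f (z i) - f (z 0) = (i : ℝ) • (f (z 1) - f (z 0)) := by
    intro i
    induction i with
    | zero => intro _; simp
    | succ i ih =>
      intro hi
      push_cast
      rw [add_smul, one_smul, ← ih (by omega), ← hdiff i (by omega)]
      abel
  have hNpos : 0 < N := by exact_mod_cast hN0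
  have h0 : dist (f (z N)) (f q) = 0 := by
    have hq : q ∈ Metric.ball (z N) r := by rw [Metric.mem_ball, dist_comm, hzN]; exact hr
    rw [hloc N le_rfl _ (Metric.mem_ball_self hr) _ hq, hzN]
  rw [← dist_eq_zero.1 h0, ← hz0, dist_comm, dist_eq_norm, hsum N le_rfl, norm_smul, ← dist_eq_norm,
    dist_comm, hstep 0 hNpos, hz0, hpq, Real.norm_of_nonneg hN0.le]

variable {m : ℕ} {M : Type*} [MetricSpace M] [ChartedSpace (EuclideanSpace ℝ (Fin m)) M]
  {x : M → EuclideanSpace ℝ (Fin (m + 1))}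
  [IsManifold (𝓡 m) ∞ M] [RiemannianBundle (fun p : M => TangentSpace (𝓡 m) p)]
  [IsRiemannianManifold (𝓡 m) M]

/-- A hypersurface inside a hyperplane is locally isometric to the hyperplane. -/
theorem exists_isometric_ball (hx : IsIsometricImmersion x) {n : EuclideanSpace ℝ (Fin (m + 1))}
    (hn : n ≠ 0) (hxn : ∀ p, inner ℝ n (x p) = (0 : ℝ)) (p : M) :
    ∃ ρ > 0, (∀ q ∈ Metric.ball p ρ, ∀ q' ∈ Metric.ball p ρ, dist (x q) (x q') = dist q q') ∧
      ∀ w, inner ℝ n w = (0 : ℝ) → dist w (x p) < ρ → w ∈ Set.range x := by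
  obtain ⟨P⟩ := exists_patch hx p
  have hc : ∀ y ∈ Metric.ball (0 : EuclideanSpace ℝ (Fin m)) P.r,
      inner ℝ n (P.E y) + P.h y * inner ℝ n P.ν = (0 : ℝ) := by
    intro y hy
    have h1 := hxn (P.e.symm y)
    rwa [P.x_symm y hy, inner_add_right, inner_add_right, hxn p, zero_add, inner_smul_right] at h1
  -- Differentiating the constraint `hc` at the centre, where dh = 0, shows that n is normal to the
  -- tangent hyperplane. Hence n is a multiple of `ν`, and the constraint then forces h = 0 on the
  -- patch.
  have hE : ∀ v, inner ℝ n (P.E v) = (0 : ℝ) := by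
    intro v
    have h1 : HasFDerivAt (fun y => inner ℝ n (P.E y) + P.h y * inner ℝ n P.ν)
        ((innerSL ℝ n).comp P.E.toContinuousLinearMap +
          (inner ℝ n P.ν : ℝ) • fderiv ℝ P.h 0) 0 :=
      ((innerSL ℝ n).comp P.E.toContinuousLinearMap).hasFDerivAt.add
        ((P.hasFDerivAt_h 0).mul_const _)
    have h2 : (fun y => inner ℝ n (P.E y) + P.h y * inner ℝ n P.ν) =ᶠ[𝓝 0] fun _ => (0 : ℝ) := by
      filter_upwards [P.eventually_mem P.zero_mem] with y hy using hc y hy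
    have h3 := (h1.congr_of_eventuallyEq h2.symm).unique (hasFDerivAt_const 0 _)
    rw [P.fderiv_zero, smul_zero, add_zero] at h3
    exact congrArg (fun L : EuclideanSpace ℝ (Fin m) →L[ℝ] ℝ => L v) h3
  obtain ⟨τ, hτ⟩ : ∃ τ, n = P.E τ + (inner ℝ P.ν n : ℝ) • P.ν :=
    ⟨_, decompose_normal P.E P.norm_ν P.inner_ν n⟩
  have hτ0 : P.E τ = 0 := by
    have h1 := hE τ
    rw [hτ, inner_add_left, inner_smul_left, P.inner_ν, mul_zero, add_zero,
      real_inner_self_eq_norm_sq] at h1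
    have h2 : τ = 0 := by simpa using h1
    rw [h2, map_zero]
  rw [hτ0, zero_add] at hτ
  have hν : inner ℝ n P.ν ≠ (0 : ℝ) := by
    intro h
    rw [real_inner_comm, h, zero_smul] at hτ
    exact hn hτ
  have hh : ∀ y ∈ Metric.ball (0 : EuclideanSpace ℝ (Fin m)) P.r, P.h y = 0 := fun y hy => by
    have := hc y hy
    rw [hE, zero_add] at this
    exact (mul_eq_zero.1 this).resolve_right hν
  have hdh : ∀ y ∈ Metric.ball (0 : EuclideanSpace ℝ (Fin m)) P.r, ‖fderiv ℝ P.h y‖ ≤ 0 := by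
    intro y hy
    have h2 : P.h =ᶠ[𝓝 y] fun _ => (0 : ℝ) := by
      filter_upwards [P.eventually_mem hy] with z hz using hh z hz
    rw [h2.fderiv_eq]
    simp
  have hxs : ∀ y ∈ Metric.ball (0 : EuclideanSpace ℝ (Fin m)) P.r, x (P.e.symm y) = x p + P.E y :=
    fun y hy => by rw [P.x_symm y hy, hh y hy, zero_smul, add_zero]
  obtain ⟨ρ, hρ, hρs⟩ := Metric.isOpen_iff.1 P.e.open_source p P.mem_source
  refine ⟨min ρ P.r, lt_min hρ P.r_pos, ?_, ?_⟩
  · intro q hq q' hq'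
    have hqs := hρs (Metric.ball_subset_ball (min_le_left _ _) hq)
    have hqs' := hρs (Metric.ball_subset_ball (min_le_left _ _) hq')
    refine le_antisymm (by simpa using (lipschitzWith_immersion hx).dist_le_mul q q') ?_
    have h1 := P.dist_symm_le hx le_rfl hdh (P.e_mem hqs) (P.e_mem hqs')
    rw [P.e.left_inv hqs, P.e.left_inv hqs', add_zero, one_mul] at h1
    rw [← P.e.left_inv hqs, ← P.e.left_inv hqs', hxs _ (P.e_mem hqs), hxs _ (P.e_mem hqs'),
      dist_add_left, P.E.dist_map, P.e.left_inv hqs, P.e.left_inv hqs']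
    exact h1
  · intro w hw hwp
    obtain ⟨y, hy⟩ : ∃ y, w - x p = P.E y + (inner ℝ P.ν (w - x p) : ℝ) • P.ν :=
      ⟨_, decompose_normal P.E P.norm_ν P.inner_ν _⟩
    have h1 : inner ℝ n (w - x p) = (0 : ℝ) := by rw [inner_sub_right, hw, hxn, sub_zero]
    have h2 : inner ℝ P.ν (w - x p) = (0 : ℝ) := by
      rw [hτ, inner_smul_left, mul_eq_zero] at h1
      refine h1.resolve_left ?_
      rw [conj_trivial, real_inner_comm]
      exact hν
    rw [h2, zero_smul, add_zero] at hy
    have hyb : y ∈ Metric.ball (0 : EuclideanSpace ℝ (Fin m)) P.r := by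
      rw [mem_ball_zero_iff, ← P.E.norm_map, ← hy, ← dist_eq_norm]
      exact hwp.trans_le (min_le_right _ _)
    exact ⟨P.e.symm y, by rw [hxs y hyb, ← hy]; abel⟩

/-- A complete hypersurface inside a hyperplane through the origin is that hyperplane. -/
theorem eq_hyperplane_of_inner_eq_zero [CompleteSpace M] [Nonempty M]
    (hx : IsIsometricImmersion x) {n : EuclideanSpace ℝ (Fin (m + 1))} (hn : n ≠ 0)
    (hxn : ∀ p, inner ℝ n (x p) = (0 : ℝ)) :
    Function.Injective x ∧ Set.range x = {y | inner ℝ n y = (0 : ℝ)} := by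
  have : LocallyCompactSpace M := ChartedSpace.locallyCompactSpace (EuclideanSpace ℝ (Fin m)) M
  have hM : SplitsDistances M := splitsDistances (m := m)
  have : ProperSpace M := properSpace_of_splitsDistances hM
  have hiso : Isometry x := Isometry.of_dist_eq <| dist_eq_of_locally_isometric hM fun p => by
    obtain ⟨ρ, hρ, h, -⟩ := exists_isometric_ball hx hn hxn p
    exact ⟨ρ, hρ, h⟩
  refine ⟨hiso.injective, Set.Subset.antisymm (Set.range_subset_iff.2 hxn) fun w hw => ?_⟩
  -- The image is closed. If w were missed, the image would contain a disc of the hyperplane around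
  -- the image point nearest to w, and moving a little towards w inside that disc would come closer.
  obtain ⟨_, ⟨p, rfl⟩, hp⟩ := hiso.isClosedEmbedding.isClosed_range.exists_infDist_eq_dist
    (Set.range_nonempty x) w
  obtain ⟨ρ, hρ, -, hρx⟩ := exists_isometric_ball hx hn hxn p
  by_contra hwx
  have hpos : 0 < dist w (x p) := dist_pos.2 fun h => hwx ⟨p, h.symm⟩
  obtain ⟨t, ht0, ht1, htρ⟩ : ∃ t : ℝ, 0 < t ∧ t ≤ 1 ∧ t * dist w (x p) < ρ := by
    refine ⟨min 1 (ρ / (2 * dist w (x p))), by positivity, min_le_left _ _, ?_⟩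
    calc _ ≤ ρ / (2 * dist w (x p)) * dist w (x p) := by gcongr; exact min_le_right _ _
      _ = ρ / 2 := by field_simp
      _ < ρ := half_lt_self hρ
  have h1 := hρx (x p + t • (w - x p))
    (by
      rw [Set.mem_ofPred_eq] at hw
      rw [inner_add_right, inner_smul_right, inner_sub_right, hw, hxn]; simp)
    (by
      rw [dist_eq_norm, add_sub_cancel_left, norm_smul, Real.norm_of_nonneg ht0.le, ← dist_eq_norm]
      exact htρ)
  have h2 := Metric.infDist_le_dist_of_mem (x := w) h1
  have h3 : w - (x p + t • (w - x p)) = (1 - t) • (w - x p) := by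
    rw [sub_smul, one_smul]; abel
  rw [hp, dist_eq_norm w (_ + _), h3, norm_smul, Real.norm_of_nonneg (by linarith),
    ← dist_eq_norm] at h2
  nlinarith

end Rigidity

/-! ### The strong maximum principle. -/

section SecondDerivativeTest

/-- At a local minimum the second derivative is nonnegative. -/
theorem fderiv_fderiv_nonneg_of_isLocalMin {E : Type*} [NormedAddCommGroup E] [NormedSpace ℝ E]
    {w : E → ℝ} {y : E} (hw : ContDiff ℝ 2 w) (hmin : IsLocalMin w y) (v : E) :
    0 ≤ fderiv ℝ (fderiv ℝ w) y v v := by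
  have hl : ∀ s : ℝ, HasDerivAt (fun s : ℝ => y + s • v) v s := fun s => by
    simpa using ((hasDerivAt_id s).smul_const v).const_add y
  have h1 : ∀ s : ℝ, HasDerivAt (fun s : ℝ => w (y + s • v)) (fderiv ℝ w (y + s • v) v) s := fun s =>
    ((hw.differentiable two_ne_zero) _).hasFDerivAt.comp_hasDerivAt s (hl s)
  have hd1 : deriv (fun s : ℝ => w (y + s • v)) = fun s => fderiv ℝ w (y + s • v) v :=
    funext fun s => (h1 s).deriv
  have h2 : HasDerivAt (fun s : ℝ => fderiv ℝ w (y + s • v) v) (fderiv ℝ (fderiv ℝ w) y v v) 0 := by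
    have h3 : HasFDerivAt (fderiv ℝ w) (fderiv ℝ (fderiv ℝ w) y) (y + (0 : ℝ) • v) := by
      rw [zero_smul, add_zero]
      exact ((hw.fderiv_right (m := 1) (by norm_num)).differentiable one_ne_zero y).hasFDerivAt
    have h4 : HasDerivAt (fun s : ℝ => fderiv ℝ w (y + s • v)) (fderiv ℝ (fderiv ℝ w) y v) 0 :=
      HasFDerivAt.comp_hasDerivAt (0 : ℝ) h3 (hl 0)
    exact (ContinuousLinearMap.apply ℝ ℝ v).hasFDerivAt.comp_hasDerivAt (0 : ℝ) h4
  have hmin' : IsLocalMin (fun s : ℝ => w (y + s • v)) 0 := by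
    have hc : ContinuousAt (fun s : ℝ => y + s • v) 0 := (hl 0).continuousAt
    have : Tendsto (fun s : ℝ => y + s • v) (𝓝 0) (𝓝 y) := by
      have := hc.tendsto
      simpa using this
    have h5 := this.eventually hmin
    filter_upwards [h5] with s hs
    simpa using hs
  -- A negative second derivative would make the point a local maximum too, so the function would be
  -- locally constant and its second derivative zero.
  by_contra! hneg
  have h6 : deriv (deriv fun s : ℝ => w (y + s • v)) 0 < 0 := by rw [hd1, h2.deriv]; exact hneg
  have hmax := isLocalMax_of_deriv_deriv_neg h6 hmin'.deriv_eq_zero (h1 0).continuousAt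
  have hconst : (fun s : ℝ => w (y + s • v)) =ᶠ[𝓝 0] fun _ => w (y + (0 : ℝ) • v) := by
    filter_upwards [hmax, hmin'] with s hs hs' using le_antisymm hs hs'
  rw [hconst.deriv.deriv_eq] at h6
  simp at h6

end SecondDerivativeTest

section Barrier

variable {m : ℕ}

/-- A Gaussian barrier. -/
def barrier (α : ℝ) (z y : EuclideanSpace ℝ (Fin m)) : ℝ := Real.exp (-(α * ‖y - z‖ ^ 2))

theorem contDiff_barrier (α : ℝ) (z : EuclideanSpace ℝ (Fin m)) : ContDiff ℝ ∞ (barrier α z) :=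
  ((contDiff_id.sub contDiff_const).norm_sq ℝ |>.const_smul α).neg.exp

theorem hasFDerivAt_barrier (α : ℝ) (z y : EuclideanSpace ℝ (Fin m)) :
    HasFDerivAt (barrier α z) ((-(2 * α) * barrier α z y) • innerSL ℝ (y - z)) y := by
  have h1 := (((hasFDerivAt_id y).sub_const z).norm_sq.const_mul α).neg.exp
  refine h1.congr_fderiv ?_
  ext v
  simp [barrier]
  ring

theorem fderiv_fderiv_barrier (α : ℝ) (z y v w : EuclideanSpace ℝ (Fin m)) :
    fderiv ℝ (fderiv ℝ (barrier α z)) y v w =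
      barrier α z y * (4 * α ^ 2 * (inner ℝ (y - z) v * inner ℝ (y - z) w) - 2 * α * inner ℝ v w) := by
  have h1 : fderiv ℝ (barrier α z) = fun y => (-(2 * α) * barrier α z y) • innerSL ℝ (y - z) :=
    funext fun y => (hasFDerivAt_barrier α z y).fderiv
  have h2 : HasFDerivAt (fun y => innerSL ℝ (y - z)) (innerSL ℝ) y :=
    (innerSL ℝ).hasFDerivAt.comp y ((hasFDerivAt_id y).sub_const z)
  have h3 := ((hasFDerivAt_barrier α z y).const_mul (-(2 * α))).smul h2
  rw [h1]
  erw [h3.fderiv]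
  change (-(2 * α) * barrier α z y) * inner ℝ v w +
    (-(2 * α) * ((-(2 * α) * barrier α z y) * inner ℝ (y - z) v)) * inner ℝ (y - z) w = _
  ring

theorem driftLap_sub_mul {U F : EuclideanSpace ℝ (Fin m) → ℝ} (hU : ContDiff ℝ ∞ U)
    (hF : ContDiff ℝ ∞ F) (δ : ℝ) (h : EuclideanSpace ℝ (Fin m) → ℝ)
    (τ y : EuclideanSpace ℝ (Fin m)) :
    driftLap h τ (fun y => U y - δ * F y) y = driftLap h τ U y - δ * driftLap h τ F y := by
  have hp : ∀ {U F : EuclideanSpace ℝ (Fin m) → ℝ}, ContDiff ℝ ∞ U → ContDiff ℝ ∞ F → ∀ k,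
      pd k (fun y => U y - δ * F y) = fun y => pd k U y - δ * pd k F y := by
    intro U F hU hF k
    rw [pd_sub hU (contDiff_const.mul hF), pd_mul contDiff_const hF, pd_const]
    simp
  have hp2 : ∀ k l, pd k (fun y => pd l U y - δ * pd l F y) =
      fun y => pd k (pd l U) y - δ * pd k (pd l F) y :=
    fun k l => hp (contDiff_pd hU l) (contDiff_pd hF l) k
  simp only [driftLap, hp hU hF, hp2, mul_sub, Finset.sum_sub_distrib, Finset.mul_sum]
  have e1 : ∀ k l, invW h y * (pd k h y * pd l h y * (δ * pd k (pd l F) y)) =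
    δ * (invW h y * (pd k h y * pd l h y * pd k (pd l F) y)) := fun k l => by ring
  have e2 : ∀ k, (τ k + y k) * (δ * pd k F y) = δ * ((τ k + y k) * pd k F y) := fun k => by ring
  simp only [e1, e2]
  ring

end Barrier

namespace Patch

variable {m : ℕ} {M : Type*} [MetricSpace M] [ChartedSpace (EuclideanSpace ℝ (Fin m)) M]
  {x : M → EuclideanSpace ℝ (Fin (m + 1))} {p : M} (P : Patch x p)

/-- Up to a positive factor, L of the barrier is 2α(|d|²(1 + |g|²) - ⟨d, g⟩²) plus terms bounded
below independently of α. Cauchy-Schwarz bounds the first part below by 2α|d|² ≥ αρ²/2, so `hα`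
makes it dominate. -/
theorem driftLap_barrier_pos {z y : EuclideanSpace ℝ (Fin m)} {α ρ G T : ℝ} (hρ : 0 < ρ)
    (hzy : ρ / 2 ≤ ‖y - z‖) (hzy' : ‖y - z‖ ≤ ρ) (hG : ‖gr P.h y‖ ^ 2 ≤ G)
    (hT : ‖P.τ + y‖ ≤ T) (hα : 2 * (1 + G) * (m + ρ * T) < α * ρ ^ 2) (hα0 : 0 < α) :
    0 < driftLap P.h P.τ (barrier α z) y := by
  set g := gr P.h y
  set d := y - z with hd
  have hB : 0 < barrier α z y := Real.exp_pos _
  rw [P.driftLap_eq_hess (contDiffAt_two (contDiff_barrier α z) y), (hasFDerivAt_barrier α z y).fderiv]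
  simp only [fderiv_fderiv_barrier]
  have h1 : ∑ k, barrier α z y * (4 * α ^ 2 * (inner ℝ d (EuclideanSpace.single k (1 : ℝ)) *
      inner ℝ d (EuclideanSpace.single k (1 : ℝ))) -
      2 * α * inner ℝ (EuclideanSpace.single k (1 : ℝ)) (EuclideanSpace.single k (1 : ℝ))) =
      barrier α z y * (4 * α ^ 2 * ‖d‖ ^ 2 - 2 * α * m) := by
    rw [← Finset.mul_sum, Finset.sum_sub_distrib, ← Finset.mul_sum, ← Finset.mul_sum,
      EuclideanSpace.norm_sq_eq]
    simp [EuclideanSpace.inner_single_right, sq]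
  rw [h1]
  have hW : 0 < 1 + ‖g‖ ^ 2 := by positivity
  have h2 : barrier α z y * (4 * α ^ 2 * ‖d‖ ^ 2 - 2 * α * m) -
      barrier α z y * (4 * α ^ 2 * (inner ℝ d g * inner ℝ d g) - 2 * α * inner ℝ g g) /
        (1 + ‖g‖ ^ 2) - ((-(2 * α) * barrier α z y) • innerSL ℝ d) (P.τ + y) =
      2 * α * barrier α z y / (1 + ‖g‖ ^ 2) * (2 * α * (‖d‖ ^ 2 * (1 + ‖g‖ ^ 2) - inner ℝ d g ^ 2) +
        ‖g‖ ^ 2 - (m - inner ℝ d (P.τ + y)) * (1 + ‖g‖ ^ 2)) := by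
    rw [real_inner_self_eq_norm_sq]
    simp
    field_simp
    ring
  rw [h2]
  refine mul_pos (by positivity) ?_
  have h3 : (inner ℝ d g : ℝ) ^ 2 ≤ ‖d‖ ^ 2 * ‖g‖ ^ 2 := by
    rw [← mul_pow, ← sq_abs]
    exact pow_le_pow_left₀ (abs_nonneg _) (abs_real_inner_le_norm d g) 2
  have h4 : -(inner ℝ d (P.τ + y) : ℝ) ≤ ρ * T := by
    refine (neg_le_abs _).trans ((abs_real_inner_le_norm _ _).trans ?_)
    gcongr
  have h5 : ρ ^ 2 / 4 ≤ ‖d‖ ^ 2 := by nlinarith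
  have hT0 : 0 ≤ T := (norm_nonneg _).trans hT
  have h6 : (m - (inner ℝ d (P.τ + y) : ℝ)) * (1 + ‖g‖ ^ 2) ≤ (m + ρ * T) * (1 + G) := by
    calc _ ≤ (m + ρ * T) * (1 + ‖g‖ ^ 2) := by gcongr; linarith
      _ ≤ _ := by gcongr
  nlinarith [mul_le_mul_of_nonneg_left h5 hα0.le, mul_le_mul_of_nonneg_left h3 hα0.le,
    sq_nonneg ‖g‖]

variable [IsManifold (𝓡 m) ∞ M] [RiemannianBundle (fun p : M => TangentSpace (𝓡 m) p)]

theorem driftLap_nonneg_of_isLocalMin (hx : IsIsometricImmersion x)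
    {w : EuclideanSpace ℝ (Fin m) → ℝ} (hw : ContDiff ℝ ∞ w) {y : EuclideanSpace ℝ (Fin m)}
    (hy : y ∈ Metric.ball 0 P.r) (hmin : IsLocalMin w y) : 0 ≤ driftLap P.h P.τ w y := by
  obtain ⟨t, ht, -⟩ := P.exists_frame_at hx (P.symm_mem hy)
  rw [P.e_symm hy] at ht
  rw [P.driftLap_frame (contDiffAt_two hw y) ht, hmin.fderiv_eq_zero]
  simp only [zero_apply, sub_zero]
  exact Finset.sum_nonneg fun i _ => fderiv_fderiv_nonneg_of_isLocalMin (hw.of_le (by norm_cast)) hmin _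

/-- The strong maximum principle in a patch. -/
theorem eq_zero_of_driftLap_nonpos (hx : IsIsometricImmersion x)
    {U : EuclideanSpace ℝ (Fin m) → ℝ} (hU : ContDiff ℝ ∞ U)
    (hpos : ∀ y ∈ Metric.ball 0 P.r, 0 ≤ U y)
    (hL : ∀ y ∈ Metric.ball 0 P.r, driftLap P.h P.τ U y ≤ 0) (h0 : U 0 = 0)
    {z : EuclideanSpace ℝ (Fin m)} (hz : ‖z‖ < P.r / 2) : U z = 0 := by
  by_contra hUz
  have hzr : 2 * ‖z‖ < P.r := by linarith
  have hBr : Metric.closedBall (0 : EuclideanSpace ℝ (Fin m)) (2 * ‖z‖) ⊆ Metric.ball 0 P.r :=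
    Metric.closedBall_subset_ball hzr
  have hBc := isCompact_closedBall (0 : EuclideanSpace ℝ (Fin m)) (2 * ‖z‖)
  have hZc : IsCompact (Metric.closedBall (0 : EuclideanSpace ℝ (Fin m)) (2 * ‖z‖) ∩ U ⁻¹' {0}) :=
    hBc.inter_right (isClosed_singleton.preimage hU.continuous)
  -- Hopf's boundary point argument: `y₀` is a zero of U nearest to z, so U is positive in the open
  -- ball about z whose boundary passes through `y₀`. The radius 2‖z‖ suffices because 0 is a zero
  -- at distance ‖z‖.
  obtain ⟨y₀, ⟨hy₀B, hy₀⟩, hy₀min⟩ := hZc.exists_isMinOn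
    ⟨0, by simp, h0⟩ (continuous_id.dist (continuous_const (y := z))).continuousOn
  simp only [Set.mem_preimage, Set.mem_singleton_iff] at hy₀
  set ρ := dist y₀ z with hρ
  have hρ0 : 0 < ρ := dist_pos.2 fun h => hUz (h ▸ hy₀)
  have hρz : ρ ≤ ‖z‖ := by
    have : dist y₀ z ≤ dist 0 z := hy₀min ⟨by simp, h0⟩
    simpa using this
  have hsub : Metric.closedBall z ρ ⊆ Metric.closedBall 0 (2 * ‖z‖) :=
    Metric.closedBall_subset_closedBall' (by rw [dist_zero_right]; linarith)
  have hball : ∀ y ∈ Metric.ball z ρ, 0 < U y := by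
    intro y hy
    have hyB := hsub (Metric.ball_subset_closedBall hy)
    refine lt_of_le_of_ne (hpos y (hBr hyB)) fun h => ?_
    have : dist y₀ z ≤ dist y z := hy₀min ⟨hyB, h.symm⟩
    exact (not_lt.2 this) hy
  obtain ⟨y₁, hy₁, hy₁min⟩ := (isCompact_closedBall z (ρ / 2)).exists_isMinOn
    ⟨z, Metric.mem_closedBall_self (by positivity)⟩ hU.continuous.continuousOn
  set δ := U y₁ with hδ
  have hδ0 : 0 < δ := hball y₁ (Metric.closedBall_subset_ball (half_lt_self hρ0) hy₁)
  obtain ⟨G, hG⟩ : ∃ G : ℝ, ∀ y ∈ Metric.closedBall (0 : EuclideanSpace ℝ (Fin m)) (2 * ‖z‖),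
      ‖gr P.h y‖ ^ 2 ≤ G := by
    have hc : Continuous fun y => ‖gr P.h y‖ ^ 2 := by
      simp only [norm_gr_sq]
      exact continuous_finsetSum _ fun k _ => ((contDiff_pd P.smooth k).continuous).pow 2
    obtain ⟨G, hG⟩ := hBc.exists_bound_of_continuousOn hc.continuousOn
    exact ⟨G, fun y hy => (le_abs_self _).trans (hG y hy)⟩
  have hT : ∀ y ∈ Metric.closedBall (0 : EuclideanSpace ℝ (Fin m)) (2 * ‖z‖),
      ‖P.τ + y‖ ≤ ‖P.τ‖ + 2 * ‖z‖ := fun y hy =>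
    (norm_add_le _ _).trans (by gcongr; simpa using hy)
  obtain ⟨α, hα⟩ := exists_gt (max 0 (2 * (1 + G) * (m + ρ * (‖P.τ‖ + 2 * ‖z‖)) / ρ ^ 2))
  have hα0 : 0 < α := (le_max_left _ _).trans_lt hα
  have hα1 : 2 * (1 + G) * (m + ρ * (‖P.τ‖ + 2 * ‖z‖)) < α * ρ ^ 2 :=
    (div_lt_iff₀ (by positivity)).1 ((le_max_right _ _).trans_lt hα)
  -- On the annulus of radii ρ/2 and ρ one has L w < 0, which excludes an interior minimum. The
  -- choice of δ handles the inner sphere, so w is smallest at `y₀`.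
  set w : EuclideanSpace ℝ (Fin m) → ℝ := fun y => U y - δ * barrier α z y with hw
  have hwc : ContDiff ℝ ∞ w := hU.sub (contDiff_const.mul (contDiff_barrier α z))
  have hAc : IsCompact (Metric.closedBall z ρ \ Metric.ball z (ρ / 2)) :=
    (isCompact_closedBall z ρ).diff Metric.isOpen_ball
  have hy₀A : y₀ ∈ Metric.closedBall z ρ \ Metric.ball z (ρ / 2) :=
    ⟨Metric.mem_closedBall.2 le_rfl, fun h => by
      have : ρ < ρ / 2 := h
      linarith⟩
  have hb₀ : barrier α z y₀ = Real.exp (-(α * ρ ^ 2)) := by rw [barrier, ← dist_eq_norm]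
  obtain ⟨y₂, hy₂, hy₂min⟩ := hAc.exists_isMinOn ⟨y₀, hy₀A⟩ hwc.continuous.continuousOn
  have hw₂ : w y₀ ≤ w y₂ := by
    have hdist := Metric.mem_closedBall.1 hy₂.1
    have hdist' : ρ / 2 ≤ dist y₂ z := not_lt.1 fun h => hy₂.2 h
    have hy₂r := hBr (hsub hy₂.1)
    simp only [hw, hy₀, hb₀]
    rcases hdist.eq_or_lt with h | h
    · have : barrier α z y₂ = Real.exp (-(α * ρ ^ 2)) := by rw [barrier, ← dist_eq_norm, h]
      rw [this]
      linarith [hpos y₂ hy₂r]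
    rcases hdist'.eq_or_lt with h' | h'
    · have h1 : δ ≤ U y₂ := hy₁min (Metric.mem_closedBall.2 h'.symm.le)
      have h2 : barrier α z y₂ ≤ 1 := Real.exp_le_one_iff.2 (neg_nonpos.2 (by positivity))
      have h3 := Real.exp_pos (-(α * ρ ^ 2))
      nlinarith
    · exfalso
      have hloc : IsLocalMin w y₂ := by
        have h1 : ∀ᶠ y in 𝓝 y₂, dist y z < ρ :=
          (continuous_id.dist continuous_const).continuousAt.eventually_lt_const h
        have h2 : ∀ᶠ y in 𝓝 y₂, ρ / 2 < dist y z :=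
          (continuous_id.dist continuous_const).continuousAt.eventually_const_lt h'
        filter_upwards [h1, h2] with y hy hy'
        exact hy₂min ⟨hy.le, not_lt.2 hy'.le⟩
      have h1 := P.driftLap_nonneg_of_isLocalMin hx hwc hy₂r hloc
      rw [driftLap_sub_mul hU (contDiff_barrier α z)] at h1
      rw [dist_eq_norm] at hdist hdist'
      have h2 := P.driftLap_barrier_pos hρ0 hdist' hdist (hG y₂ (hsub hy₂.1)) (hT y₂ (hsub hy₂.1))
        hα1 hα0
      have h3 := hL y₂ hy₂r
      nlinarith
  have hDU : fderiv ℝ U y₀ = 0 := by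
    have : IsLocalMin U y₀ := by
      filter_upwards [P.eventually_mem (hBr hy₀B)] with y hy
      rw [hy₀]; exact hpos y hy
    exact this.fderiv_eq_zero
  -- Since ∇U vanishes at `y₀` and the barrier increases towards z, w strictly decreases along the
  -- inward radius. This contradicts minimality.
  have hk : HasDerivAt (fun t : ℝ => w (y₀ + t • (z - y₀)))
      (-(δ * (2 * α * ρ ^ 2 * Real.exp (-(α * ρ ^ 2))))) 0 := by
    have hl : HasDerivAt (fun t : ℝ => y₀ + t • (z - y₀)) (z - y₀) 0 := by
      simpa using ((hasDerivAt_id (0 : ℝ)).smul_const (z - y₀)).const_add y₀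
    have h1 : HasFDerivAt w (fderiv ℝ U y₀ - δ • ((-(2 * α) * barrier α z y₀) • innerSL ℝ (y₀ - z)))
        (y₀ + (0 : ℝ) • (z - y₀)) := by
      rw [zero_smul, add_zero]
      exact (hU.differentiable (by simp) y₀).hasFDerivAt.sub
        ((hasFDerivAt_barrier α z y₀).const_mul δ)
    refine (h1.comp_hasDerivAt 0 hl).congr_deriv ?_
    have h2 : (inner ℝ (y₀ - z) (z - y₀) : ℝ) = -ρ ^ 2 := by
      rw [← neg_sub y₀ z, inner_neg_right, real_inner_self_eq_norm_sq, hρ, dist_eq_norm]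
    rw [hDU, zero_sub]
    change -(δ * ((-(2 * α) * barrier α z y₀) * inner ℝ (y₀ - z) (z - y₀))) = _
    rw [h2, hb₀]
    ring
  have hIoi : Set.Ioi (0 : ℝ) ⊆ {0}ᶜ := fun t ht => ne_of_gt (Set.mem_Ioi.1 ht)
  have hslope := (hasDerivAt_iff_tendsto_slope.1 hk).mono_left (nhdsWithin_mono (0 : ℝ) hIoi)
  have hnonneg : ∀ᶠ t in 𝓝[>] (0 : ℝ), 0 ≤ slope (fun t : ℝ => w (y₀ + t • (z - y₀))) 0 t := by
    filter_upwards [Ioo_mem_nhdsGT (show (0 : ℝ) < 1 / 2 by norm_num)] with t ht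
    have hd : dist (y₀ + t • (z - y₀)) z = (1 - t) * ρ := by
      have : y₀ + t • (z - y₀) - z = (1 - t) • (y₀ - z) := by
        rw [sub_smul, one_smul, smul_sub, smul_sub]; abel
      rw [dist_eq_norm, this, norm_smul, Real.norm_of_nonneg (by linarith [ht.2]), hρ, dist_eq_norm]
    have hmem : y₀ + t • (z - y₀) ∈ Metric.closedBall z ρ \ Metric.ball z (ρ / 2) := by
      refine ⟨Metric.mem_closedBall.2 ?_, fun h => ?_⟩
      · rw [hd]; nlinarith [ht.1]
      · rw [Metric.mem_ball, hd] at h; nlinarith [ht.2]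
    have h1 : w y₀ ≤ w (y₀ + t • (z - y₀)) := hw₂.trans (hy₂min hmem)
    rw [slope_def_field, zero_smul, add_zero, sub_zero]
    exact div_nonneg (sub_nonneg.2 h1) ht.1.le
  have := ge_of_tendsto hslope hnonneg
  have h7 : 0 < δ * (2 * α * ρ ^ 2 * Real.exp (-(α * ρ ^ 2))) := by positivity
  linarith

end Patch

section StrongMaximumPrinciple

variable {m : ℕ} {M : Type*} [MetricSpace M] [ChartedSpace (EuclideanSpace ℝ (Fin m)) M]
  {x : M → EuclideanSpace ℝ (Fin (m + 1))}
  [IsManifold (𝓡 m) ∞ M] [RiemannianBundle (fun p : M => TangentSpace (𝓡 m) p)]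

theorem hasDriftLap_inner (hx : IsSelfShrinker x) (a : EuclideanSpace ℝ (Fin (m + 1))) :
    HasDriftLap x (fun p => inner ℝ a (x p)) fun p => -inner ℝ a (x p) := by
  intro p P
  refine ⟨fun y => inner ℝ a (P.Y y), P.contDiff_inner_Y a, fun y hy => ?_⟩
  simp only
  rw [P.x_symm_eq hy, P.driftLap_inner_Y hx a hy]
  exact ⟨rfl, rfl⟩

/-- The strong maximum principle for the height function. -/
theorem inner_eq_zero_or_pos [ConnectedSpace M] (hx : IsSelfShrinker x)
    {a : EuclideanSpace ℝ (Fin (m + 1))} (ha : ∀ p, 0 ≤ (inner ℝ a (x p) : ℝ)) :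
    (∀ p, inner ℝ a (x p) = (0 : ℝ)) ∨ ∀ p, 0 < (inner ℝ a (x p) : ℝ) := by
  have hxi := hx.toIsIsometricImmersion
  have hc : Continuous fun p => (inner ℝ a (x p) : ℝ) := continuous_const.inner hxi.contMDiff.continuous
  have hclopen : IsClopen {p | (inner ℝ a (x p) : ℝ) = 0} := by
    refine ⟨isClosed_eq hc continuous_const, isOpen_iff_mem_nhds.2 fun p hp => ?_⟩
    obtain ⟨P⟩ := exists_patch hxi p
    have h1 : ∀ y ∈ Metric.ball (0 : EuclideanSpace ℝ (Fin m)) P.r,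
        0 ≤ (inner ℝ a (P.Y y) : ℝ) := fun y hy => P.x_symm_eq hy ▸ ha _
    have h2 : ∀ z : EuclideanSpace ℝ (Fin m), ‖z‖ < P.r / 2 → (inner ℝ a (P.Y z) : ℝ) = 0 :=
      fun z hz => P.eq_zero_of_driftLap_nonpos hxi (P.contDiff_inner_Y a) h1
        (fun y hy => by
          rw [P.driftLap_inner_Y hx a hy]
          linarith [h1 y hy])
        (by
          rw [← P.x_symm_eq P.zero_mem, P.symm_zero]; exact hp) hz
    have h3 : P.e.source ∩ P.e ⁻¹' Metric.ball 0 (P.r / 2) ∈ 𝓝 p :=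
      (P.e.isOpen_inter_preimage Metric.isOpen_ball).mem_nhds ⟨P.mem_source, by
        rw [Set.mem_preimage, P.e_self]; exact Metric.mem_ball_self (half_pos P.r_pos)⟩
    filter_upwards [h3] with q hq
    rw [P.x_eq hq.1]
    exact h2 _ (mem_ball_zero_iff.1 hq.2)
  rcases isClopen_iff.1 hclopen with h | h
  · refine Or.inr fun p => lt_of_le_of_ne (ha p) fun h0 => ?_
    have : p ∈ {p | (inner ℝ a (x p) : ℝ) = 0} := h0.symm
    rw [h] at this
    exact this
  · exact Or.inl fun p => by
      have : p ∈ {p | (inner ℝ a (x p) : ℝ) = 0} := h ▸ Set.mem_univ p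
      exact this

end StrongMaximumPrinciple

/-! ### The squared norm of A on the hypersurface, and totally geodesic shrinkers. -/

namespace Patch

variable {m : ℕ} {M : Type*} [MetricSpace M] [ChartedSpace (EuclideanSpace ℝ (Fin m)) M]
  {x : M → EuclideanSpace ℝ (Fin (m + 1))} {p : M} (P : Patch x p)
  [IsManifold (𝓡 m) ∞ M] [RiemannianBundle (fun p : M => TangentSpace (𝓡 m) p)]

theorem normSqA_symm (hx : IsIsometricImmersion x) {y : EuclideanSpace ℝ (Fin m)}
    (hy : y ∈ Metric.ball 0 P.r) : normSqA x (P.e.symm y) = graphNormSq P.h y := by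
  have hW : (1 + ‖gr P.h y‖ ^ 2) ≠ 0 := by positivity
  rw [P.normSqA_eq hx hy, graphNormSq, invW_eq]
  simp only [pow_two (∑ l, _), pow_two (pd _ _ _)]
  field_simp

theorem hess_eq_zero (hx : IsIsometricImmersion x) (hq : ∀ p, normSqA x p = 0)
    {y : EuclideanSpace ℝ (Fin m)} (hy : y ∈ Metric.ball 0 P.r) :
    fderiv ℝ (fderiv ℝ P.h) y = 0 := by
  obtain ⟨t, ht, hA, -⟩ := P.exists_frame hx hy
  have hW : (1 + ‖gr P.h y‖ ^ 2) ≠ 0 := by positivity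
  set H := fderiv ℝ (fderiv ℝ P.h) y with hH
  have hz : ∀ i j, H (t i) (t j) = 0 := by
    intro i j
    have h1 := hq (P.e.symm y)
    rw [normSqA, Finset.sum_eq_zero_iff_of_nonneg
      fun i _ => Finset.sum_nonneg fun j _ => sq_nonneg _] at h1
    have h2 := (Finset.sum_eq_zero_iff_of_nonneg fun j _ => sq_nonneg _).1 (h1 i (Finset.mem_univ _))
      j (Finset.mem_univ _)
    rw [hA, norm_smul, mul_pow, P.norm_normal_sq] at h2
    simpa [hW] using h2
  ext v w
  rw [ht v, map_sum, sum_apply]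
  refine Finset.sum_eq_zero fun i _ => ?_
  rw [map_smul, smul_apply]
  have h3 : H (t i) w = 0 := by
    rw [ht w, map_sum]
    exact Finset.sum_eq_zero fun j _ => by rw [map_smul, hz, smul_zero]
  rw [h3, smul_zero]

theorem h_eq_zero (hx : IsIsometricImmersion x) (hq : ∀ p, normSqA x p = 0)
    {y : EuclideanSpace ℝ (Fin m)} (hy : y ∈ Metric.ball 0 P.r) : P.h y = 0 := by
  have hc : IsPreconnected (Metric.ball (0 : EuclideanSpace ℝ (Fin m)) P.r) :=
    (convex_ball _ _).isPreconnected
  have h1 : ∀ z ∈ Metric.ball (0 : EuclideanSpace ℝ (Fin m)) P.r, fderiv ℝ P.h z = 0 := by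
    intro z hz
    rw [← P.fderiv_zero]
    exact Metric.isOpen_ball.is_const_of_fderiv_eq_zero hc
      ((P.smooth.fderiv_right (m := ∞) (by simp)).differentiable (by simp)).differentiableOn
      (fun w hw => P.hess_eq_zero hx hq hw) hz P.zero_mem
  rw [← P.h_zero]
  exact Metric.isOpen_ball.is_const_of_fderiv_eq_zero hc
    (P.smooth.differentiable (by simp)).differentiableOn h1 hy P.zero_mem

end Patch

section NormSqA

variable {m : ℕ} {M : Type*} [MetricSpace M] [ChartedSpace (EuclideanSpace ℝ (Fin m)) M]
  {x : M → EuclideanSpace ℝ (Fin (m + 1))}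
  [IsManifold (𝓡 m) ∞ M] [RiemannianBundle (fun p : M => TangentSpace (𝓡 m) p)]

omit [IsManifold (𝓡 m) ∞ M] in
theorem normSqA_nonneg (x : M → EuclideanSpace ℝ (Fin (m + 1))) (p : M) : 0 ≤ normSqA x p :=
  Finset.sum_nonneg fun _ _ => Finset.sum_nonneg fun _ _ => sq_nonneg _

omit [IsManifold (𝓡 m) ∞ M] in
theorem dif_eq_zero_of_gradInner_eq_zero {F : M → ℝ} {q : M}
    (h : gradInner m F F q = 0) : dif (m := m) F q = 0 := by
  have h1 := (Finset.sum_eq_zero_iff_of_nonneg fun i _ => mul_self_nonneg _).1 h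
  have h2 : ((dif (m := m) F q).toLinearMap : TangentSpace (𝓡 m) q →ₗ[ℝ] ℝ) = 0 :=
    (stdOrthonormalBasis ℝ (TangentSpace (𝓡 m) q)).toBasis.ext fun i => by
      have := mul_self_eq_zero.1 (h1 i (Finset.mem_univ _))
      rw [OrthonormalBasis.coe_toBasis]
      exact this
  ext v
  exact congrArg (fun L : TangentSpace (𝓡 m) q →ₗ[ℝ] ℝ => L v) h2

theorem HasDriftLap.continuous_gradInner (hx : IsIsometricImmersion x) {F G : M → ℝ}
    (h : HasDriftLap x F G) : Continuous (gradInner m F F) := by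
  refine continuous_iff_continuousAt.2 fun p => ?_
  obtain ⟨P⟩ := exists_patch hx p
  obtain ⟨Φ, hΦ, hFG⟩ := h p P
  have h1 : Continuous fun y => ∑ k, pd k Φ y * pd k Φ y -
      (∑ k, pd k P.h y * pd k Φ y) * (∑ k, pd k P.h y * pd k Φ y) * invW P.h y := by
    have := P.smooth
    have h2 : ContDiff ℝ ∞ fun y => ∑ k, pd k Φ y * pd k Φ y -
      (∑ k, pd k P.h y * pd k Φ y) * (∑ k, pd k P.h y * pd k Φ y) * invW P.h y := by fun_prop
    exact h2.continuous
  refine (h1.continuousAt.comp (P.e.continuousAt P.mem_source)).congr ?_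
  filter_upwards [P.e.open_source.mem_nhds P.mem_source] with q hq
  have hy := P.e_mem hq
  have hFe : F ∘ P.e.symm =ᶠ[𝓝 (P.e q)] Φ := by
    filter_upwards [P.eventually_mem hy] with z hz using (hFG z hz).1
  have h3 := P.gradInner_eq hx hy F F
  have hFp : ∀ k, pd k (F ∘ P.e.symm) (P.e q) = pd k Φ (P.e q) :=
    fun k => (pd_eventuallyEq hFe k).self_of_nhds
  rw [P.e.left_inv hq, fderiv_eq_sum_pd, div_eq_mul_inv, ← invW_eq] at h3
  simp only [hFp, gr_apply] at h3
  exact h3.symm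

/-- A function with vanishing gradient on a connected manifold is constant. -/
theorem HasDriftLap.eq_const [ConnectedSpace M] (hx : IsIsometricImmersion x) {F G : M → ℝ}
    (h : HasDriftLap x F G) (h0 : ∀ q, gradInner m F F q = 0) (p q : M) : F p = F q := by
  have hl : IsLocallyConstant F := by
    refine (IsLocallyConstant.iff_eventually_eq F).2 fun p => ?_
    obtain ⟨P⟩ := exists_patch hx p
    obtain ⟨Φ, hΦ, hFG⟩ := h p P
    have h1 : ∀ y ∈ Metric.ball (0 : EuclideanSpace ℝ (Fin m)) P.r, fderiv ℝ Φ y = 0 := by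
      intro y hy
      have hFe : F ∘ P.e.symm =ᶠ[𝓝 y] Φ := by
        filter_upwards [P.eventually_mem hy] with z hz using (hFG z hz).1
      rw [← hFe.fderiv_eq, P.dif_eq hx hy, dif_eq_zero_of_gradInner_eq_zero (h0 _),
        ContinuousLinearMap.zero_comp]
    filter_upwards [P.e.open_source.mem_nhds P.mem_source] with q hq
    have h2 := Metric.isOpen_ball.is_const_of_fderiv_eq_zero (convex_ball _ _).isPreconnected
      (hΦ.differentiable (by simp)).differentiableOn h1 (P.e_mem hq) P.zero_mem
    rw [← (hFG _ (P.e_mem hq)).1, ← (hFG _ P.zero_mem).1, P.e.left_inv hq, P.symm_zero] at h2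
    exact h2
  exact hl.apply_eq_of_preconnectedSpace p q

/-- Simons' inequality for self-shrinkers. -/
theorem exists_hasDriftLap_normSqA (hx : IsSelfShrinker x) : ∃ G : M → ℝ,
    HasDriftLap x (normSqA x) G ∧ ∀ p, ∀ ε > 0,
      2 * normSqA x p * (1 - normSqA x p) +
        gradInner m (normSqA x) (normSqA x) p / (2 * (normSqA x p + ε)) ≤ G p := by
  have hxi := hx.toIsIsometricImmersion
  set Q : ∀ p : M, Patch x p := fun p => (exists_patch hxi p).some with hQ
  have heq : ∀ {p : M} (P : Patch x p) {y : EuclideanSpace ℝ (Fin m)}, y ∈ Metric.ball 0 P.r →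
      normSqA x ∘ P.e.symm =ᶠ[𝓝 y] graphNormSq P.h := fun P y hy => by
    filter_upwards [P.eventually_mem hy] with z hz using P.normSqA_symm hxi hz
  refine ⟨fun p => driftLap (Q p).h (Q p).τ (graphNormSq (Q p).h) 0, ?_, ?_⟩
  · intro p P
    refine ⟨graphNormSq P.h, contDiff_graphNormSq P.smooth, fun y hy => ⟨P.normSqA_symm hxi hy, ?_⟩⟩
    have h1 := Patch.driftLap_invariant (Q (P.e.symm y)) hx P (Q (P.e.symm y)).mem_source (P.symm_mem hy)
      (heq _ (by rw [(Q (P.e.symm y)).e_self]; exact (Q (P.e.symm y)).zero_mem))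
      (heq P (by rw [P.e_symm hy]; exact hy)) (contDiff_graphNormSq P.smooth)
    rw [(Q (P.e.symm y)).e_self, P.e_symm hy] at h1
    exact h1
  · intro p ε hε
    set P := Q p
    have hq0 : graphNormSq P.h 0 = normSqA x p := by
      rw [← P.normSqA_symm hxi P.zero_mem, P.symm_zero]
    have hgrad : gradInner m (normSqA x) (normSqA x) p = ∑ j, pd j (graphNormSq P.h) 0 ^ 2 := by
      rw [P.gradInner_center hxi]
      refine Finset.sum_congr rfl fun k _ => ?_
      rw [(pd_eventuallyEq (heq P P.zero_mem) k).self_of_nhds, sq]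
    have hs := simons P.smooth P.pd_zero (P.eventually_driftLap_h hx)
    rw [← hgrad, hq0] at hs
    have hq := normSqA_nonneg x p
    have hg := gradInner_self_nonneg (m := m) (normSqA x) p
    simp only
    set L := driftLap P.h P.τ (graphNormSq P.h) 0
    -- At a zero of |A|² the pointwise inequality cannot be divided by |A|². Such a point is a
    -- minimum, so L|A|² ≥ 0 and the gradient vanishes.
    rcases hq.eq_or_lt with h0 | h0
    · have hmin : IsLocalMin (graphNormSq P.h) 0 := by
        filter_upwards [P.eventually_mem P.zero_mem] with y hy
        rw [hq0, ← h0, ← P.normSqA_symm hxi hy]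
        exact normSqA_nonneg x _
      have hL : 0 ≤ L := P.driftLap_nonneg_of_isLocalMin hxi (contDiff_graphNormSq P.smooth)
        P.zero_mem hmin
      rw [← h0] at hs ⊢
      have : gradInner m (normSqA x) (normSqA x) p = 0 := le_antisymm (by linarith) hg
      rw [this]
      simpa using hL
    · have h1 : gradInner m (normSqA x) (normSqA x) p / (2 * (normSqA x p + ε)) ≤
          L - 2 * normSqA x p * (1 - normSqA x p) := by
        have h2 : 0 ≤ L - 2 * normSqA x p * (1 - normSqA x p) := by
          by_contra! hneg
          nlinarith
        rw [div_le_iff₀ (by positivity)]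
        nlinarith
      linarith

/-- A totally geodesic self-shrinker lies in a hyperplane through the origin. -/
theorem exists_hyperplane_of_normSqA_eq_zero [ConnectedSpace M] (hx : IsSelfShrinker x)
    (hq : ∀ p, normSqA x p = 0) :
    ∃ n : EuclideanSpace ℝ (Fin (m + 1)), n ≠ 0 ∧ ∀ p, inner ℝ n (x p) = (0 : ℝ) := by
  have hxi := hx.toIsIsometricImmersion
  have hflat : ∀ {p : M} (P : Patch x p) {q : M}, q ∈ P.e.source → x q = x p + P.E (P.e q) := by
    intro p P q hqs
    rw [P.x_eq hqs, Patch.Y, P.h_eq_zero hxi hq (P.e_mem hqs), zero_smul, add_zero]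
  obtain ⟨p₀⟩ := (inferInstance : Nonempty M)
  obtain ⟨P₀⟩ := exists_patch hxi p₀
  -- With zero Hessian the mean curvature vanishes, so the shrinker equation puts the tangent
  -- hyperplane through the origin.
  have hν0 : inner ℝ P₀.ν (x p₀) = (0 : ℝ) := by
    have h1 := P₀.driftLap_h hx P₀.zero_mem
    rw [P₀.driftLap_eq_hess (Patch.contDiffAt_two P₀.smooth 0), P₀.hess_eq_zero hxi hq P₀.zero_mem,
      P₀.h_zero, P₀.fderiv_zero] at h1
    simpa using h1.symm
  refine ⟨P₀.ν, fun h => by simpa [h] using P₀.norm_ν, ?_⟩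
  -- S is open by its form. It is closed because in a flat patch the height is affine, and an affine
  -- function vanishing on a nonempty open set vanishes on the whole patch.
  set S : Set M := {p | ∀ᶠ q in 𝓝 p, inner ℝ P₀.ν (x q) = (0 : ℝ)} with hS
  have hSo : IsOpen S := isOpen_setOfPred_eventually_nhds
  have hSne : p₀ ∈ S := by
    change ∀ᶠ q in 𝓝 p₀, inner ℝ P₀.ν (x q) = (0 : ℝ)
    filter_upwards [P₀.e.open_source.mem_nhds P₀.mem_source] with q hqs
    rw [hflat P₀ hqs, inner_add_right, hν0, P₀.inner_ν, add_zero]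
  have hSc : IsClosed S := by
    refine isClosed_of_closure_subset fun p hp => ?_
    obtain ⟨P⟩ := exists_patch hxi p
    obtain ⟨q, hqs, hqS⟩ := mem_closure_iff.1 hp _ P.e.open_source P.mem_source
    have h1 : (fun y => inner ℝ P₀.ν (x p) + inner ℝ P₀.ν (P.E y)) =ᶠ[𝓝 (P.e q)]
        fun _ => (0 : ℝ) := by
      have h2 : Tendsto P.e.symm (𝓝 (P.e q)) (𝓝 q) := by
        have := P.continuousAt_symm (P.e_mem hqs)
        rwa [ContinuousAt, P.e.left_inv hqs] at this
      filter_upwards [h2.eventually hqS, P.eventually_mem (P.e_mem hqs)] with y hy hyb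
      rw [hflat P (P.symm_mem hyb), P.e_symm hyb, inner_add_right] at hy
      exact hy
    have h3 : HasFDerivAt (fun y => inner ℝ P₀.ν (x p) + inner ℝ P₀.ν (P.E y))
        ((innerSL ℝ P₀.ν).comp P.E.toContinuousLinearMap) (P.e q) :=
      ((innerSL ℝ P₀.ν).comp P.E.toContinuousLinearMap).hasFDerivAt.const_add _
    have h4 := (h3.congr_of_eventuallyEq h1.symm).unique (hasFDerivAt_const 0 _)
    have h5 : ∀ v, inner ℝ P₀.ν (P.E v) = (0 : ℝ) := fun v =>
      congrArg (fun L : EuclideanSpace ℝ (Fin m) →L[ℝ] ℝ => L v) h4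
    have h6 := h1.self_of_nhds
    simp only [h5, add_zero] at h6
    change ∀ᶠ q in 𝓝 p, inner ℝ P₀.ν (x q) = (0 : ℝ)
    filter_upwards [P.e.open_source.mem_nhds P.mem_source] with q' hqs'
    rw [hflat P hqs', inner_add_right, h6, h5, add_zero]
  have hSu : S = Set.univ := IsClopen.eq_univ ⟨hSc, hSo⟩ ⟨p₀, hSne⟩
  intro p
  have : p ∈ S := hSu ▸ Set.mem_univ p
  exact this.self_of_nhds

end NormSqA

/-! ### Stability inequality and volume growth. -/

section Stability

variable {m : ℕ} {M : Type*} [MetricSpace M] [ChartedSpace (EuclideanSpace ℝ (Fin m)) M]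
  {x : M → EuclideanSpace ℝ (Fin (m + 1))}
  [IsManifold (𝓡 m) ∞ M] [RiemannianBundle (fun p : M => TangentSpace (𝓡 m) p)]

theorem hasCompactSupport_cutoff {α : Type*} [PseudoMetricSpace α] [ProperSpace α] (o : α) {R : ℝ}
    (hR : 0 < R) : HasCompactSupport (cutoff o R) :=
  (isCompact_closedBall o (2 * R)).of_isClosed_subset (isClosed_tsupport _)
    (tsupport_cutoff_subset o hR)

theorem gradInner_cutoff_le [IsRiemannianManifold (𝓡 m) M] (hx : IsIsometricImmersion x) (o : M)
    {R : ℝ} (hR : 0 < R) (q : M) :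
    gradInner m (cutoff o R) (cutoff o R) q ≤
      (Metric.closedBall o (2 * R)).indicator (fun _ => (1 / R) ^ 2) q := by
  by_cases hq : q ∈ Metric.closedBall o (2 * R)
  · rw [Set.indicator_of_mem hq]
    have := gradInner_le_sq hx (p := q) univ_mem (lipschitzWith_cutoff o hR).lipschitzOnWith
    rwa [Real.coe_toNNReal _ (by positivity)] at this
  · rw [Set.indicator_of_notMem hq]
    exact (gradInner_eq_zero (fun h => hq (tsupport_cutoff_subset o hR h)) _).le

variable [MeasurableSpace M] [BorelSpace M]

omit [IsManifold (𝓡 m) ∞ M] [BorelSpace M] in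
/-- Finite weighted volume gives quadratic growth of the weighted volume. -/
theorem hasQuadraticWeightedVolumeGrowth_of_finite [Nonempty M] (h : weightedVolume x Set.univ ≠ ⊤) :
    HasQuadraticWeightedVolumeGrowth x := by
  obtain ⟨o⟩ := ‹Nonempty M›
  refine ⟨o, (weightedVolume x Set.univ).toReal, ?_⟩
  filter_upwards [eventually_ge_atTop 1] with R hR
  refine (measure_mono (Set.subset_univ _)).trans ?_
  rw [← ENNReal.ofReal_toReal h]
  refine ENNReal.ofReal_le_ofReal ?_
  rw [ENNReal.toReal_ofReal ENNReal.toReal_nonneg]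
  exact le_mul_of_one_le_right ENNReal.toReal_nonneg (one_le_pow₀ hR)

omit [IsManifold (𝓡 m) ∞ M] in
-- The Gaussian is dominated layer by layer in |x|, so that the total weight is at most a convergent
-- series of a polynomial times an exponential.
theorem weightedVolume_univ_ne_top_of_extrinsic (hx : IsIsometricImmersion x)
    (h : HasExtrinsicPolynomialVolumeGrowth x) : weightedVolume x Set.univ ≠ ⊤ := by
  obtain ⟨C, n, hC⟩ := h
  obtain ⟨R₀, hR₀⟩ := eventually_atTop.1 hC
  obtain ⟨N, hN⟩ := exists_nat_ge R₀
  have hxc : Continuous x := hx.contMDiff.continuous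
  have hvol : ∀ k : ℕ, riemannianVolume m M (x ⁻¹' Metric.ball 0 (k + 1)) ≤
      ENNReal.ofReal (C * ((k + (N + 1) : ℕ) : ℝ) ^ n) := by
    intro k
    refine (measure_mono (Set.preimage_mono (Metric.ball_subset_ball ?_))).trans (hR₀ _ ?_)
    · push_cast; linarith [(Nat.cast_nonneg N : (0 : ℝ) ≤ N)]
    · push_cast; linarith [(Nat.cast_nonneg k : (0 : ℝ) ≤ k)]
  -- The single term k = ⌊|x|⌋ of the series is enough, since k ≤ k² ≤ |x|² for a natural number k.
  have hle : ∀ p, ENNReal.ofReal (Real.exp (-(‖x p‖ ^ 2 / 2))) ≤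
      ∑' k : ℕ, (x ⁻¹' Metric.ball 0 (k + 1)).indicator
        (fun _ => ENNReal.ofReal (Real.exp (-(1 / 2) * k))) p := by
    intro p
    refine le_trans ?_ (ENNReal.le_tsum ⌊‖x p‖⌋₊)
    rw [Set.indicator_of_mem (by
      rw [Set.mem_preimage, mem_ball_zero_iff]; exact Nat.lt_floor_add_one _)]
    refine ENNReal.ofReal_le_ofReal (Real.exp_le_exp.2 ?_)
    have h1 : (⌊‖x p‖⌋₊ : ℝ) ≤ ‖x p‖ := Nat.floor_le (norm_nonneg _)
    have h2 : (⌊‖x p‖⌋₊ : ℝ) ≤ (⌊‖x p‖⌋₊ : ℝ) ^ 2 := by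
      exact_mod_cast Nat.le_self_pow two_ne_zero _
    have h3 : (⌊‖x p‖⌋₊ : ℝ) ^ 2 ≤ ‖x p‖ ^ 2 := by gcongr
    linarith
  have hsum : Summable fun k : ℕ => Real.exp (-(1 / 2) * k) * (C * ((k + (N + 1) : ℕ) : ℝ) ^ n) := by
    have h1 := ((summable_nat_add_iff (N + 1)).2
      (Real.summable_pow_mul_exp_neg_nat_mul n (one_half_pos (α := ℝ)))).mul_left
        (C * Real.exp ((N + 1) / 2))
    refine h1.congr fun k => ?_
    have h2 : Real.exp (-(1 / 2) * k) =
        Real.exp ((N + 1) / 2) * Real.exp (-(1 / 2) * ((k + (N + 1) : ℕ) : ℝ)) := by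
      rw [← Real.exp_add]; congr 1; push_cast; ring
    rw [h2]; ring
  rw [weightedVolume, withDensity_apply _ MeasurableSet.univ, Measure.restrict_univ]
  refine ne_top_of_le_ne_top hsum.tsum_ofReal_ne_top ((lintegral_mono hle).trans ?_)
  rw [lintegral_tsum fun k => (measurable_const.indicator
    (Metric.isOpen_ball.preimage hxc).measurableSet).aemeasurable]
  refine ENNReal.tsum_le_tsum fun k => ?_
  rw [lintegral_indicator_const (Metric.isOpen_ball.preimage hxc).measurableSet,
    ENNReal.ofReal_mul (Real.exp_pos _).le]
  gcongr
  exact hvol k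

variable [SecondCountableTopology M] [IsRiemannianManifold (𝓡 m) M]

/-- A positive function `u` with `L u = -u` gives a stability inequality. -/
theorem integral_sq_le_integral_gradInner (hx : IsSelfShrinker x) {u : M → ℝ}
    (hu : HasDriftLap x u fun p => -u p) (hpos : ∀ p, 0 < u p) {φ : M → ℝ}
    (hφ : LocallyLipschitz φ) (hφc : HasCompactSupport φ) :
    ∫ q, φ q ^ 2 ∂weightedVolume x ≤ ∫ q, gradInner m φ φ q ∂weightedVolume x := by
  have hxi := hx.toIsIsometricImmersion
  have huL := hu.locallyLipschitz hxi
  have hinv : LocallyLipschitz fun q => (u q)⁻¹ :=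
    locallyLipschitz_comp huL (g := fun t => t⁻¹) fun a => contDiffAt_inv ℝ (hpos a).ne'
  -- The test function φ²/u: paired with L u = -u it returns exactly ∫ φ².
  have hη : LocallyLipschitz fun q => φ q * φ q * (u q)⁻¹ :=
    locallyLipschitz_mul (locallyLipschitz_mul hφ hφ) hinv
  have hηc : HasCompactSupport fun q => φ q * φ q * (u q)⁻¹ :=
    HasCompactSupport.mul_right (HasCompactSupport.mul_right hφc)
  have h1 := integral_gradInner hx hu hη hηc
  have h2 : ∫ q, φ q ^ 2 ∂weightedVolume x = -∫ q, φ q * φ q * (u q)⁻¹ * -u q ∂weightedVolume x := by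
    rw [← integral_neg]
    refine integral_congr_ae (Eventually.of_forall fun q => ?_)
    have := (hpos q).ne'
    simp only
    field_simp
  rw [h2, ← h1]
  refine integral_mono_ae (integrable_gradInner hxi hη hηc huL)
    (integrable_gradInner hxi hφ hφc hφ) ?_
  filter_upwards [ae_hasDif hxi hφ, ae_hasDif hxi huL] with q hq hqu
  have h0 := (hpos q).ne'
  have hd : dif (m := m) (fun q => φ q * φ q * (u q)⁻¹) q =
      (2 * (φ q / u q)) • dif φ q + (-(φ q / u q) ^ 2) • dif u q := by
    have hdi := hasDerivAt_inv h0
    have e1 := dif_mul (hq.mul hq) (hqu.comp hdi)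
    rw [dif_mul hq hq, dif_comp hqu hdi] at e1
    rw [e1, smul_smul, ← add_smul, smul_smul, add_comm]
    congr 2 <;> field_simp
    ring
  rw [gradInner_of_dif_eq hd]
  -- The square of ∇φ - (φ/u)∇u is nonnegative, which bounds the gradient term by |∇φ|².
  have h3 := two_mul_gradInner_le (m := m) φ u q 1 (φ q / u q)
  linarith

/-- The weighted volume of a ball is controlled by the weighted volume of the ball of twice the
radius. -/
theorem measureReal_closedBall_le [ProperSpace M] (hx : IsIsometricImmersion x)
    (hst : ∀ φ : M → ℝ, LocallyLipschitz φ → HasCompactSupport φ →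
      ∫ q, φ q ^ 2 ∂weightedVolume x ≤ ∫ q, gradInner m φ φ q ∂weightedVolume x) (o : M) {R : ℝ}
    (hR : 0 < R) :
    (weightedVolume x).real (Metric.closedBall o R) ≤
      (1 / R) ^ 2 * (weightedVolume x).real (Metric.closedBall o (2 * R)) := by
  have := isLocallyFiniteMeasure_weightedVolume hx
  have hL := (lipschitzWith_cutoff o hR).locallyLipschitz
  have hc := hasCompactSupport_cutoff o hR
  have hfin : ∀ r : ℝ, weightedVolume x (Metric.closedBall o r) ≠ ⊤ := fun r =>
    (isCompact_closedBall o r).measure_lt_top.ne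
  have hind : ∀ r c : ℝ, Integrable ((Metric.closedBall o r).indicator fun _ => c)
      (weightedVolume x) := fun r c =>
    (integrable_indicator_iff Metric.isClosed_closedBall.measurableSet).2
      (integrableOn_const (hfin r))
  calc (weightedVolume x).real (Metric.closedBall o R)
      = ∫ q, (Metric.closedBall o R).indicator (fun _ => (1 : ℝ)) q ∂weightedVolume x := by
        rw [integral_indicator_const _ Metric.isClosed_closedBall.measurableSet, smul_eq_mul, mul_one]
    _ ≤ ∫ q, cutoff o R q ^ 2 ∂weightedVolume x := by
        refine integral_mono (hind _ _) ((hL.continuous.pow 2).integrable_of_hasCompactSupport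
          ?_) fun q => ?_
        · simpa only [pow_two] using HasCompactSupport.mul_right hc
        · by_cases hq : q ∈ Metric.closedBall o R
          · rw [Set.indicator_of_mem hq]
            simp only [cutoff_eq_one hR (Metric.mem_closedBall.1 hq), one_pow, le_refl]
          · rw [Set.indicator_of_notMem hq]
            positivity
    _ ≤ ∫ q, gradInner m (cutoff o R) (cutoff o R) q ∂weightedVolume x := hst _ hL hc
    _ ≤ ∫ q, (Metric.closedBall o (2 * R)).indicator (fun _ => (1 / R) ^ 2) q ∂weightedVolume x :=
        integral_mono (integrable_gradInner hx hL hc hL) (hind _ _) (gradInner_cutoff_le hx o hR)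
    _ = _ := by
        rw [integral_indicator_const _ Metric.isClosed_closedBall.measurableSet, smul_eq_mul, mul_comm]

/-- The stability inequality is incompatible with quadratic growth of the weighted volume. -/
theorem not_hasQuadraticWeightedVolumeGrowth [ProperSpace M] (hx : IsIsometricImmersion x)
    (hst : ∀ φ : M → ℝ, LocallyLipschitz φ → HasCompactSupport φ →
      ∫ q, φ q ^ 2 ∂weightedVolume x ≤ ∫ q, gradInner m φ φ q ∂weightedVolume x) :
    ¬ HasQuadraticWeightedVolumeGrowth x := by
  rintro ⟨o, C, hC⟩
  have := isLocallyFiniteMeasure_weightedVolume hx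
  have hfin : ∀ r : ℝ, weightedVolume x (Metric.closedBall o r) ≠ ⊤ := fun r =>
    (isCompact_closedBall o r).measure_lt_top.ne
  obtain ⟨R₀, hR₀⟩ := eventually_atTop.1 hC
  -- First application of the doubling estimate: quadratic growth at radius 3R is absorbed by R⁻²,
  -- which gives the constant 9 = 3².
  have hb : ∀ R : ℝ, 1 ≤ R → R₀ ≤ R →
      (weightedVolume x).real (Metric.closedBall o R) ≤ 9 * |C| := by
    intro R h1 h2
    have hR : 0 < R := by linarith
    refine (measureReal_closedBall_le hx hst o hR).trans ?_
    have h3 : weightedVolume x (Metric.closedBall o (2 * R)) ≤ ENNReal.ofReal (|C| * (3 * R) ^ 2) :=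
      (measure_mono (Metric.closedBall_subset_ball (by linarith))).trans
        ((hR₀ (3 * R) (by linarith)).trans (ENNReal.ofReal_le_ofReal (by
          gcongr; exact le_abs_self C)))
    have h4 : (weightedVolume x).real (Metric.closedBall o (2 * R)) ≤ |C| * (3 * R) ^ 2 :=
      ENNReal.toReal_le_of_le_ofReal (by positivity) h3
    calc _ ≤ (1 / R) ^ 2 * (|C| * (3 * R) ^ 2) := by gcongr
      _ = _ := by field_simp; norm_num
  -- Second application: a bounded volume multiplied by R⁻² tends to zero.
  have h0 : (weightedVolume x).real (Metric.closedBall o 1) ≤ 0 := by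
    have ht : Tendsto (fun R : ℝ => (1 / R) ^ 2 * (9 * |C|)) atTop (𝓝 ((0 : ℝ) ^ 2 * (9 * |C|))) :=
      ((tendsto_const_nhds.div_atTop tendsto_id).pow 2).mul_const _
    rw [zero_pow two_ne_zero, zero_mul] at ht
    refine ge_of_tendsto ht ?_
    filter_upwards [eventually_ge_atTop 1, eventually_ge_atTop R₀] with R h1 h2
    calc (weightedVolume x).real (Metric.closedBall o 1)
        ≤ (weightedVolume x).real (Metric.closedBall o R) :=
          measureReal_mono (Metric.closedBall_subset_closedBall h1) (hfin R)
      _ ≤ _ := measureReal_closedBall_le hx hst o (by linarith)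
      _ ≤ _ := by
          gcongr
          exact hb _ (by linarith) (by linarith)
  have h1 := weightedVolume_pos hx (Metric.closedBall_mem_nhds o one_pos)
  have h2 := ENNReal.toReal_pos h1.ne' (hfin 1)
  exact absurd h2 (not_lt.2 h0)

end Stability

/-! ### Constancy of the squared norm of A under the curvature bound. -/

section Curvature

variable {m : ℕ} {M : Type*} [MetricSpace M] [ChartedSpace (EuclideanSpace ℝ (Fin m)) M]
  {x : M → EuclideanSpace ℝ (Fin (m + 1))}
  [IsManifold (𝓡 m) ∞ M] [RiemannianBundle (fun p : M => TangentSpace (𝓡 m) p)]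
  [MeasurableSpace M] [BorelSpace M] [SecondCountableTopology M] [IsRiemannianManifold (𝓡 m) M]

/-- The Caccioppoli inequality obtained from stability and a Simons type inequality. -/
theorem integral_caccioppoli (hx : IsSelfShrinker x)
    (hst : ∀ φ : M → ℝ, LocallyLipschitz φ → HasCompactSupport φ →
      ∫ q, φ q ^ 2 ∂weightedVolume x ≤ ∫ q, gradInner m φ φ q ∂weightedVolume x)
    {f G : M → ℝ} (hf : HasDriftLap x f G) (hf0 : ∀ q, 0 ≤ f q) {p : ℝ} (hp : 0 < p)
    (hfp : ∀ q, f q ≤ 1 + 1 / p) {ε : ℝ} (hε : 0 < ε)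
    (hG : ∀ q, 2 * f q * (1 - f q) + gradInner m f f q / (2 * (f q + ε)) ≤ G q) {φ : M → ℝ}
    (hφ : LocallyLipschitz φ) (hφc : HasCompactSupport φ) :
    Integrable (fun q => (f q + ε) ^ p * gradInner m φ φ q) (weightedVolume x) ∧
    (p - 1) / 2 * ∫ q, φ q * φ q * (f q + ε) ^ (p - 2) * gradInner m f f q ∂weightedVolume x ≤
      2 / p * ∫ q, (f q + ε) ^ p * gradInner m φ φ q ∂weightedVolume x := by
  have hxi := hx.toIsIsometricImmersion
  set μ := weightedVolume x
  have hfL := hf.locallyLipschitz hxi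
  have hc0 : ∀ q, 0 < f q + ε := fun q => add_pos_of_nonneg_of_pos (hf0 q) hε
  have hder : ∀ (s : ℝ) q, HasDerivAt (fun t : ℝ => (t + ε) ^ s) (s * (f q + ε) ^ (s - 1)) (f q) := by
    intro s q
    have := ((hasDerivAt_id (f q)).add_const ε).rpow_const (p := s) (Or.inl (hc0 q).ne')
    simpa using this
  have hpowL : ∀ s : ℝ, LocallyLipschitz fun q => (f q + ε) ^ s := fun s =>
    locallyLipschitz_comp hfL (g := fun t : ℝ => (t + ε) ^ s) fun a =>
      (contDiffAt_id.add contDiffAt_const).rpow_const_of_ne (hc0 a).ne'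
  have hφ2 := locallyLipschitz_mul hφ hφ
  have hφ2c : HasCompactSupport fun q => φ q * φ q := HasCompactSupport.mul_right hφc
  -- This function tests the differential inequality for f, while φ(f + ε)^(p/2) below tests
  -- stability. The exponents are matched so that both give the same integrals `A` and `B`.
  have hη : LocallyLipschitz fun q => φ q * φ q * (f q + ε) ^ (p - 1) :=
    locallyLipschitz_mul hφ2 (hpowL _)
  have hηc : HasCompactSupport fun q => φ q * φ q * (f q + ε) ^ (p - 1) :=
    HasCompactSupport.mul_right hφ2c
  have hψ : LocallyLipschitz fun q => φ q * (f q + ε) ^ (p / 2) :=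
    locallyLipschitz_mul hφ (hpowL _)
  have hψc : HasCompactSupport fun q => φ q * (f q + ε) ^ (p / 2) :=
    HasCompactSupport.mul_right hφc
  -- the integrands
  set A : M → ℝ := fun q => φ q * φ q * (f q + ε) ^ (p - 2) * gradInner m f f q with hA
  set B : M → ℝ := fun q => φ q * (f q + ε) ^ (p - 1) * gradInner m φ f q with hB
  set D : M → ℝ := fun q => (f q + ε) ^ p * gradInner m φ φ q with hD
  set E : M → ℝ := fun q => (φ q * (f q + ε) ^ (p / 2)) ^ 2 with hE
  have hAi : Integrable A μ := by
    refine integrable_mul_of_hasCompactSupport hxi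
      (hφ2.continuous.mul (hpowL _).continuous) (HasCompactSupport.mul_right hφ2c)
      (hf.continuous_gradInner hxi)
  have hηi := integrable_gradInner hxi hη hηc hfL
  have hψi := integrable_gradInner hxi hψ hψc hψ
  have hdφ := ae_hasDif hxi hφ
  have hdf := ae_hasDif hxi hfL
  have hr1 : ∀ q, (f q + ε) ^ (p - 1) = (f q + ε) ^ (p - 2) * (f q + ε) := fun q => by
    rw [← Real.rpow_add_one (hc0 q).ne']; ring_nf
  have hr2 : ∀ q, (f q + ε) ^ p = (f q + ε) ^ (p - 1) * (f q + ε) := fun q => by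
    rw [← Real.rpow_add_one (hc0 q).ne']; ring_nf
  have hr3 : ∀ q, (f q + ε) ^ (p / 2) * (f q + ε) ^ (p / 2) = (f q + ε) ^ p := fun q => by
    rw [← Real.rpow_add (hc0 q)]; ring_nf
  have hr4 : ∀ q, (f q + ε) ^ (p / 2) = (f q + ε) ^ (p / 2 - 1) * (f q + ε) := fun q => by
    rw [← Real.rpow_add_one (hc0 q).ne']; ring_nf
  have hη_eq : (gradInner m (fun q => φ q * φ q * (f q + ε) ^ (p - 1)) f) =ᵐ[μ]
      fun q => 2 * B q + (p - 1) * A q := by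
    filter_upwards [hdφ, hdf] with q hq hqf
    have hd : dif (m := m) (fun q => φ q * φ q * (f q + ε) ^ (p - 1)) q =
        (2 * (φ q * (f q + ε) ^ (p - 1))) • dif φ q +
          (φ q * φ q * ((p - 1) * (f q + ε) ^ (p - 2))) • dif f q := by
      have e1 := dif_mul (hq.mul hq) (hqf.comp (hder (p - 1) q))
      rw [dif_mul hq hq, dif_comp hqf (hder (p - 1) q), show p - 1 - 1 = p - 2 by ring] at e1
      rw [e1, smul_smul, ← add_smul, smul_smul, add_comm]
      congr 2
      ring
    rw [gradInner_of_dif_eq hd, hA, hB]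
    ring
  have hψ_eq : (gradInner m (fun q => φ q * (f q + ε) ^ (p / 2))
      (fun q => φ q * (f q + ε) ^ (p / 2))) =ᵐ[μ] fun q => D q + p * B q + p ^ 2 / 4 * A q := by
    filter_upwards [hdφ, hdf] with q hq hqf
    have hd : dif (m := m) (fun q => φ q * (f q + ε) ^ (p / 2)) q =
        (f q + ε) ^ (p / 2) • dif φ q + (φ q * (p / 2 * (f q + ε) ^ (p / 2 - 1))) • dif f q := by
      have e1 := dif_mul hq (hqf.comp (hder (p / 2) q))
      rw [dif_comp hqf (hder (p / 2) q)] at e1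
      rw [e1, smul_smul, add_comm]
    rw [gradInner_of_dif_eq hd, gradInner_comm φ, gradInner_comm f, gradInner_of_dif_eq hd,
      gradInner_of_dif_eq hd, gradInner_comm f φ, hA, hB, hD]
    simp only
    have h2 := hr2 q
    have h3 := hr3 q
    have h4 := hr4 q
    have h1 := hr1 q
    set c := f q + ε
    set w := c ^ (p / 2)
    set w' := c ^ (p / 2 - 1)
    have hc : c ≠ 0 := (hc0 q).ne'
    have h5 : w * w' = c ^ (p - 1) := by
      refine mul_right_cancel₀ hc ?_
      rw [mul_assoc, ← h4, h3, h2]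
    have h6 : w' * w' = c ^ (p - 2) := by
      refine mul_right_cancel₀ hc ?_
      rw [mul_assoc, ← h4, mul_comm, h5, h1]
    rw [← h6, ← h5, ← h3]
    ring
  have hBi : Integrable B μ := by
    have : Integrable (fun q => (1 / 2) * (gradInner m (fun q => φ q * φ q * (f q + ε) ^ (p - 1)) f q -
        (p - 1) * A q)) μ := (hηi.sub (hAi.const_mul _)).const_mul _
    refine this.congr ?_
    filter_upwards [hη_eq] with q hq
    rw [hq]; ring
  have hDi : Integrable D μ := by
    refine ((hψi.sub (hBi.const_mul p)).sub (hAi.const_mul (p ^ 2 / 4))).congr ?_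
    filter_upwards [hψ_eq] with q hq
    simp only [Pi.sub_apply]
    rw [hq]; ring
  have hEi : Integrable E μ := by
    refine (integrable_mul_of_hasCompactSupport hxi hψ.continuous hψc hψ.continuous).congr
      (Eventually.of_forall fun q => ?_)
    simp only [hE, pow_two]
  refine ⟨hDi, ?_⟩
  have hs := hst _ hψ hψc
  have hDB : Integrable (fun q => D q + p * B q) μ := hDi.add (hBi.const_mul p)
  rw [integral_congr_ae hψ_eq, integral_add hDB (hAi.const_mul _),
    integral_add hDi (hBi.const_mul _), integral_const_mul, integral_const_mul] at hs
  have hi := integral_gradInner hx hf hη hηc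
  rw [integral_congr_ae hη_eq, integral_add (hBi.const_mul _) (hAi.const_mul _),
    integral_const_mul, integral_const_mul] at hi
  have hl : (1 / 2) * ∫ q, A q ∂μ - 2 / p * ∫ q, E q ∂μ ≤
      ∫ q, φ q * φ q * (f q + ε) ^ (p - 1) * G q ∂μ := by
    rw [← integral_const_mul, ← integral_const_mul, ← integral_sub (hAi.const_mul _) (hEi.const_mul _)]
    refine integral_mono ((hAi.const_mul _).sub (hEi.const_mul _))
      (integrable_mul_of_hasCompactSupport hxi hη.continuous hηc (hf.continuous hxi)) fun q => ?_
    simp only [hA, hE]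
    have hk : 0 ≤ φ q * φ q * (f q + ε) ^ (p - 1) :=
      mul_nonneg (mul_self_nonneg _) (Real.rpow_nonneg (hc0 q).le _)
    refine le_trans ?_ (mul_le_mul_of_nonneg_left (hG q) hk)
    -- This is where f ≤ 1 + 1/p enters. The reaction term is then bounded by 2/p times the quantity
    -- `E` that stability controls.
    have h1 : -(2 / p) * (f q + ε) ≤ 2 * f q * (1 - f q) := by
      have h2 : -(1 / p) ≤ 1 - f q := by linarith [hfp q]
      have h3 : 0 < 1 / p := by positivity
      have h4 : 2 / p = 2 * (1 / p) := by ring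
      rw [h4]
      nlinarith [hf0 q]
    have h2 : (φ q * (f q + ε) ^ (p / 2)) ^ 2 = φ q * φ q * (f q + ε) ^ (p - 1) * (f q + ε) := by
      rw [mul_assoc _ _ (f q + ε), ← hr2, ← hr3]; ring
    rw [h2, mul_add (φ q * φ q * (f q + ε) ^ (p - 1)) (2 * f q * (1 - f q))]
    have h3 : φ q * φ q * (f q + ε) ^ (p - 1) * (gradInner m f f q / (2 * (f q + ε))) =
        1 / 2 * (φ q * φ q * (f q + ε) ^ (p - 2) * gradInner m f f q) := by
      have := (hc0 q).ne'
      rw [hr1]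
      field_simp
    rw [h3]
    have := mul_le_mul_of_nonneg_left h1 hk
    linarith
  -- Multiplying stability by 2/p makes its cross term 2∫B, the one produced by Green's formula, so
  -- it cancels. The coefficient left for ∫A is 1/2 + (p - 1) - p/2 = (p - 1)/2.
  have h2p : 2 / p * ∫ q, E q ∂μ ≤ 2 / p * ((∫ q, D q ∂μ) + p * (∫ q, B q ∂μ) +
      p ^ 2 / 4 * ∫ q, A q ∂μ) := mul_le_mul_of_nonneg_left hs (by positivity)
  have h3p : 2 / p * ((∫ q, D q ∂μ) + p * (∫ q, B q ∂μ) + p ^ 2 / 4 * ∫ q, A q ∂μ) =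
      2 / p * (∫ q, D q ∂μ) + 2 * (∫ q, B q ∂μ) + p / 2 * ∫ q, A q ∂μ := by
    field_simp
    ring
  rw [h3p] at h2p
  change (p - 1) / 2 * ∫ q, A q ∂μ ≤ 2 / p * ∫ q, D q ∂μ
  linarith

/-- A stable self-shrinker satisfying the curvature bound has constant `|A|²`. -/
theorem gradInner_normSqA_eq_zero [ProperSpace M] (hx : IsSelfShrinker x)
    (hst : ∀ φ : M → ℝ, LocallyLipschitz φ → HasCompactSupport φ →
      ∫ q, φ q ^ 2 ∂weightedVolume x ≤ ∫ q, gradInner m φ φ q ∂weightedVolume x)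
    {p : ℝ} (hp : 1 < p) (hLp : MemLp (normSqA x) (ENNReal.ofReal p) (weightedVolume x))
    (hle : ∀ q, normSqA x q ≤ 1 + 1 / p) (o : M) :
    gradInner m (normSqA x) (normSqA x) o = 0 := by
  have hxi := hx.toIsIsometricImmersion
  have := isLocallyFiniteMeasure_weightedVolume hxi
  have := isOpenPosMeasure_weightedVolume hxi
  have hp0 : 0 < p := by linarith
  obtain ⟨G, hf, hG⟩ := exists_hasDriftLap_normSqA hx
  set f := normSqA x with hfdef
  set μ := weightedVolume x
  have hf0 : ∀ q, 0 ≤ f q := normSqA_nonneg x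
  have hf2 : ∀ q, f q ≤ 2 := fun q => (hle q).trans (by
    have : 1 / p ≤ 1 := (div_le_one hp0).2 hp.le
    linarith)
  have hΓ0 : ∀ q, 0 ≤ gradInner m f f q := gradInner_self_nonneg f
  -- Where f vanishes, Simons' inequality bounds the squared gradient by 2εG for every ε > 0, so it
  -- is zero. The integral argument below covers the points with f > 0.
  rcases (hf0 o).eq_or_lt with h0 | h0
  · refine le_antisymm (le_of_forall_pos_le_add fun δ hδ => ?_) (hΓ0 o)
    rw [zero_add]
    have h1 := hG o (δ / (2 * (|G o| + 1))) (by positivity)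
    rw [← h0, mul_zero, zero_mul, zero_add, zero_add, div_le_iff₀ (by positivity)] at h1
    refine h1.trans ?_
    have h2 : 2 * (δ / (2 * (|G o| + 1))) = δ / (|G o| + 1) := by field_simp
    rw [h2, mul_div_assoc', div_le_iff₀ (by positivity), mul_comm]
    gcongr
    linarith [le_abs_self (G o)]
  have hfc : Continuous f := (hf.locallyLipschitz hxi).continuous
  have hfp : Integrable (fun q => f q ^ p) μ := by
    have h1 := hLp.integrable_norm_rpow (by simpa using hp0) ENNReal.ofReal_ne_top
    rw [ENNReal.toReal_ofReal hp0.le] at h1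
    refine h1.congr (Eventually.of_forall fun q => ?_)
    simp only [Real.norm_of_nonneg (hf0 q)]
  -- The weight f^p replaces (f + ε)^(p - 2), which could blow up as ε → 0 at zeros of f. It makes k
  -- continuous and free of ε, and it is positive at o.
  set k : M → ℝ := fun q => cutoff o 1 q * cutoff o 1 q * (f q ^ p * gradInner m f f q) with hk
  have hkc : Continuous k := by
    have := (lipschitzWith_cutoff o one_pos).continuous
    have := hfc.rpow_const fun q => Or.inr hp0.le
    have := hf.continuous_gradInner hxi
    fun_prop
  have hks : HasCompactSupport k :=
    HasCompactSupport.mul_right (HasCompactSupport.mul_right (hasCompactSupport_cutoff o one_pos))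
  have hki : Integrable k μ := hkc.integrable_of_hasCompactSupport hks
  have hk0 : 0 ≤ k := fun q => mul_nonneg (mul_self_nonneg _)
    (mul_nonneg (Real.rpow_nonneg (hf0 q) _) (hΓ0 q))
  have hmain : ∀ R : ℝ, 2 ≤ R → ∫ q, k q ∂μ ≤
      18 / (p - 1) * (2 / p) * (1 / R) ^ 2 * 2 ^ p * ∫ q, f q ^ p ∂μ := by
    intro R hR2
    have hR : 0 < R := by linarith
    set b := Metric.closedBall o (2 * R)
    have hb : MeasurableSet b := Metric.isClosed_closedBall.measurableSet
    have hbfin : μ b ≠ ⊤ := (isCompact_closedBall o (2 * R)).measure_lt_top.ne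
    -- For fixed R the error is ε times the volume of a ball. It is removed by ε → 0 before R → ∞,
    -- since those volumes are not known to be bounded.
    have hε : ∀ ε : ℝ, 0 < ε → ε ≤ 1 → ∫ q, k q ∂μ ≤
        18 / (p - 1) * (2 / p) * (1 / R) ^ 2 * 2 ^ p * ((∫ q, f q ^ p ∂μ) + ε * μ.real b) := by
      intro ε hε0 hε1
      have hc0 : ∀ q, 0 < f q + ε := fun q => add_pos_of_nonneg_of_pos (hf0 q) hε0
      have hφ := (lipschitzWith_cutoff o hR).locallyLipschitz
      have hφc := hasCompactSupport_cutoff o hR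
      obtain ⟨hDi, hcac⟩ := integral_caccioppoli hx hst hf hf0 hp0 hle hε0 (fun q => hG q ε hε0) hφ hφc
      have hD : ∫ q, (f q + ε) ^ p * gradInner m (cutoff o R) (cutoff o R) q ∂μ ≤
          (1 / R) ^ 2 * 2 ^ p * ((∫ q, f q ^ p ∂μ) + ε * μ.real b) := by
        have hind : Integrable (b.indicator fun _ => ε) μ :=
          (integrable_indicator_iff hb).2 (integrableOn_const hbfin)
        calc _ ≤ ∫ q, (1 / R) ^ 2 * 2 ^ p * (f q ^ p + b.indicator (fun _ => ε) q) ∂μ := by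
              refine integral_mono hDi ((hfp.add hind).const_mul _) fun q => ?_
              simp only
              have h1 := gradInner_cutoff_le hxi o hR q
              have hfq : 0 ≤ f q ^ p := Real.rpow_nonneg (hf0 q) _
              by_cases hq : q ∈ b
              · rw [Set.indicator_of_mem hq] at h1 ⊢
                have h2 : (f q + ε) ^ p ≤ 2 ^ p * (f q ^ p + ε) := by
                  have h3 : f q + ε ≤ 2 * max (f q) ε := by
                    linarith [le_max_left (f q) ε, le_max_right (f q) ε]
                  have h4 : max (f q) ε ^ p ≤ f q ^ p + ε := by
                    have h5 : ε ^ p ≤ ε := by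
                      simpa using Real.rpow_le_rpow_of_exponent_ge hε0 hε1 hp.le
                    rcases max_choice (f q) ε with h | h <;> rw [h] <;> linarith
                  calc (f q + ε) ^ p ≤ (2 * max (f q) ε) ^ p :=
                        Real.rpow_le_rpow (hc0 q).le h3 hp0.le
                    _ = 2 ^ p * max (f q) ε ^ p :=
                        Real.mul_rpow zero_le_two (hε0.le.trans (le_max_right _ _))
                    _ ≤ _ := by gcongr
                calc _ ≤ 2 ^ p * (f q ^ p + ε) * (1 / R) ^ 2 := by
                      gcongr
                      exact gradInner_self_nonneg _ q
                  _ = _ := by ring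
              · rw [Set.indicator_of_notMem hq] at h1 ⊢
                have h2 : (f q + ε) ^ p * gradInner m (cutoff o R) (cutoff o R) q ≤ 0 :=
                  mul_nonpos_of_nonneg_of_nonpos (Real.rpow_nonneg (hc0 q).le _) h1
                refine h2.trans ?_
                positivity
          _ = _ := by
              rw [integral_const_mul, integral_add hfp hind, integral_indicator_const _ hb,
                smul_eq_mul, mul_comm (μ.real b)]
      have hkA : ∫ q, k q ∂μ ≤ 9 * ∫ q, cutoff o R q * cutoff o R q * (f q + ε) ^ (p - 2) *
          gradInner m f f q ∂μ := by
        rw [← integral_const_mul]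
        refine integral_mono hki ((integrable_mul_of_hasCompactSupport hxi
          (hφ.continuous.mul hφ.continuous |>.mul ((hfc.add continuous_const).rpow_const
            fun q => Or.inl (hc0 q).ne')) (HasCompactSupport.mul_right
              (HasCompactSupport.mul_right hφc)) (hf.continuous_gradInner hxi)).const_mul _)
          fun q => ?_
        simp only [hk]
        -- The inner cutoff vanishes at distance 2 and beyond, so R ≥ 2 is what is needed.
        have h1 : cutoff o 1 q ≤ cutoff o R q := by
          rcases le_total (dist q o) R with h | h
          · rw [cutoff_eq_one hR h]; exact cutoff_le_one _ _ _
          · rw [cutoff_eq_zero one_pos (by linarith)]; exact cutoff_nonneg _ _ _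
        have h2 : f q ^ p ≤ 9 * (f q + ε) ^ (p - 2) := by
          have h3 : f q ^ p ≤ (f q + ε) ^ p := Real.rpow_le_rpow (hf0 q) (by linarith) hp0.le
          have h4 : (f q + ε) ^ p = (f q + ε) ^ (p - 2) * (f q + ε) ^ 2 := by
            rw [← Real.rpow_add_natCast (hc0 q).ne']; norm_num
          -- The 9 is (2 + 1)², from f ≤ 2 and ε ≤ 1.
          have h5 : (f q + ε) ^ 2 ≤ 9 := by nlinarith [hf2 q, hc0 q]
          rw [h4] at h3
          have h6 := mul_le_mul_of_nonneg_left h5 (Real.rpow_nonneg (hc0 q).le (p - 2))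
          linarith
        have h7 := cutoff_nonneg o 1 q
        have h8 := cutoff_nonneg o R q
        calc cutoff o 1 q * cutoff o 1 q * (f q ^ p * gradInner m f f q)
            ≤ cutoff o R q * cutoff o R q * (9 * (f q + ε) ^ (p - 2) * gradInner m f f q) := by
              have := hΓ0 q
              have := Real.rpow_nonneg (hf0 q) p
              gcongr
          _ = _ := by ring
      have hp1 : 0 < p - 1 := by linarith
      have h9 : ∫ q, cutoff o R q * cutoff o R q * (f q + ε) ^ (p - 2) * gradInner m f f q ∂μ ≤
          2 / (p - 1) * (2 / p * ((1 / R) ^ 2 * 2 ^ p * ((∫ q, f q ^ p ∂μ) + ε * μ.real b))) := by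
        have h10 := hcac.trans (mul_le_mul_of_nonneg_left hD (by positivity))
        have h11 := mul_le_mul_of_nonneg_left h10 (show 0 ≤ 2 / (p - 1) by positivity)
        have h12 : 2 / (p - 1) * ((p - 1) / 2) = 1 := by field_simp
        rwa [← mul_assoc, h12, one_mul] at h11
      refine hkA.trans ((mul_le_mul_of_nonneg_left h9 (by norm_num)).trans (le_of_eq ?_))
      ring
    have ht : Tendsto (fun ε : ℝ => 18 / (p - 1) * (2 / p) * (1 / R) ^ 2 * 2 ^ p *
        ((∫ q, f q ^ p ∂μ) + ε * μ.real b)) (𝓝[>] 0)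
        (𝓝 (18 / (p - 1) * (2 / p) * (1 / R) ^ 2 * 2 ^ p *
          ((∫ q, f q ^ p ∂μ) + 0 * μ.real b))) := by
      refine Tendsto.mono_left ?_ nhdsWithin_le_nhds
      exact Continuous.tendsto (by fun_prop) 0
    rw [zero_mul, add_zero] at ht
    refine ge_of_tendsto ht ?_
    filter_upwards [Ioc_mem_nhdsGT one_pos] with ε hε'
    exact hε ε hε'.1 hε'.2
  have hint : ∫ q, k q ∂μ ≤ 0 := by
    have ht : Tendsto (fun R : ℝ => 18 / (p - 1) * (2 / p) * (1 / R) ^ 2 * 2 ^ p *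
        ∫ q, f q ^ p ∂μ) atTop
        (𝓝 (18 / (p - 1) * (2 / p) * (0 : ℝ) ^ 2 * 2 ^ p * ∫ q, f q ^ p ∂μ)) :=
      ((((tendsto_const_nhds.div_atTop tendsto_id).pow 2).const_mul _).mul_const _).mul_const _
    rw [zero_pow two_ne_zero, mul_zero, zero_mul, zero_mul] at ht
    refine ge_of_tendsto ht ?_
    filter_upwards [eventually_ge_atTop 2] with R hR using hmain R hR
  by_contra hne
  refine absurd hint (not_le.2 (hkc.integral_pos_of_hasCompactSupport_nonneg_nonzero hks hk0
    (x := o) ?_))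
  simp only [hk, cutoff_eq_one one_pos ((dist_self o).trans_le zero_le_one), one_mul]
  exact mul_ne_zero (Real.rpow_pos_of_pos h0 _).ne' hne

end Curvature

/-! ### Conclusion of the half-space theorem. -/

section HalfSpace

variable {m : ℕ} {M : Type*} [MetricSpace M] [ChartedSpace (EuclideanSpace ℝ (Fin m)) M]
  {x : M → EuclideanSpace ℝ (Fin (m + 1))}
  [IsManifold (𝓡 m) ∞ M] [RiemannianBundle (fun p : M => TangentSpace (𝓡 m) p)]
  [MeasurableSpace M] [BorelSpace M] [SecondCountableTopology M] [IsRiemannianManifold (𝓡 m) M]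
  [ConnectedSpace M] [CompleteSpace M]

/-- The half-space theorem for self-shrinkers. -/
theorem eq_hyperplane_of_inner_nonneg (hx : IsSelfShrinker x)
    (h : HasExtrinsicPolynomialVolumeGrowth x ∨ HasQuadraticWeightedVolumeGrowth x ∨
      HasCurvatureBound x) {a : EuclideanSpace ℝ (Fin (m + 1))} (ha : a ≠ 0)
    (hside : ∀ p : M, 0 ≤ (inner ℝ a (x p) : ℝ)) :
    Function.Injective x ∧ Set.range x = {y | inner ℝ a y = (0 : ℝ)} := by
  have hxi := hx.toIsIsometricImmersion
  rcases inner_eq_zero_or_pos hx hside with h0 | hpos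
  · exact eq_hyperplane_of_inner_eq_zero hxi ha h0
  exfalso
  have : LocallyCompactSpace M := ChartedSpace.locallyCompactSpace (EuclideanSpace ℝ (Fin m)) M
  have : ProperSpace M := properSpace_of_splitsDistances (splitsDistances (m := m))
  have hst : ∀ φ : M → ℝ, LocallyLipschitz φ → HasCompactSupport φ →
      ∫ q, φ q ^ 2 ∂weightedVolume x ≤ ∫ q, gradInner m φ φ q ∂weightedVolume x :=
    fun φ hφ hφc => integral_sq_le_integral_gradInner hx (hasDriftLap_inner hx a) hpos hφ hφc
  have hgrowth := not_hasQuadraticWeightedVolumeGrowth hxi hst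
  rcases h with h | h | ⟨p, hp, hLp, hle⟩
  · exact hgrowth (hasQuadraticWeightedVolumeGrowth_of_finite
      (weightedVolume_univ_ne_top_of_extrinsic hxi h))
  · exact hgrowth h
  · obtain ⟨G, hG, -⟩ := exists_hasDriftLap_normSqA hx
    obtain ⟨o⟩ := (inferInstance : Nonempty M)
    have hconst : normSqA x = fun _ => normSqA x o := funext fun q =>
      hG.eq_const hxi (gradInner_normSqA_eq_zero hx hst hp hLp hle) q o
    -- If A = 0, the image is a full hyperplane through the origin, so the height vanishes
    -- somewhere. If |A|² is a nonzero constant, its membership in L^p makes the weighted volume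
    -- finite.
    rcases eq_or_ne (normSqA x o) 0 with hq | hq
    · obtain ⟨n, hn, hxn⟩ := exists_hyperplane_of_normSqA_eq_zero hx
        fun q => (congrFun hconst q).trans hq
      have h0 : (0 : EuclideanSpace ℝ (Fin (m + 1))) ∈ Set.range x := by
        rw [(eq_hyperplane_of_inner_eq_zero hxi hn hxn).2]
        exact inner_zero_right n
      obtain ⟨p₀, hp₀⟩ := h0
      have := hpos p₀
      rw [hp₀, inner_zero_right] at this
      exact lt_irrefl _ this
    · rw [hconst, memLp_const_iff (by simpa using by linarith) ENNReal.ofReal_ne_top] at hLp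
      exact hgrowth (hasQuadraticWeightedVolumeGrowth_of_finite (hLp.resolve_left hq).ne)

end HalfSpace

end SelfShrinker

end

theorem mainTheorem4 {m : ℕ} {M : Type*} [MetricSpace M] [SecondCountableTopology M]
    [ConnectedSpace M] [NoncompactSpace M] [MeasurableSpace M] [BorelSpace M]
    [ChartedSpace (EuclideanSpace ℝ (Fin m)) M] [IsManifold (𝓡 m) ∞ M]
    [RiemannianBundle (fun p : M => TangentSpace (𝓡 m) p)]
    [IsContMDiffRiemannianBundle (𝓡 m) ∞ (EuclideanSpace ℝ (Fin m))
      (fun p : M => TangentSpace (𝓡 m) p)]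
    [IsRiemannianManifold (𝓡 m) M] [CompleteSpace M]
    (x : M → EuclideanSpace ℝ (Fin (m + 1))) (hx : SelfShrinker.IsSelfShrinker x)
    (h : SelfShrinker.HasExtrinsicPolynomialVolumeGrowth x ∨
      SelfShrinker.HasQuadraticWeightedVolumeGrowth x ∨ SelfShrinker.HasCurvatureBound x)
    (a : EuclideanSpace ℝ (Fin (m + 1))) (ha : a ≠ 0)
    (hside : (∀ p : M, 0 ≤ inner ℝ a (x p)) ∨ (∀ p : M, inner ℝ a (x p) ≤ 0)) :
    Function.Injective x ∧ Set.range x = {y | inner ℝ a y = (0 : ℝ)} := by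
  rcases hside with hside | hside
  · exact SelfShrinker.eq_hyperplane_of_inner_nonneg hx h ha hside
  · have := SelfShrinker.eq_hyperplane_of_inner_nonneg hx h (neg_ne_zero.2 ha) fun p => by
      rw [inner_neg_left]; exact neg_nonneg.2 (hside p)
    simpa only [inner_neg_left, neg_eq_zero] using this
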